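/- Let $n\ge 2$, let $\mathbb P^n=\{z\in\mathbb C^n: |z_i|<1,\ i=1,\dots,n\}$ be the polydisk, and let $|z|_\infty=\max_i|z_i|$. Consider a system $$\frac{\partial^2u}{\partial z_i\partial z_j}=\sum_{k=1}^nP^k_{ij}(z)\frac{\partial u}{\partial z_k}+P^0_{ij}(z)\,u,\qquad i,j=1,\dots,n,$$ whose coefficients $P^k_{ij}$, $P^0_{ij}$ are holomorphic in $\mathbb P^n$. Suppose that the system is completely integrable, i.e. it has $n+1$ linearly independent holomorphic solutions in $\mathbb P^n$, and that it is in canonical form, i.e. $\sum_{j=1}^nP^j_{ij}\equiv0$ for $i=1,\dots,n$. For $z\in\mathbb P^n$ and $v\in\mathbb C^n$ let $$\|v\|_z=\Bigl(2\sum_{i=1}^n\frac{|v_i|^2}{(1-|z_i|^2)^2}\Bigr)^{1/2}$$ be the Bergman norm of $v$ at $z$, let $S(z)(v)\in\mathbb C^n$ be the vector with components $\sum_{i,j=1}^nP^k_{ij}(z)v_iv_j$, $k=1,\dots,n$, and let $$\|P\|=\sup_{z\in\mathbb P^n}\ \sup_{\|v\|_z=1}\|S(z)(v)\|_z .$$ Let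 $\alpha\ge0$ satisfy $\|P\|\le\alpha$ and $$n\sqrt n\,\alpha\le\frac1{6.1},$$ and let $u$ be the holomorphic solution of the system in $\mathbb P^n$ with $u(0)=1$ and $\nabla u(0)=0$. Then, for every $z\in\mathbb P^n$, $$\bigl(1-|z|_\infty^2\bigr)^{\sqrt n/2}\ \le\ |u(z)|\ \le\ \frac1{\bigl(1-|z|_\infty^2\bigr)^{\sqrt n/2}} .$$ -/

import Mathlib

open scoped NNReal ENNReal

noncomputable section

namespace PolydiskSchwarzian

/-- The unit polydisk in `ℂⁿ`. The norm of `Fin n → ℂ` is the polydisk norm `|z|_∞ = max_i |z_i|`. -/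
def polydisk (n : ℕ) : Set (Fin n → ℂ) := {z | ∀ i, ‖z i‖ < 1}

/-- The complex partial derivative `∂u/∂z_i`. -/
def pderiv {n : ℕ} (i : Fin n) (u : (Fin n → ℂ) → ℂ) (z : Fin n → ℂ) : ℂ :=
  fderiv ℂ u z (Pi.single i 1)

/-- The coefficients of a linear system
`∂²u/∂z_i∂z_j = ∑_k P^k_{ij} ∂u/∂z_k + P^0_{ij} u`, `1 ≤ i, j ≤ n`. -/
structure LinearSystem (n : ℕ) where
  /-- `P k i j` is the coefficient function `P^k_{ij}`, `1 ≤ k ≤ n`. -/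
  P : Fin n → Fin n → Fin n → (Fin n → ℂ) → ℂ
  /-- `P₀ i j` is the coefficient function `P^0_{ij}`. -/
  P₀ : Fin n → Fin n → (Fin n → ℂ) → ℂ

namespace LinearSystem

variable {n : ℕ}

/-- All coefficients are holomorphic in the polydisk. -/
def HasHolomorphicCoeffs (L : LinearSystem n) : Prop :=
  (∀ k i j, DifferentiableOn ℂ (L.P k i j) (polydisk n)) ∧
    ∀ i j, DifferentiableOn ℂ (L.P₀ i j) (polydisk n)

/-- `u` is a holomorphic solution of the system in the polydisk. -/
def IsSolution (L : LinearSystem n) (u : (Fin n → ℂ) → ℂ) : Prop :=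
  DifferentiableOn ℂ u (polydisk n) ∧
    ∀ z ∈ polydisk n, ∀ i j,
      pderiv i (pderiv j u) z = ∑ k, L.P k i j z * pderiv k u z + L.P₀ i j z * u z

/-- Complete integrability: there are `n + 1` solutions in the polydisk that are linearly
independent over `ℂ` (as functions on the polydisk). -/
def CompletelyIntegrable (L : LinearSystem n) : Prop :=
  ∃ w : Fin (n + 1) → (Fin n → ℂ) → ℂ,
    (∀ m, L.IsSolution (w m)) ∧ LinearIndependent ℂ (fun m (z : polydisk n) => w m z)

/-- Canonical form: `∑_j P^j_{ij} = 0` in the polydisk for every `i`. -/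
def IsCanonical (L : LinearSystem n) : Prop :=
  ∀ z ∈ polydisk n, ∀ i, ∑ j, L.P j i j z = 0

/-- The quadratic operator `S(z)(v) = (vᵗ P^1(z) v, …, vᵗ P^n(z) v)`. If `P^k_{ij}` are the
Schwarzian derivatives `S^k_{ij} f` of a locally biholomorphic mapping `f`, this is the Schwarzian
derivative operator `S_f(z)`, which depends on `f` through these coefficients only. -/
def op (L : LinearSystem n) (z v : Fin n → ℂ) : Fin n → ℂ :=
  fun k => ∑ i, ∑ j, v i * L.P k i j z * v j

end LinearSystem

/-- The Bergman norm `‖v‖ = (2 ∑_i |v_i|² / (1 - |z_i|²)²)^{1/2}` of a tangent vector `v` at a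
point `z` of the polydisk. -/
def bergmanNorm {n : ℕ} (z v : Fin n → ℂ) : ℝ :=
  √(2 * ∑ i, ‖v i‖ ^ 2 / (1 - ‖z i‖ ^ 2) ^ 2)

/-- `‖P‖ = sup_{z ∈ ℙⁿ} sup_{‖v‖ = 1} ‖S(z)(v)‖`, all norms of tangent vectors at `z` being Bergman
norms at `z`; the value is `∞` if the supremum is not finite. -/
def LinearSystem.opNorm {n : ℕ} (L : LinearSystem n) : ℝ≥0∞ :=
  ⨆ z ∈ polydisk n, ⨆ v : Fin n → ℂ, ⨆ _ : bergmanNorm z v = 1,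
    ENNReal.ofReal (bergmanNorm z (L.op z v))

end PolydiskSchwarzian

end

noncomputable section

namespace PolydiskSchwarzian

open Metric Set Filter Topology

/-! ### Holomorphic functions of several variables and their partial derivatives -/

section Holomorphic

variable {n : ℕ} {f g : (Fin n → ℂ) → ℂ} {U : Set (Fin n → ℂ)}

/-! The norm bound makes the system almost diagonal. Testing S(z) on vectors with one or two nonzero
coordinates gives |P^k_{ij}| (1 - |z_i|²)(1 - |z_j|²) ≤ √2 α (1 - |z_k|²) (`norm_P_le`). If k ∉ {i,
j}, the right side tends to 0 as |z_k| → 1 with the other coordinates fixed, and the maximum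
principle in z_k gives P^k_{ij} = 0 (`P_eq_zero`). Only the coefficients P^m_{ml} survive, with
|P^m_{ml}| (1 - |z_l|²) ≤ ε, and the integrability conditions express P^0 through them
(`CompletelyIntegrable.regular`).

Hence on a hyperplane z_k = const the tangential 1-jet of a solution obeys a closed linear system.
Let e_k be the solution with e_k(0) = 0 and ∇e_k(0) the k-th basis vector. For each value of z_k
some combination e_k + ∑_m M_km(z_k) e_m - A_k(z_k) u vanishes on the hyperplane together with its
tangential derivatives. Used as row operations, these combinations make the Wronskian of u, e_1, …,
e_n block triangular. In canonical form that Wronskian is constantly 1, so det(1 + M) = u ∏_k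
exp(l_k) (u - ∑_m R_km e_m), with A_k' = exp(l_k) and M_km' = R_km exp(l_k)
(`exists_axisFactorization`). This is a formula for u^(n+1).

The functions A, l, R, M live on the coordinate axes, where the system is solved by quadratures
(`AxisData.estimates`): l_k grows at most like 3 ε artanh |z_k|, while R and M are of size ε.
Moreover log det(1 + M) is of second order because M has zero diagonal. Taking logarithms, (n + 1)
|log |u|| ≤ n (constant + 3 ε artanh |z|_∞) (`Regular.abs_log_le`).

For |z|_∞ ≥ 9/10 this is enough. For smaller z the constant is useless near the origin, but on each
complex line through 0 the function log u vanishes to second order, with leading coefficient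
controlled by P^0(0). The Schwarz–Pick lemma applied to (n + 1) log u / t² then gives the estimate
(`Regular.abs_log_le_sq`). What remains is numerical: n = 2 is run with √(3/2) α in place of √2 α
(`Regular.of_two`), and all n ≥ 3 are treated by one set of constants. -/

theorem exists_norm_fderiv_le (hU : IsOpen U) (hf : DifferentiableOn ℂ f U) {x : Fin n → ℂ}
    (hx : x ∈ U) :
    ∃ δ > 0, ∃ C, ball x (3 * δ) ⊆ U ∧ ∀ w ∈ ball x (2 * δ), ‖fderiv ℂ f w‖ ≤ C := by
  obtain ⟨r, hr, hrU⟩ := nhds_basis_closedBall.mem_iff.1 (hU.mem_nhds hx)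
  obtain ⟨B, hB⟩ := (isCompact_closedBall x r).exists_bound_of_continuousOn
    (hf.continuousOn.mono hrU)
  refine ⟨r / 4, by positivity, 2 * B / (r / 4),
    (ball_subset_closedBall.trans (closedBall_subset_closedBall (by linarith))).trans hrU,
    fun w hw => ?_⟩
  rw [mem_ball] at hw
  have hsub : ball w (r / 4) ⊆ closedBall x r := by
    intro y hy
    rw [mem_ball] at hy
    rw [mem_closedBall]
    linarith [dist_triangle y w x]
  refine Complex.norm_fderiv_le_div_of_mapsTo_ball (hf.mono (hsub.trans hrU)) ?_ (by positivity)
  intro y hy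
  rw [mem_closedBall, dist_eq_norm]
  have h1 := hB y (hsub hy)
  have h2 := hB w (hsub (mem_ball_self (by positivity)))
  linarith [norm_sub_le (f y) (f w)]

theorem hasDerivAt_comp_line {x v : Fin n → ℂ} {ξ : ℂ} (hf : DifferentiableAt ℂ f (x + ξ • v)) :
    HasDerivAt (fun ζ : ℂ => f (x + ζ • v)) (fderiv ℂ f (x + ξ • v) v) ξ := by
  have h1 : HasDerivAt (fun ζ : ℂ => x + ζ • v) v ξ := by
    simpa using ((hasDerivAt_id ξ).smul_const v).const_add x
  exact hf.hasFDerivAt.comp_hasDerivAt ξ h1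

/-- Cauchy's formula writes the derivative in a coordinate direction as an integral of f over
translated circles. That integral can be differentiated under the integral sign in all variables at
once, the local bound of `exists_norm_fderiv_le` providing the dominating function. -/
theorem differentiableOn_pderiv (hU : IsOpen U) (hf : DifferentiableOn ℂ f U) (i : Fin n) :
    DifferentiableOn ℂ (pderiv i f) U := by
  intro x hx
  obtain ⟨δ, hδ, C, hsub, hC⟩ := exists_norm_fderiv_le hU hf hx
  set v : Fin n → ℂ := Pi.single i 1 with hv
  have hvn : ‖v‖ = 1 := by simp [hv, Pi.norm_single]
  set c : ℝ → ℂ := fun θ => deriv (circleMap 0 δ) θ * ((circleMap 0 δ θ - 0) ^ 2)⁻¹ with hc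
  have hcm : ∀ θ, circleMap 0 δ θ ≠ 0 := fun θ => by
    simpa using circleMap_ne_center (c := 0) (R := δ) (θ := θ) hδ.ne'
  have hcc : Continuous c := by
    have h1 : Continuous (deriv (circleMap 0 δ)) := by
      have : deriv (circleMap 0 δ) = fun θ => circleMap 0 δ θ * Complex.I := by
        ext θ; exact deriv_circleMap 0 δ θ
      rw [this]; exact (continuous_circleMap 0 δ).mul continuous_const
    refine h1.mul (Continuous.inv₀ (by fun_prop) fun θ => ?_)
    simpa using hcm θ
  have hw : ∀ z ∈ ball x δ, ∀ ζ : ℂ, ‖ζ‖ ≤ δ → z + ζ • v ∈ ball x (2 * δ) := by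
    intro z hz ζ hζ
    rw [mem_ball] at hz ⊢
    have h1 : dist (z + ζ • v) z ≤ δ := by
      rw [dist_eq_norm, add_sub_cancel_left, norm_smul, hvn, mul_one]; exact hζ
    linarith [dist_triangle (z + ζ • v) z x]
  have hdiff : ∀ z ∈ ball x (2 * δ), DifferentiableAt ℂ f z := fun z hz =>
    hf.differentiableAt (hU.mem_nhds (hsub (ball_subset_ball (by linarith) hz)))
  have hcn : ∀ θ, ‖circleMap 0 δ θ‖ ≤ δ := fun θ => by simp [abs_of_pos hδ]
  have key : ∀ z ∈ ball x δ, pderiv i f z =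
      (2 * Real.pi * Complex.I : ℂ)⁻¹ *
        ∫ θ in (0 : ℝ)..2 * Real.pi, c θ * f (z + circleMap 0 δ θ • v) := by
    intro z hz
    have hz' : DifferentiableAt ℂ f (z + (0 : ℂ) • v) :=
      hdiff _ (hw z hz 0 (by simpa using hδ.le))
    have h1 := (hasDerivAt_comp_line (f := f) hz').deriv
    -- Cauchy's formula needs an open disk strictly larger than radius δ; the slack δ - dist z x
    -- provides it.
    obtain ⟨η, hη, hηU⟩ : ∃ η > δ, ∀ ζ ∈ ball (0 : ℂ) η, z + ζ • v ∈ ball x (2 * δ) := by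
      rw [mem_ball] at hz
      refine ⟨δ + (δ - dist z x), by linarith, fun ζ hζ => ?_⟩
      rw [mem_ball_zero_iff] at hζ
      rw [mem_ball]
      have h1 : dist (z + ζ • v) z = ‖ζ‖ := by
        rw [dist_eq_norm, add_sub_cancel_left, norm_smul, hvn, mul_one]
      linarith [dist_triangle (z + ζ • v) z x]
    have h2 := Complex.two_pi_I_inv_smul_circleIntegral_sub_sq_inv_smul_of_differentiable
      (f := fun ζ : ℂ => f (z + ζ • v)) (U := ball 0 η) (c := 0) (R := δ) (w₀ := 0) isOpen_ball
      (closedBall_subset_ball hη)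
      (fun ζ hζ => (hasDerivAt_comp_line (hdiff _ (hηU ζ hζ))).differentiableAt.differentiableWithinAt)
      (mem_ball_self hδ)
    rw [h1] at h2
    simp only [zero_smul, add_zero] at h2
    rw [pderiv, ← hv, ← h2, circleIntegral, smul_eq_mul]
    congr 2
    ext θ
    simp [hc, mul_assoc]
  have hmain : HasFDerivAt (fun z => ∫ θ in (0 : ℝ)..2 * Real.pi, c θ * f (z + circleMap 0 δ θ • v))
      (∫ θ in (0 : ℝ)..2 * Real.pi, c θ • fderiv ℂ f (x + circleMap 0 δ θ • v)) x := by
    have hcont : ∀ z ∈ ball x δ, Continuous fun θ => c θ * f (z + circleMap 0 δ θ • v) := by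
      intro z hz
      refine hcc.mul (continuous_iff_continuousAt.2 fun θ => ?_)
      have h1 := (hdiff _ (hw z hz _ (hcn θ))).continuousAt
      exact ContinuousAt.comp (f := fun θ => z + circleMap 0 δ θ • v) h1 (by fun_prop)
    refine intervalIntegral.hasFDerivAt_integral_of_dominated_of_fderiv_le
      (F := fun z θ => c θ * f (z + circleMap 0 δ θ • v))
      (F' := fun z θ => c θ • fderiv ℂ f (z + circleMap 0 δ θ • v)) (s := ball x δ)
      (bound := fun θ => ‖c θ‖ * C) (ball_mem_nhds x hδ) ?_ ?_ ?_ ?_ ?_ ?_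
    · filter_upwards [ball_mem_nhds x hδ] with z hz
      exact (hcont z hz).aestronglyMeasurable
    · exact (hcont x (mem_ball_self hδ)).intervalIntegrable _ _
    · refine (hcc.aestronglyMeasurable).smul ?_
      have : Measurable fun θ => fderiv ℂ f (x + circleMap 0 δ θ • v) :=
        (measurable_fderiv ℂ f).comp (by fun_prop : Continuous _).measurable
      exact this.aestronglyMeasurable
    · refine Eventually.of_forall fun θ _ z hz => ?_
      rw [norm_smul]
      exact mul_le_mul_of_nonneg_left (hC _ (hw z hz _ (hcn θ))) (norm_nonneg _)
    · exact (hcc.norm.mul continuous_const).intervalIntegrable _ _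
    · refine Eventually.of_forall fun θ _ z hz => ?_
      have h1 : HasFDerivAt (fun z => f (z + circleMap 0 δ θ • v))
          (fderiv ℂ f (z + circleMap 0 δ θ • v)) z := by
        have h2 := (hdiff _ (hw z hz _ (hcn θ))).hasFDerivAt
        exact (hasFDerivAt_comp_add_right _).2 h2
      simpa [smul_eq_mul] using h1.const_mul (c θ)
  have h3 : DifferentiableAt ℂ (pderiv i f) x := by
    refine (hmain.differentiableAt.const_mul (2 * Real.pi * Complex.I : ℂ)⁻¹).congr_of_eventuallyEq ?_
    filter_upwards [ball_mem_nhds x hδ] with z hz using key z hz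
  exact h3.differentiableWithinAt

theorem fderiv_apply_eq_sum (f : (Fin n → ℂ) → ℂ) (z v : Fin n → ℂ) :
    fderiv ℂ f z v = ∑ i, v i * pderiv i f z := by
  conv_lhs => rw [← Finset.univ_sum_single v]
  rw [map_sum]
  refine Finset.sum_congr rfl fun i _ => ?_
  have : (Pi.single i (v i) : Fin n → ℂ) = v i • Pi.single i 1 := by
    rw [← Pi.single_smul, smul_eq_mul, mul_one]
  rw [this, map_smul, smul_eq_mul, pderiv]

theorem fderiv_eq_sum (f : (Fin n → ℂ) → ℂ) (z : Fin n → ℂ) :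
    fderiv ℂ f z = ∑ i, pderiv i f z • ContinuousLinearMap.proj (R := ℂ) (φ := fun _ => ℂ) i := by
  ext v
  rw [fderiv_apply_eq_sum]
  simp [mul_comm]

theorem pderiv_comm (hU : IsOpen U) (hf : DifferentiableOn ℂ f U) {x : Fin n → ℂ} (hx : x ∈ U)
    (i j : Fin n) : pderiv i (pderiv j f) x = pderiv j (pderiv i f) x := by
  have hd : ∀ i, DifferentiableAt ℂ (pderiv i f) x := fun i =>
    (differentiableOn_pderiv hU hf i).differentiableAt (hU.mem_nhds hx)
  have h1 : DifferentiableAt ℂ (fderiv ℂ f) x := by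
    have : fderiv ℂ f = fun z =>
        ∑ i, pderiv i f z • ContinuousLinearMap.proj (R := ℂ) (φ := fun _ => ℂ) i := by
      ext1 z; exact fderiv_eq_sum f z
    rw [this]
    exact DifferentiableAt.fun_sum fun i _ => (hd i).smul_const _
  have h2 := second_derivative_symmetric_of_eventually (𝕜 := ℂ) (f := f) (f' := fderiv ℂ f)
    (f'' := fderiv ℂ (fderiv ℂ f) x) (x := x)
    (by
      filter_upwards [hU.mem_nhds hx] with y hy
      exact (hf.differentiableAt (hU.mem_nhds hy)).hasFDerivAt) h1.hasFDerivAt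
    (Pi.single i 1) (Pi.single j 1)
  have h3 : ∀ i j, pderiv i (pderiv j f) x =
      fderiv ℂ (fderiv ℂ f) x (Pi.single i 1) (Pi.single j 1) := by
    intro i j
    have h4 : HasFDerivAt (pderiv j f)
        ((ContinuousLinearMap.apply ℂ ℂ (Pi.single j 1 : Fin n → ℂ)).comp
          (fderiv ℂ (fderiv ℂ f) x)) x :=
      (ContinuousLinearMap.apply ℂ ℂ (Pi.single j 1 : Fin n → ℂ)).hasFDerivAt.comp x h1.hasFDerivAt
    rw [pderiv, h4.fderiv]; rfl
  rw [h3, h3, h2]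

theorem pderiv_congr (hU : IsOpen U) (h : EqOn f g U) {x : Fin n → ℂ} (hx : x ∈ U) (i : Fin n) :
    pderiv i f x = pderiv i g x := by
  rw [pderiv, pderiv, Filter.EventuallyEq.fderiv_eq (h.eventuallyEq_of_mem (hU.mem_nhds hx))]

theorem pderiv_add {x : Fin n → ℂ} (hf : DifferentiableAt ℂ f x) (hg : DifferentiableAt ℂ g x)
    (i : Fin n) : pderiv i (fun z => f z + g z) x = pderiv i f x + pderiv i g x := by
  simp [pderiv, fderiv_fun_add hf hg]

theorem pderiv_sub {x : Fin n → ℂ} (hf : DifferentiableAt ℂ f x) (hg : DifferentiableAt ℂ g x)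
    (i : Fin n) : pderiv i (fun z => f z - g z) x = pderiv i f x - pderiv i g x := by
  simp [pderiv, fderiv_fun_sub hf hg]

theorem pderiv_const_mul {x : Fin n → ℂ} (hf : DifferentiableAt ℂ f x) (c : ℂ)
    (i : Fin n) : pderiv i (fun z => c * f z) x = c * pderiv i f x := by
  simp [pderiv, fderiv_const_mul hf]

theorem pderiv_mul {x : Fin n → ℂ} (hf : DifferentiableAt ℂ f x) (hg : DifferentiableAt ℂ g x)
    (i : Fin n) : pderiv i (fun z => f z * g z) x = f x * pderiv i g x + g x * pderiv i f x := by
  simp [pderiv, fderiv_fun_mul hf hg]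

theorem pderiv_sum {ι : Type*} {s : Finset ι} {F : ι → (Fin n → ℂ) → ℂ} {x : Fin n → ℂ}
    (hF : ∀ m ∈ s, DifferentiableAt ℂ (F m) x) (i : Fin n) :
    pderiv i (fun z => ∑ m ∈ s, F m z) x = ∑ m ∈ s, pderiv i (F m) x := by
  simp [pderiv, fderiv_fun_sum hF]

end Holomorphic

/-! ### The polydisk as a ball of the maximum norm -/

section Polydisk

variable {n : ℕ}

theorem polydisk_eq_ball : polydisk n = ball (0 : Fin n → ℂ) 1 := by
  ext z
  rw [mem_ball_zero_iff, pi_norm_lt_iff one_pos]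
  rfl

theorem isOpen_polydisk : IsOpen (polydisk n) := by
  rw [polydisk_eq_ball]; exact isOpen_ball

theorem mem_polydisk_iff_norm {z : Fin n → ℂ} : z ∈ polydisk n ↔ ‖z‖ < 1 := by
  rw [polydisk_eq_ball, mem_ball_zero_iff]

theorem zero_mem_polydisk : (0 : Fin n → ℂ) ∈ polydisk n := fun i => by simp

theorem single_mem_polydisk {k : Fin n} {ξ : ℂ} (hξ : ξ ∈ ball (0 : ℂ) 1) :
    (Pi.single k ξ : Fin n → ℂ) ∈ polydisk n := by
  rw [mem_polydisk_iff_norm, Pi.norm_single]; simpa using hξ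

theorem one_sub_sq_pos {z : Fin n → ℂ} (hz : z ∈ polydisk n) (i : Fin n) :
    0 < 1 - ‖z i‖ ^ 2 := by
  have := hz i
  nlinarith [norm_nonneg (z i)]

theorem DifferentiableOn.at_polydisk {f : (Fin n → ℂ) → ℂ} (hf : DifferentiableOn ℂ f (polydisk n))
    {z : Fin n → ℂ} (hz : z ∈ polydisk n) : DifferentiableAt ℂ f z :=
  hf.differentiableAt (isOpen_polydisk.mem_nhds hz)

end Polydisk

namespace LinearSystem

/-! ### Solutions and their 1-jets: uniqueness and existence -/

section Jets

variable {n : ℕ} {L : LinearSystem n} {v : (Fin n → ℂ) → ℂ}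

theorem IsSolution.differentiableAt (hv : L.IsSolution v) {z : Fin n → ℂ} (hz : z ∈ polydisk n) :
    DifferentiableAt ℂ v z := DifferentiableOn.at_polydisk hv.1 hz

theorem IsSolution.differentiableAt_pderiv (hv : L.IsSolution v) {z : Fin n → ℂ}
    (hz : z ∈ polydisk n) (i : Fin n) : DifferentiableAt ℂ (pderiv i v) z :=
  DifferentiableOn.at_polydisk (differentiableOn_pderiv isOpen_polydisk hv.1 i) hz

/-- The condition on `K` says that second derivatives in directions of `K` involve only first
derivatives in directions of `K`. Along a segment in such directions the partial jet therefore
solves a homogeneous linear equation with bounded coefficients, and Grönwall's inequality forces it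
to vanish. `K = univ` gives uniqueness of solutions; the complement of one index gives uniqueness on
a hyperplane. -/
theorem IsSolution.eq_zero_of_jet_eq_zero (hL : L.HasHolomorphicCoeffs) (hv : L.IsSolution v)
    (K : Finset (Fin n))
    (hK : ∀ z ∈ polydisk n, ∀ i ∈ K, ∀ j ∈ K, ∀ l ∉ K, L.P l i j z = 0)
    {x y : Fin n → ℂ} (hx : x ∈ polydisk n) (hy : y ∈ polydisk n) (hxy : ∀ i ∉ K, y i = x i)
    (h0 : v x = 0) (h1 : ∀ i ∈ K, pderiv i v x = 0) :
    v y = 0 ∧ ∀ i ∈ K, pderiv i v y = 0 := by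
  set d : Fin n → ℂ := y - x with hd
  have hd0 : ∀ j ∉ K, d j = 0 := fun j hj => by simp [hd, hxy j hj]
  set γ : ℝ → Fin n → ℂ := fun t => x + (t : ℂ) • d with hγ
  have hγm : ∀ t ∈ Icc (0 : ℝ) 1, γ t ∈ polydisk n := by
    intro t ht
    rw [polydisk_eq_ball] at hx hy ⊢
    have h2 := (convex_ball (0 : Fin n → ℂ) 1) hx hy (sub_nonneg.2 ht.2) ht.1 (by ring)
    convert h2 using 1
    ext i
    simp [hγ, hd]
    ring
  have hγc : Continuous γ := by fun_prop
  have hder : ∀ f : (Fin n → ℂ) → ℂ, DifferentiableOn ℂ f (polydisk n) → ∀ t ∈ Icc (0 : ℝ) 1,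
      HasDerivAt (fun s => f (γ s)) (∑ j, d j * pderiv j f (γ t)) t := by
    intro f hf t ht
    rw [← fderiv_apply_eq_sum]
    exact (hasDerivAt_comp_line (DifferentiableOn.at_polydisk hf (hγm t ht))).comp_ofReal
  set W : ℝ → ℂ × (Fin n → ℂ) := fun t =>
    (v (γ t), fun i => if i ∈ K then pderiv i v (γ t) else 0) with hW
  set W' : ℝ → ℂ × (Fin n → ℂ) := fun t =>
    (∑ j, d j * pderiv j v (γ t),
      fun i => if i ∈ K then ∑ j, d j * pderiv j (pderiv i v) (γ t) else 0) with hW'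
  have hWd : ∀ t ∈ Icc (0 : ℝ) 1, HasDerivAt W (W' t) t := by
    intro t ht
    refine (hder v hv.1 t ht).prodMk (hasDerivAt_pi.2 fun i => ?_)
    by_cases hi : i ∈ K
    · simpa [hi] using hder _ (differentiableOn_pderiv isOpen_polydisk hv.1 i) t ht
    · simpa [hi] using hasDerivAt_const t (0 : ℂ)
  -- One constant dominating every coefficient on the compact segment and every component of its
  -- direction.
  obtain ⟨B, hB⟩ := isCompact_Icc.exists_bound_of_continuousOn (s := Icc (0 : ℝ) 1)
    (f := fun t => (∑ l, ∑ i, ∑ j, ‖L.P l i j (γ t)‖) + (∑ i, ∑ j, ‖L.P₀ i j (γ t)‖) + ∑ j, ‖d j‖)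
    (by
      have hc : ∀ f : (Fin n → ℂ) → ℂ, DifferentiableOn ℂ f (polydisk n) →
          ContinuousOn (fun t => ‖f (γ t)‖) (Icc (0 : ℝ) 1) := fun f hf =>
        (hf.continuousOn.comp hγc.continuousOn hγm).norm
      refine ((continuousOn_finsetSum _ fun l _ => continuousOn_finsetSum _ fun i _ =>
        continuousOn_finsetSum _ fun j _ => hc _ (hL.1 l i j)).add
        (continuousOn_finsetSum _ fun i _ => continuousOn_finsetSum _ fun j _ =>
          hc _ (hL.2 i j))).add continuousOn_const)
  have hS1 : ∀ t, 0 ≤ ∑ l, ∑ i, ∑ j, ‖L.P l i j (γ t)‖ := fun t => by positivity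
  have hS2 : ∀ t, 0 ≤ ∑ i, ∑ j, ‖L.P₀ i j (γ t)‖ := fun t => by positivity
  have hS3 : 0 ≤ ∑ j, ‖d j‖ := by positivity
  have hB' : ∀ t ∈ Icc (0 : ℝ) 1, (∑ l, ∑ i, ∑ j, ‖L.P l i j (γ t)‖) +
      (∑ i, ∑ j, ‖L.P₀ i j (γ t)‖) + ∑ j, ‖d j‖ ≤ B := fun t ht =>
    (le_abs_self _).trans (hB t ht)
  have hB0 : 0 ≤ B := by
    have := hB' 0 (by simp)
    have := hS1 0
    have := hS2 0
    linarith
  have hBP : ∀ t ∈ Icc (0 : ℝ) 1, ∀ l i j, ‖L.P l i j (γ t)‖ ≤ B := by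
    intro t ht l i j
    have e1 := Finset.single_le_sum (f := fun l => ∑ i, ∑ j, ‖L.P l i j (γ t)‖)
      (fun _ _ => by positivity) (Finset.mem_univ l)
    have e2 := Finset.single_le_sum (f := fun i => ∑ j, ‖L.P l i j (γ t)‖)
      (fun _ _ => by positivity) (Finset.mem_univ i)
    have e3 := Finset.single_le_sum (f := fun j => ‖L.P l i j (γ t)‖)
      (fun _ _ => by positivity) (Finset.mem_univ j)
    have := hB' t ht
    have := hS2 t
    linarith
  have hBP0 : ∀ t ∈ Icc (0 : ℝ) 1, ∀ i j, ‖L.P₀ i j (γ t)‖ ≤ B := by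
    intro t ht i j
    have e2 := Finset.single_le_sum (f := fun i => ∑ j, ‖L.P₀ i j (γ t)‖)
      (fun _ _ => by positivity) (Finset.mem_univ i)
    have e3 := Finset.single_le_sum (f := fun j => ‖L.P₀ i j (γ t)‖)
      (fun _ _ => by positivity) (Finset.mem_univ j)
    have := hB' t ht
    have := hS1 t
    linarith
  have hBd : ∀ j, ‖d j‖ ≤ B := by
    intro j
    have e3 := Finset.single_le_sum (f := fun j => ‖d j‖)
      (fun _ _ => by positivity) (Finset.mem_univ j)
    have := hB' 0 (by simp)
    have := hS1 0
    have := hS2 0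
    linarith
  have hWn1 : ∀ t, ‖v (γ t)‖ ≤ ‖W t‖ := fun t => norm_fst_le (W t)
  have hWn2 : ∀ t, ∀ i ∈ K, ‖pderiv i v (γ t)‖ ≤ ‖W t‖ := by
    intro t i hi
    have h2 := (norm_le_pi_norm (W t).2 i).trans (norm_snd_le (W t))
    simpa [hW, hi] using h2
  have hbound : ∀ t ∈ Ico (0 : ℝ) 1,
      ‖W' t‖ ≤ (n * B + n * (B * (n * B + B))) * ‖W t‖ := by
    intro t ht
    have ht' : t ∈ Icc (0 : ℝ) 1 := ⟨ht.1, ht.2.le⟩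
    have hN := norm_nonneg (W t)
    have hn : (0 : ℝ) ≤ n := Nat.cast_nonneg n
    have hfst : ‖∑ j, d j * pderiv j v (γ t)‖ ≤ n * B * ‖W t‖ := by
      refine (norm_sum_le_of_le _ (f := fun j => d j * pderiv j v (γ t))
        (n := fun _ => B * ‖W t‖) fun j _ => ?_).trans (by simp [mul_assoc])
      by_cases hj : j ∈ K
      · rw [norm_mul]
        exact mul_le_mul (hBd j) (hWn2 t j hj) (norm_nonneg _) hB0
      · rw [hd0 j hj, zero_mul, norm_zero]; positivity
    have hsnd : ∀ i ∈ K, ‖∑ j, d j * pderiv j (pderiv i v) (γ t)‖ ≤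
        n * (B * (n * B + B)) * ‖W t‖ := by
      intro i hi
      refine (norm_sum_le_of_le _ (f := fun j => d j * pderiv j (pderiv i v) (γ t))
        (n := fun _ => B * ((n * B + B) * ‖W t‖)) fun j _ => ?_).trans
        (by simp [mul_assoc])
      by_cases hj : j ∈ K
      · rw [norm_mul]
        refine mul_le_mul (hBd j) ?_ (norm_nonneg _) hB0
        rw [hv.2 _ (hγm t ht') j i, add_mul]
        refine norm_add_le_of_le ?_ ?_
        · refine (norm_sum_le_of_le _ (f := fun l => L.P l j i (γ t) * pderiv l v (γ t))
            (n := fun _ => B * ‖W t‖) fun l _ => ?_).trans (by simp [mul_assoc])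
          by_cases hl : l ∈ K
          · rw [norm_mul]
            exact mul_le_mul (hBP t ht' l j i) (hWn2 t l hl) (norm_nonneg _) hB0
          · rw [hK _ (hγm t ht') j hj i hi l hl, zero_mul, norm_zero]; positivity
        · rw [norm_mul]
          exact mul_le_mul (hBP0 t ht' j i) (hWn1 t) (norm_nonneg _) hB0
      · rw [hd0 j hj, zero_mul, norm_zero]; positivity
    rw [Prod.norm_def, add_mul]
    have hp1 : 0 ≤ n * B * ‖W t‖ := by positivity
    have hp2 : 0 ≤ n * (B * (n * B + B)) * ‖W t‖ := by positivity
    refine max_le (hfst.trans (by linarith)) ((pi_norm_le_iff_of_nonneg (by positivity)).2 fun i => ?_)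
    by_cases hi : i ∈ K
    · simp only [hW', hi, if_true]
      exact (hsnd i hi).trans (by linarith)
    · simp only [hW', hi, if_false, norm_zero]; positivity
  have hγ0 : γ 0 = x := by simp [hγ]
  have hγ1 : γ 1 = y := by simp [hγ, hd]
  have hW0 : ‖W 0‖ ≤ 0 := by
    have : W 0 = 0 := by
      refine Prod.ext ?_ ?_
      · simp [hW, hγ0, h0]
      · funext i
        by_cases hi : i ∈ K
        · simp [hW, hγ0, hi, h1 i hi]
        · simp [hW, hi]
    simp [this]
  have hfin := norm_le_gronwallBound_of_norm_deriv_right_le (f := W) (f' := W') (δ := 0)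
    (K := n * B + n * (B * (n * B + B))) (ε := 0) (a := 0) (b := 1)
    (fun t ht => (hWd t ht).continuousAt.continuousWithinAt)
    (fun t ht => (hWd t ⟨ht.1, ht.2.le⟩).hasDerivWithinAt) hW0
    (fun t ht => by simpa using hbound t ht) 1 (by simp)
  rw [gronwallBound_ε0_δ0] at hfin
  constructor
  · have := (hWn1 1).trans hfin
    rwa [hγ1, norm_le_zero_iff] at this
  · intro i hi
    have := (hWn2 1 i hi).trans hfin
    rwa [hγ1, norm_le_zero_iff] at this

theorem pderiv_linearCombination {ι : Type*} [Fintype ι] {w : ι → (Fin n → ℂ) → ℂ}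
    {z : Fin n → ℂ} (hw : ∀ m, DifferentiableAt ℂ (w m) z) (c : ι → ℂ) (i : Fin n) :
    pderiv i (fun z => ∑ m, c m * w m z) z = ∑ m, c m * pderiv i (w m) z := by
  rw [pderiv_sum fun m _ => (hw m).const_mul _]
  exact Finset.sum_congr rfl fun m _ => pderiv_const_mul (hw m) _ _

theorem IsSolution.linearCombination {ι : Type*} [Fintype ι] {w : ι → (Fin n → ℂ) → ℂ}
    (hw : ∀ m, L.IsSolution (w m)) (c : ι → ℂ) : L.IsSolution fun z => ∑ m, c m * w m z := by
  refine ⟨DifferentiableOn.fun_sum fun m _ => (hw m).1.const_mul _, fun z hz i j => ?_⟩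
  have h1 : EqOn (pderiv j fun z => ∑ m, c m * w m z) (fun z => ∑ m, c m * pderiv j (w m) z)
      (polydisk n) := fun y hy =>
    pderiv_linearCombination (fun m => (hw m).differentiableAt hy) c j
  rw [pderiv_congr isOpen_polydisk h1 hz i,
    pderiv_linearCombination (fun m => (hw m).differentiableAt_pderiv hz j)]
  simp_rw [pderiv_linearCombination (fun m => (hw m).differentiableAt hz) c, (hw _).2 z hz i j,
    mul_add, Finset.sum_add_distrib, Finset.mul_sum]
  rw [Finset.sum_comm]
  congr 1 <;> refine Finset.sum_congr rfl fun _ _ => ?_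
  · refine Finset.sum_congr rfl fun _ _ => by ring
  · ring

/-- By uniqueness, the map from combinations of the n + 1 independent solutions to 1-jets at x is
injective; both spaces have dimension n + 1, so it is onto. Coefficients of the system can then be
read off at any point by testing on solutions with convenient jets. -/
theorem CompletelyIntegrable.exists_solution (hL : L.HasHolomorphicCoeffs)
    (hint : L.CompletelyIntegrable) {x : Fin n → ℂ} (hx : x ∈ polydisk n) (a : ℂ) (p : Fin n → ℂ) :
    ∃ v, L.IsSolution v ∧ v x = a ∧ ∀ i, pderiv i v x = p i := by
  obtain ⟨w, hw, hli⟩ := hint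
  let J : (Fin (n + 1) → ℂ) →ₗ[ℂ] ℂ × (Fin n → ℂ) :=
    { toFun := fun c => (∑ m, c m * w m x, fun i => ∑ m, c m * pderiv i (w m) x)
      map_add' := fun c c' => by
        refine Prod.ext ?_ (funext fun i => ?_) <;> simp [add_mul, Finset.sum_add_distrib]
      map_smul' := fun r c => by
        refine Prod.ext ?_ (funext fun i => ?_) <;> simp [mul_assoc, Finset.mul_sum] }
  have hinj : Function.Injective J := by
    rw [← LinearMap.ker_eq_bot, LinearMap.ker_eq_bot']
    intro c hc
    have hsol := IsSolution.linearCombination hw c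
    have h0 : ∑ m, c m * w m x = 0 := congrArg Prod.fst hc
    have h1 : ∀ i, pderiv i (fun z => ∑ m, c m * w m z) x = 0 := fun i => by
      rw [pderiv_linearCombination (fun m => (hw m).differentiableAt hx)]
      exact congrFun (congrArg Prod.snd hc) i
    have h2 : ∀ y : polydisk n, ∑ m, c m * w m y = 0 := fun y =>
      (hsol.eq_zero_of_jet_eq_zero hL Finset.univ (by simp) hx y.2 (by simp) h0
        fun i _ => h1 i).1
    funext m
    refine Fintype.linearIndependent_iff.1 hli c ?_ m
    funext y
    simpa using h2 y
  have hsurj : Function.Surjective J := by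
    refine (LinearMap.injective_iff_surjective_of_finrank_eq_finrank ?_).1 hinj
    simp [Module.finrank_prod, add_comm]
  obtain ⟨c, hc⟩ := hsurj (a, p)
  refine ⟨_, IsSolution.linearCombination hw c, congrArg Prod.fst hc, fun i => ?_⟩
  rw [pderiv_linearCombination (fun m => (hw m).differentiableAt hx)]
  exact congrFun (congrArg Prod.snd hc) i

end Jets

end LinearSystem

namespace LinearSystem

/-! ### Integrability conditions on the coefficients -/

section Integrability

variable {n : ℕ} {L : LinearSystem n}

theorem CompletelyIntegrable.P_symm (hL : L.HasHolomorphicCoeffs) (hint : L.CompletelyIntegrable)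
    {z : Fin n → ℂ} (hz : z ∈ polydisk n) (k i j : Fin n) : L.P k i j z = L.P k j i z := by
  obtain ⟨v, hv, h0, h1⟩ := hint.exists_solution hL hz 0 (Pi.single k 1)
  have h := pderiv_comm isOpen_polydisk hv.1 hz i j
  rw [hv.2 z hz, hv.2 z hz] at h
  simpa [h0, h1, Pi.single_apply] using h

theorem IsSolution.pderiv_pderiv_pderiv (hL : L.HasHolomorphicCoeffs) {v : (Fin n → ℂ) → ℂ}
    (hv : L.IsSolution v) {z : Fin n → ℂ} (hz : z ∈ polydisk n) (l i j : Fin n) :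
    pderiv l (pderiv i (pderiv j v)) z =
      ∑ k, (L.P k i j z * pderiv l (pderiv k v) z + pderiv k v z * pderiv l (L.P k i j) z) +
        (L.P₀ i j z * pderiv l v z + v z * pderiv l (L.P₀ i j) z) := by
  have hP : ∀ k, DifferentiableAt ℂ (L.P k i j) z := fun k =>
    DifferentiableOn.at_polydisk (hL.1 k i j) hz
  have hP0 : DifferentiableAt ℂ (L.P₀ i j) z := DifferentiableOn.at_polydisk (hL.2 i j) hz
  have hvk : ∀ k, DifferentiableAt ℂ (pderiv k v) z := hv.differentiableAt_pderiv hz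
  have h1 : EqOn (pderiv i (pderiv j v))
      (fun z => ∑ k, L.P k i j z * pderiv k v z + L.P₀ i j z * v z) (polydisk n) :=
    fun y hy => hv.2 y hy i j
  rw [pderiv_congr isOpen_polydisk h1 hz,
    pderiv_add (DifferentiableAt.fun_sum fun k _ => (hP k).fun_mul (hvk k))
      (hP0.fun_mul (hv.differentiableAt hz)),
    pderiv_sum fun k _ => (hP k).fun_mul (hvk k), pderiv_mul hP0 (hv.differentiableAt hz)]
  congr 1
  exact Finset.sum_congr rfl fun k _ => pderiv_mul (hP k) (hvk k) l

/-- Commuting ∂_l and ∂_i in the third derivatives of a solution whose only nonzero jet entry at z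
is ∂_m v = 1. -/
theorem CompletelyIntegrable.compatibility (hL : L.HasHolomorphicCoeffs)
    (hint : L.CompletelyIntegrable) {z : Fin n → ℂ} (hz : z ∈ polydisk n) (m l i j : Fin n) :
    pderiv l (L.P m i j) z + ∑ k, L.P k i j z * L.P m l k z + (if l = m then L.P₀ i j z else 0) =
      pderiv i (L.P m l j) z + ∑ k, L.P k l j z * L.P m i k z +
        (if i = m then L.P₀ l j z else 0) := by
  obtain ⟨v, hv, h0, h1⟩ := hint.exists_solution hL hz 0 (Pi.single m 1)
  have h2 : ∀ i j, pderiv i (pderiv j v) z = L.P m i j z := fun i j => by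
    rw [hv.2 z hz]; simp [h0, h1, Pi.single_apply]
  have h3 : ∀ l i, pderiv l (pderiv i (pderiv j v)) z =
      pderiv l (L.P m i j) z + ∑ k, L.P k i j z * L.P m l k z +
        (if l = m then L.P₀ i j z else 0) := by
    intro l i
    rw [hv.pderiv_pderiv_pderiv hL hz]
    simp only [h2, h1, h0, Finset.sum_add_distrib, Pi.single_apply, ite_mul, one_mul, zero_mul,
      Finset.sum_ite_eq', Finset.mem_univ, if_true, mul_ite, mul_one, mul_zero]
    ring
  rw [← h3 l i, ← h3 i l]
  exact pderiv_comm isOpen_polydisk (differentiableOn_pderiv isOpen_polydisk hv.1 j) hz l i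

end Integrability

/-! ### Pointwise bounds and vanishing of coefficients -/

section Bounds

variable {n : ℕ} {L : LinearSystem n}

/-- Half the squared Bergman norm. -/
def weight {n : ℕ} (z v : Fin n → ℂ) : ℝ := ∑ i, ‖v i‖ ^ 2 / (1 - ‖z i‖ ^ 2) ^ 2

theorem weight_nonneg (z v : Fin n → ℂ) : 0 ≤ weight z v :=
  Finset.sum_nonneg fun _ _ => by positivity

theorem sq_bergmanNorm (z v : Fin n → ℂ) : bergmanNorm z v ^ 2 = 2 * weight z v :=
  Real.sq_sqrt (mul_nonneg zero_le_two (weight_nonneg z v))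

theorem op_smul (L : LinearSystem n) (z v : Fin n → ℂ) (c : ℂ) :
    L.op z (c • v) = c ^ 2 • L.op z v := by
  funext k
  simp only [op, Pi.smul_apply, smul_eq_mul, Finset.mul_sum]
  exact Finset.sum_congr rfl fun _ _ => Finset.sum_congr rfl fun _ _ => by ring

theorem weight_smul (z v : Fin n → ℂ) (c : ℂ) : weight z (c • v) = ‖c‖ ^ 2 * weight z v := by
  simp only [weight, Pi.smul_apply, smul_eq_mul, norm_mul, Finset.mul_sum]
  exact Finset.sum_congr rfl fun _ _ => by ring

/-- Homogeneity extends the bound on unit vectors to ‖S(z)(v)‖ ≤ α ‖v‖². Since `weight` is half a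
squared norm, squaring produces the factor 2 α². -/
theorem weight_op_le {α : ℝ≥0} (hα : L.opNorm ≤ α) {z : Fin n → ℂ} (hz : z ∈ polydisk n)
    (v : Fin n → ℂ) : weight z (L.op z v) ≤ 2 * (α : ℝ) ^ 2 * weight z v ^ 2 := by
  have h1 : ∀ v, bergmanNorm z v = 1 → weight z (L.op z v) ≤ (α : ℝ) ^ 2 / 2 := by
    intro v hv
    have h2 : ENNReal.ofReal (bergmanNorm z (L.op z v)) ≤ α := by
      refine le_trans ?_ hα
      exact le_iSup₂_of_le z hz (le_iSup₂_of_le v hv le_rfl)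
    have h3 : bergmanNorm z (L.op z v) ≤ α := by
      rwa [ENNReal.ofReal_le_iff_le_toReal ENNReal.coe_ne_top, ENNReal.coe_toReal] at h2
    have h4 := sq_bergmanNorm z (L.op z v)
    have h5 : 0 ≤ bergmanNorm z (L.op z v) := Real.sqrt_nonneg _
    nlinarith
  rcases (weight_nonneg z v).eq_or_lt with h | h
  · have hv : v = 0 := by
      funext i
      have h2 := (Finset.sum_eq_zero_iff_of_nonneg fun i _ => by positivity).1 h.symm i
        (Finset.mem_univ i)
      have h3 := one_sub_sq_pos hz i
      rw [div_eq_zero_iff] at h2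
      rcases h2 with h2 | h2
      · simpa using h2
      · exact absurd h2 (by positivity)
    have h0 : L.op z v = 0 := by
      funext k; simp [op, hv]
    rw [h0]
    have : weight z (0 : Fin n → ℂ) = 0 := by simp [weight]
    rw [this]; positivity
  · set r : ℝ := bergmanNorm z v with hr
    have hr2 : r ^ 2 = 2 * weight z v := sq_bergmanNorm z v
    have hr0 : 0 ≤ r := Real.sqrt_nonneg _
    have hrp : 0 < r := by
      rcases hr0.eq_or_lt with h' | h'
      · rw [← h'] at hr2; nlinarith
      · exact h'
    have hv : bergmanNorm z ((((r⁻¹ : ℝ) : ℂ)) • v) = 1 := by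
      have e1 := sq_bergmanNorm z ((((r⁻¹ : ℝ) : ℂ)) • v)
      rw [weight_smul, Complex.norm_real, Real.norm_eq_abs, sq_abs] at e1
      have e2 : bergmanNorm z ((((r⁻¹ : ℝ) : ℂ)) • v) ^ 2 = 1 := by
        rw [e1]
        have : 2 * (r⁻¹ ^ 2 * weight z v) = r⁻¹ ^ 2 * r ^ 2 := by rw [hr2]; ring
        rw [this, ← mul_pow, inv_mul_cancel₀ hrp.ne', one_pow]
      have e3 : 0 ≤ bergmanNorm z ((((r⁻¹ : ℝ) : ℂ)) • v) := Real.sqrt_nonneg _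
      nlinarith
    have h2 := h1 _ hv
    rw [op_smul, weight_smul, norm_pow, Complex.norm_real, Real.norm_eq_abs, sq_abs] at h2
    have h3 : weight z (L.op z v) ≤ (α : ℝ) ^ 2 / 2 * (r ^ 2) ^ 2 := by
      have : weight z (L.op z v) = (r ^ 2) ^ 2 * ((r⁻¹ ^ 2) ^ 2 * weight z (L.op z v)) := by
        field_simp
      rw [this]
      nlinarith [mul_le_mul_of_nonneg_left h2 (by positivity : 0 ≤ (r ^ 2) ^ 2)]
    rw [hr2] at h3
    linarith [h3, (by ring : (α : ℝ) ^ 2 / 2 * (2 * weight z v) ^ 2 = 2 * α ^ 2 * weight z v ^ 2)]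

theorem op_single (L : LinearSystem n) (z : Fin n → ℂ) (i k : Fin n) (x : ℂ) :
    L.op z (Pi.single i x) k = x ^ 2 * L.P k i i z := by
  simp only [op, Pi.single_apply, ite_mul, zero_mul, mul_ite, mul_zero, Finset.sum_ite_eq',
    Finset.mem_univ, if_true]
  ring

theorem op_single_add_single (L : LinearSystem n) (z : Fin n → ℂ) (i j k : Fin n) (x y : ℂ) :
    L.op z (Pi.single i x + Pi.single j y) k =
      x ^ 2 * L.P k i i z + y ^ 2 * L.P k j j z + x * y * (L.P k i j z + L.P k j i z) := by
  simp only [op, Pi.add_apply, Pi.single_apply, add_mul, mul_add, ite_mul, zero_mul, mul_ite,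
    mul_zero, Finset.sum_add_distrib, Finset.sum_ite_eq', Finset.mem_univ, if_true]
  ring

theorem weight_single_add_single (z : Fin n → ℂ) {i j : Fin n} (hij : i ≠ j) (x y : ℂ) :
    weight z (Pi.single i x + Pi.single j y) =
      ‖x‖ ^ 2 / (1 - ‖z i‖ ^ 2) ^ 2 + ‖y‖ ^ 2 / (1 - ‖z j‖ ^ 2) ^ 2 := by
  rw [weight, Fintype.sum_eq_add i j hij]
  · simp [hij, hij.symm]
  · rintro k ⟨h1, h2⟩
    simp [h1, h2]

theorem norm_sq_div_le_weight (z v : Fin n → ℂ) (k : Fin n) :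
    ‖v k‖ ^ 2 / (1 - ‖z k‖ ^ 2) ^ 2 ≤ weight z v :=
  Finset.single_le_sum (f := fun k => ‖v k‖ ^ 2 / (1 - ‖z k‖ ^ 2) ^ 2)
    (fun _ _ => by positivity) (Finset.mem_univ k)

theorem parallelogram (x y : ℂ) :
    ‖x + y‖ ^ 2 + ‖x - y‖ ^ 2 = 2 * (‖x‖ ^ 2 + ‖y‖ ^ 2) := by
  have := parallelogram_law_with_norm ℝ x y
  nlinarith

/-- The test vectors are d_i e_i ± d_j e_j with d_l = 1 - |z_l|² and e_l the coordinate vectors.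
Averaging over the sign by the parallelogram law isolates the mixed term 2 d_i d_j P^k_{ij}. -/
theorem CompletelyIntegrable.norm_P_le (hL : L.HasHolomorphicCoeffs)
    (hint : L.CompletelyIntegrable) {α : ℝ≥0} (hα : L.opNorm ≤ α) {z : Fin n → ℂ}
    (hz : z ∈ polydisk n) (k i j : Fin n) :
    ‖L.P k i j z‖ * ((1 - ‖z i‖ ^ 2) * (1 - ‖z j‖ ^ 2)) ≤ √2 * α * (1 - ‖z k‖ ^ 2) := by
  have hi := one_sub_sq_pos hz i
  have hj := one_sub_sq_pos hz j
  have hk := one_sub_sq_pos hz k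
  set di := 1 - ‖z i‖ ^ 2 with hdi
  set dj := 1 - ‖z j‖ ^ 2 with hdj
  set dk := 1 - ‖z k‖ ^ 2 with hdk
  refine le_of_sq_le_sq (a := ‖L.P k i j z‖ * (di * dj)) (b := √2 * α * dk) ?_ (by positivity)
  have hs : (√2 * (α : ℝ) * dk) ^ 2 = 2 * α ^ 2 * dk ^ 2 := by
    rw [mul_pow, mul_pow, Real.sq_sqrt zero_le_two]
  rw [hs]
  by_cases hij : i = j
  · subst hij
    have h1 := (norm_sq_div_le_weight z _ k).trans (weight_op_le hα hz (Pi.single i (di : ℂ)))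
    have h2 : weight z (Pi.single i (di : ℂ)) = 1 := by
      rw [weight, Finset.sum_eq_single i]
      · simp only [Pi.single_eq_same, Complex.norm_real, Real.norm_eq_abs, sq_abs, ← hdi]
        field_simp
      · intro b _ hb; simp [hb]
      · simp
    rw [h2, op_single, ← hdk, div_le_iff₀ (by positivity)] at h1
    simp only [norm_mul, norm_pow, Complex.norm_real, Real.norm_eq_abs, sq_abs] at h1
    nlinarith
  -- Each test vector has weight 1 + 1 = 2, whence the factor 2² = 4.
  · have hw : ∀ s : ℂ, ‖s‖ = dj → ‖L.op z (Pi.single i (di : ℂ) + Pi.single j s) k‖ ^ 2 ≤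
        2 * α ^ 2 * 4 * dk ^ 2 := by
      intro s hs
      have h1 := (norm_sq_div_le_weight z _ k).trans
        (weight_op_le hα hz (Pi.single i (di : ℂ) + Pi.single j s))
      rw [weight_single_add_single z hij, hs, ← hdi, ← hdj, ← hdk,
        div_le_iff₀ (by positivity)] at h1
      simp only [Complex.norm_real, Real.norm_eq_abs, sq_abs] at h1
      rw [div_self (by positivity), div_self (by positivity)] at h1
      linarith
    have h1 := hw dj (by simp [abs_of_pos hj])
    have h2 := hw (-dj) (by simp [abs_of_pos hj])
    rw [op_single_add_single, hint.P_symm hL hz k j i] at h1 h2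
    have h3 := parallelogram ((di : ℂ) ^ 2 * L.P k i i z + (dj : ℂ) ^ 2 * L.P k j j z)
      ((di : ℂ) * dj * (L.P k i j z + L.P k i j z))
    have e1 : (di : ℂ) ^ 2 * L.P k i i z + (-dj : ℂ) ^ 2 * L.P k j j z +
        (di : ℂ) * (-dj) * (L.P k i j z + L.P k i j z) =
        (di : ℂ) ^ 2 * L.P k i i z + (dj : ℂ) ^ 2 * L.P k j j z -
        (di : ℂ) * dj * (L.P k i j z + L.P k i j z) := by ring
    rw [e1] at h2
    have e2 : ‖(di : ℂ) * dj * (L.P k i j z + L.P k i j z)‖ ^ 2 =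
        4 * (‖L.P k i j z‖ * (di * dj)) ^ 2 := by
      rw [← two_mul]
      simp only [norm_mul, Complex.norm_real, Real.norm_eq_abs, Complex.norm_ofNat, mul_pow, sq_abs]
      ring
    rw [e2] at h3
    nlinarith [sq_nonneg ‖(di : ℂ) ^ 2 * L.P k i i z + (dj : ℂ) ^ 2 * L.P k j j z‖]

/-- The maximum principle on the disk of radius ρ gives the bound C (1 - ρ²) inside it; let ρ → 1.
-/
theorem eq_zero_of_norm_le_one_sub_sq {f : ℂ → ℂ} (hf : DifferentiableOn ℂ f (ball 0 1)) {C : ℝ}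
    (hC : ∀ ξ ∈ ball (0 : ℂ) 1, ‖f ξ‖ ≤ C * (1 - ‖ξ‖ ^ 2)) {ξ : ℂ} (hξ : ξ ∈ ball (0 : ℂ) 1) :
    f ξ = 0 := by
  rw [mem_ball_zero_iff] at hξ
  have hC0 : 0 ≤ C := by
    have h1 := (norm_nonneg _).trans (hC 0 (by simp))
    simpa using h1
  have key : ∀ ρ : ℝ, ‖ξ‖ < ρ → ρ < 1 → ‖f ξ‖ ≤ C * (1 - ρ ^ 2) := by
    intro ρ h1 h2
    have hρ : 0 < ρ := (norm_nonneg ξ).trans_lt h1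
    have hcl : closure (ball (0 : ℂ) ρ) = closedBall 0 ρ := closure_ball _ hρ.ne'
    have hsub : closedBall (0 : ℂ) ρ ⊆ ball 0 1 := closedBall_subset_ball h2
    refine Complex.norm_le_of_forall_mem_frontier_norm_le isBounded_ball
      (DifferentiableOn.diffContOnCl (by rw [hcl]; exact hf.mono hsub)) ?_
      (subset_closure (mem_ball_zero_iff.2 h1))
    intro w hw
    rw [frontier_ball _ hρ.ne', mem_sphere_zero_iff_norm] at hw
    rw [← hw]
    exact hC w (by rw [mem_ball_zero_iff, hw]; exact h2)
  have ht : Tendsto (fun ρ : ℝ => C * (1 - ρ ^ 2)) (𝓝[<] 1) (𝓝 0) := by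
    have : Tendsto (fun ρ : ℝ => C * (1 - ρ ^ 2)) (𝓝 1) (𝓝 (C * (1 - 1 ^ 2))) :=
      (Continuous.tendsto (by fun_prop) 1)
    simpa using this.mono_left nhdsWithin_le_nhds
  have h3 : ‖f ξ‖ ≤ 0 := by
    refine ge_of_tendsto ht ?_
    filter_upwards [Ioo_mem_nhdsLT hξ] with ρ hρ using key ρ hρ.1 hρ.2
  simpa using h3

/-- Changing the `k`-th coordinate of a point of the polydisk. -/
theorem update_mem_polydisk {z : Fin n → ℂ} (hz : z ∈ polydisk n) (k : Fin n) {ξ : ℂ}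
    (hξ : ξ ∈ ball (0 : ℂ) 1) : Function.update z k ξ ∈ polydisk n := by
  intro i
  by_cases h : i = k
  · subst h; simpa using hξ
  · simpa [h] using hz i

theorem differentiableOn_update {f : (Fin n → ℂ) → ℂ} (hf : DifferentiableOn ℂ f (polydisk n))
    {z : Fin n → ℂ} (hz : z ∈ polydisk n) (k : Fin n) :
    DifferentiableOn ℂ (fun ξ => f (Function.update z k ξ)) (ball 0 1) := by
  refine hf.comp (fun ξ _ => ?_) fun ξ hξ => update_mem_polydisk hz k hξ
  exact (hasDerivAt_update z k ξ).differentiableAt.differentiableWithinAt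

/-- When only z_k moves, the weights at i and j are constants, so `norm_P_le` reads as decay like 1
- |z_k|². -/
theorem CompletelyIntegrable.P_eq_zero (hL : L.HasHolomorphicCoeffs)
    (hint : L.CompletelyIntegrable) {α : ℝ≥0} (hα : L.opNorm ≤ α) {z : Fin n → ℂ}
    (hz : z ∈ polydisk n) {k i j : Fin n} (hki : k ≠ i) (hkj : k ≠ j) : L.P k i j z = 0 := by
  have h := eq_zero_of_norm_le_one_sub_sq (differentiableOn_update (hL.1 k i j) hz k)
    (C := √2 * α / ((1 - ‖z i‖ ^ 2) * (1 - ‖z j‖ ^ 2))) ?_ (ξ := z k) (by simpa using hz k)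
  · simpa using h
  · intro ξ hξ
    have hz' := update_mem_polydisk hz k hξ
    have h1 := hint.norm_P_le hL hα hz' k i j
    have hi := one_sub_sq_pos hz i
    have hj := one_sub_sq_pos hz j
    simp only [Function.update_self, Function.update_of_ne hki.symm,
      Function.update_of_ne hkj.symm] at h1
    rw [div_mul_eq_mul_div, le_div_iff₀ (by positivity)]
    exact h1

end Bounds

end LinearSystem

/-! ### Regular systems: the structure forced by the norm bound -/

namespace LinearSystem

variable {n : ℕ} {L : LinearSystem n}

/-- The consequences of complete integrability and of a norm bound on which the estimates rest:
the coefficients `P^k_{ij}` with `k ∉ {i, j}` vanish, the others obey a uniform bound, and `P^0`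
is expressed through the `P^k_{ij}`. -/
structure Regular (L : LinearSystem n) (ε : ℝ) : Prop where
  hol : L.HasHolomorphicCoeffs
  exists_solution : ∀ x ∈ polydisk n, ∀ (a : ℂ) (p : Fin n → ℂ),
    ∃ v, L.IsSolution v ∧ v x = a ∧ ∀ i, pderiv i v x = p i
  symm : ∀ z ∈ polydisk n, ∀ k i j, L.P k i j z = L.P k j i z
  vanish : ∀ z ∈ polydisk n, ∀ k i j, k ≠ i → k ≠ j → L.P k i j z = 0
  canonical : ∀ z ∈ polydisk n, ∀ i, ∑ j, L.P j i j z = 0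
  bound : ∀ z ∈ polydisk n, ∀ m l, ‖L.P m m l z‖ * (1 - ‖z l‖ ^ 2) ≤ ε
  P₀_diag : ∀ z ∈ polydisk n, ∀ k m, k ≠ m → L.P₀ k k z =
    pderiv k (L.P m m k) z + L.P m m k z ^ 2 - L.P k k k z * L.P m m k z
  P₀_off_diag : ∀ z ∈ polydisk n, ∀ k m, k ≠ m → L.P₀ k m z =
    pderiv k (L.P m m m) z - pderiv m (L.P m m k) z - L.P m m k z * L.P k k m z

theorem sum_eq_add_of_ne {f : Fin n → ℂ} {a b : Fin n} (hab : a ≠ b)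
    (h : ∀ k, k ≠ a → k ≠ b → f k = 0) : ∑ k, f k = f a + f b :=
  Fintype.sum_eq_add a b hab fun k hk => h k hk.1 hk.2

/-- The formulas for P^0 are instances of the compatibility conditions in which the vanishing
coefficients leave only terms with indices k and m. -/
theorem CompletelyIntegrable.regular (hL : L.HasHolomorphicCoeffs)
    (hint : L.CompletelyIntegrable) (hcan : L.IsCanonical) {α : ℝ≥0} (hα : L.opNorm ≤ α) :
    L.Regular (√2 * α) := by
  have hvan : ∀ z ∈ polydisk n, ∀ k i j, k ≠ i → k ≠ j → L.P k i j z = 0 :=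
    fun z hz k i j => hint.P_eq_zero hL hα hz
  have hsymm : ∀ z ∈ polydisk n, ∀ k i j, L.P k i j z = L.P k j i z :=
    fun z hz k i j => hint.P_symm hL hz k i j
  refine ⟨hL, fun x hx a p => hint.exists_solution hL hx a p, hsymm,
    hvan, hcan, ?_, ?_, ?_⟩
  · intro z hz m l
    have h := hint.norm_P_le hL hα hz m m l
    have hm := one_sub_sq_pos hz m
    refine le_of_mul_le_mul_right ?_ hm
    linarith
  · intro z hz k m hkm
    have h := hint.compatibility hL hz m k m k
    have hd : pderiv m (L.P m k k) z = 0 := by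
      rw [pderiv_congr (g := fun _ => 0) isOpen_polydisk
        (fun y hy => hvan y hy m k k hkm.symm hkm.symm) hz m]
      simp [pderiv]
    rw [hd, if_neg hkm, if_pos rfl, sum_eq_add_of_ne hkm, sum_eq_add_of_ne hkm,
      hvan z hz m k k hkm.symm hkm.symm, hsymm z hz m k m] at h
    · linear_combination -h
    · intro l h1 h2; rw [hvan z hz l k k h1 h1, zero_mul]
    · intro l h1 h2; rw [hvan z hz l m k h2 h1, zero_mul]
  · intro z hz k m hkm
    have h := hint.compatibility hL hz m k m m
    have hd : pderiv m (L.P m k m) z = pderiv m (L.P m m k) z :=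
      pderiv_congr isOpen_polydisk (fun y hy => hsymm y hy m k m) hz m
    rw [hd, if_neg hkm, if_pos rfl, sum_eq_add_of_ne hkm, sum_eq_add_of_ne hkm,
      hvan z hz k m m hkm hkm, hsymm z hz m k m] at h
    · linear_combination -h
    · intro l h1 h2; rw [hvan z hz l k m h1 h2, zero_mul]
    · intro l h1 h2; rw [hvan z hz l m m h2 h2, zero_mul]

/-- In dimension 2 the canonical form gives P^i_{ii} = -P^j_{ji}, so b = P^j_{ji} enters both
components of S(z)(v). For v = √2 d_i e_i ± d_j e_j, of weight 3, averaging over the sign yields 12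
(|b| d_i)² ≤ 18 α². The ratio √2 between the two entries optimizes the resulting constant. -/
theorem Regular.bound_of_two {L : LinearSystem 2} {ε : ℝ} (hR : L.Regular ε) {α : ℝ≥0}
    (hα : L.opNorm ≤ α) {z : Fin 2 → ℂ} (hz : z ∈ polydisk 2) {i j : Fin 2} (hij : i ≠ j) :
    (‖L.P j j i z‖ * (1 - ‖z i‖ ^ 2)) ^ 2 ≤ 3 / 2 * α ^ 2 := by
  have hi := one_sub_sq_pos hz i
  have hj := one_sub_sq_pos hz j
  set di := 1 - ‖z i‖ ^ 2 with hdi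
  set dj := 1 - ‖z j‖ ^ 2 with hdj
  set b := L.P j j i z with hb
  have hcan : L.P i i i z = -b := by
    have h := hR.canonical z hz i
    have h2 := sum_eq_add_of_ne (n := 2) (f := fun l => L.P l i l z) hij (by
      intro k h1 h2; exfalso; omega)
    rw [h2] at h
    rw [hb, hR.symm z hz j j i]
    linear_combination h
  have hw : ∀ s : ℂ, ‖s‖ = dj →
      ‖L.op z (Pi.single i ((√2 * di : ℝ) : ℂ) + Pi.single j s) i‖ ^ 2 / di ^ 2 +
      ‖L.op z (Pi.single i ((√2 * di : ℝ) : ℂ) + Pi.single j s) j‖ ^ 2 / dj ^ 2 ≤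
        2 * α ^ 2 * 9 := by
    intro s hs
    have h1 := weight_op_le hα hz (Pi.single i ((√2 * di : ℝ) : ℂ) + Pi.single j s)
    have h2 : weight z (L.op z (Pi.single i ((√2 * di : ℝ) : ℂ) + Pi.single j s)) =
        ‖L.op z (Pi.single i ((√2 * di : ℝ) : ℂ) + Pi.single j s) i‖ ^ 2 / di ^ 2 +
        ‖L.op z (Pi.single i ((√2 * di : ℝ) : ℂ) + Pi.single j s) j‖ ^ 2 / dj ^ 2 := by
      rw [weight, Fintype.sum_eq_add i j hij]
      intro k hk; exfalso; omega
    rw [h2, weight_single_add_single z hij, hs, ← hdi, ← hdj] at h1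
    simp only [Complex.norm_real, Real.norm_eq_abs, sq_abs, mul_pow,
      Real.sq_sqrt zero_le_two] at h1
    rw [div_self (by positivity), mul_div_assoc, div_self (by positivity)] at h1
    linarith
  have h1 := hw dj (by simp [abs_of_pos hj])
  have h2 := hw (-dj) (by simp [abs_of_pos hj])
  have hs2 : ((√2 * di : ℝ) : ℂ) ^ 2 = 2 * (di : ℂ) ^ 2 := by
    rw [← Complex.ofReal_pow, mul_pow, Real.sq_sqrt zero_le_two]; push_cast; ring
  simp only [op_single_add_single, hs2, hR.vanish z hz i j j hij hij,
    hR.vanish z hz j i i hij.symm hij.symm, hR.symm z hz i j i, hR.symm z hz j i j, ← hb, hcan,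
    mul_zero, add_zero, zero_add, neg_sq, mul_neg, neg_mul] at h1 h2
  have e3 := parallelogram (-(2 * (di : ℂ) ^ 2 * b))
    (((√2 * di : ℝ) : ℂ) * dj * (L.P i i j z + L.P i i j z))
  have e4 := parallelogram ((dj : ℂ) ^ 2 * L.P j j j z) (((√2 * di : ℝ) : ℂ) * dj * (b + b))
  have n1 : ‖-(2 * (di : ℂ) ^ 2 * b)‖ ^ 2 = 4 * di ^ 2 * di ^ 2 * ‖b‖ ^ 2 := by
    simp only [norm_neg, norm_mul, norm_pow, Complex.norm_real, Real.norm_eq_abs,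
      Complex.norm_ofNat, mul_pow, sq_abs]
    ring
  have n2 : ‖((√2 * di : ℝ) : ℂ) * dj * (b + b)‖ ^ 2 = 8 * di ^ 2 * dj ^ 2 * ‖b‖ ^ 2 := by
    rw [← two_mul]
    simp only [norm_mul, Complex.norm_real, Real.norm_eq_abs,
      Complex.norm_ofNat, mul_pow, sq_abs, Real.sq_sqrt zero_le_two]
    ring
  simp only [← sub_eq_add_neg] at h1 h2
  have m1 : ∀ X Y d : ℝ, 0 < d → 2 * (X + Y) / d ^ 2 = 2 * X / d ^ 2 + 2 * Y / d ^ 2 := by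
    intro X Y d hd; ring
  rw [n1] at e3
  rw [n2] at e4
  have q1 := congrArg (· / di ^ 2) e3
  have q2 := congrArg (· / dj ^ 2) e4
  rw [add_div, m1 _ _ _ hi] at q1
  rw [add_div, m1 _ _ _ hj] at q2
  have r1 : 2 * (4 * di ^ 2 * di ^ 2 * ‖b‖ ^ 2) / di ^ 2 = 8 * (‖b‖ * di) ^ 2 := by
    field_simp; ring
  have r2 : 2 * (8 * di ^ 2 * dj ^ 2 * ‖b‖ ^ 2) / dj ^ 2 = 16 * (‖b‖ * di) ^ 2 := by
    field_simp; ring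
  rw [r1] at q1
  rw [r2] at q2
  have p1 : 0 ≤ 2 * ‖((√2 * di : ℝ) : ℂ) * dj * (L.P i i j z + L.P i i j z)‖ ^ 2 / di ^ 2 := by
    positivity
  have p2 : 0 ≤ 2 * ‖(dj : ℂ) ^ 2 * L.P j j j z‖ ^ 2 / dj ^ 2 := by positivity
  linarith

theorem Regular.of_two {L : LinearSystem 2} {ε : ℝ} (hR : L.Regular ε) {α : ℝ≥0}
    (hα : L.opNorm ≤ α) : L.Regular (√(3 / 2) * α) := by
  have key : ∀ z ∈ polydisk 2, ∀ i j : Fin 2, i ≠ j →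
      ‖L.P j j i z‖ * (1 - ‖z i‖ ^ 2) ≤ √(3 / 2) * α := by
    intro z hz i j hij
    refine le_of_sq_le_sq ?_ (by positivity)
    rw [mul_pow (√(3 / 2)), Real.sq_sqrt (by norm_num)]
    exact hR.bound_of_two hα hz hij
  refine { hR with bound := fun z hz m l => ?_ }
  by_cases hml : m = l
  · subst hml
    obtain ⟨j, hj⟩ : ∃ j : Fin 2, m ≠ j := ⟨m + 1, by omega⟩
    have h := hR.canonical z hz m
    rw [sum_eq_add_of_ne hj (by intro k h1 h2; exfalso; omega), hR.symm z hz j m j,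
      add_eq_zero_iff_eq_neg] at h
    rw [h, norm_neg]
    exact key z hz m j hj
  · exact key z hz l m (Ne.symm hml)

end LinearSystem

/-! ### Comparison and first order equations on a disk -/

section DiskCalculus

/-- Comparison along the radius from 0 to ξ, parametrized by modulus. -/
theorem norm_le_of_norm_deriv_le {g g' : ℂ → ℂ} {h h' : ℝ → ℝ} {r : ℝ}
    (hg : ∀ ζ ∈ ball (0 : ℂ) r, HasDerivAt g (g' ζ) ζ)
    (hh : ∀ t ∈ Ico 0 r, HasDerivAt h (h' t) t)
    (hb : ∀ ζ ∈ ball (0 : ℂ) r, ‖g' ζ‖ ≤ h' ‖ζ‖) {ξ : ℂ} (hξ : ξ ∈ ball (0 : ℂ) r) :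
    ‖g ξ‖ ≤ ‖g 0‖ + (h ‖ξ‖ - h 0) := by
  rw [mem_ball_zero_iff] at hξ
  obtain ⟨e, he, hξe⟩ : ∃ e : ℂ, ‖e‖ = 1 ∧ ξ = (‖ξ‖ : ℂ) * e := by
    by_cases h0 : ξ = 0
    · exact ⟨1, by simp, by simp [h0]⟩
    · have : (‖ξ‖ : ℂ) ≠ 0 := by simpa using h0
      exact ⟨ξ / ‖ξ‖, by simp [h0], by field_simp⟩
  have hn : ∀ t : ℝ, 0 ≤ t → ‖(t : ℂ) * e‖ = t := fun t ht => by
    simp [he, abs_of_nonneg ht]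
  have hlt : ∀ t ∈ Icc 0 ‖ξ‖, t ∈ Ico 0 r := fun t ht => ⟨ht.1, ht.2.trans_lt hξ⟩
  have hmem : ∀ t ∈ Icc 0 ‖ξ‖, (t : ℂ) * e ∈ ball (0 : ℂ) r := fun t ht => by
    rw [mem_ball_zero_iff, hn t ht.1]; exact (hlt t ht).2
  have hd : ∀ t ∈ Icc 0 ‖ξ‖, HasDerivAt (fun s : ℝ => g (s * e)) (g' (t * e) * e) t := by
    intro t ht
    have h1 : HasDerivAt (fun s : ℂ => s * e) e (t : ℂ) := by
      simpa using (hasDerivAt_id (t : ℂ)).mul_const e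
    exact ((hg _ (hmem t ht)).comp (t : ℂ) h1).comp_ofReal
  have hB : ∀ t ∈ Icc 0 ‖ξ‖, HasDerivAt (fun s => ‖g 0‖ + (h s - h 0)) (h' t) t :=
    fun t ht => ((hh t (hlt t ht)).sub_const _).const_add _
  have := image_norm_le_of_norm_deriv_right_le_deriv_boundary'
    (f := fun s : ℝ => g (s * e)) (f' := fun t => g' (t * e) * e) (a := 0) (b := ‖ξ‖)
    (fun t ht => (hd t ht).continuousAt.continuousWithinAt)
    (fun t ht => (hd t (Ico_subset_Icc_self ht)).hasDerivWithinAt)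
    (B := fun s => ‖g 0‖ + (h s - h 0)) (B' := h') (by simp)
    (fun t ht => (hB t ht).continuousAt.continuousWithinAt)
    (fun t ht => (hB t (Ico_subset_Icc_self ht)).hasDerivWithinAt)
    (fun t ht => by
      rw [norm_mul, he, mul_one]
      have := hb _ (hmem t (Ico_subset_Icc_self ht))
      rwa [hn t ht.1] at this)
    (right_mem_Icc.2 (norm_nonneg ξ))
  rwa [← hξe] at this

theorem artanh_eq {t : ℝ} (h1 : -1 < t) (h2 : t < 1) :
    Real.artanh t = (Real.log (1 + t) - Real.log (1 - t)) / 2 := by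
  rw [Real.artanh_eq_half_log ⟨h1.le, h2.le⟩, Real.log_div (by linarith) (by linarith)]
  ring

theorem hasDerivAt_artanh {t : ℝ} (h1 : -1 < t) (h2 : t < 1) :
    HasDerivAt Real.artanh (1 / (1 - t ^ 2)) t := by
  have h3 : HasDerivAt (fun t => (Real.log (1 + t) - Real.log (1 - t)) / 2) (1 / (1 - t ^ 2)) t := by
    have e1 : HasDerivAt (fun t => Real.log (1 + t)) (1 / (1 + t)) t := by
      simpa using ((hasDerivAt_id t).const_add 1).log (by simp; linarith)
    have e2 : HasDerivAt (fun t => Real.log (1 - t)) (-1 / (1 - t)) t := by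
      simpa using ((hasDerivAt_id t).const_sub 1).log (by simp; linarith)
    refine ((e1.sub e2).div_const 2).congr_deriv ?_
    have : 1 + t ≠ 0 := by linarith
    have : 1 - t ≠ 0 := by linarith
    have : 1 - t ^ 2 ≠ 0 := by nlinarith
    field_simp
    ring
  refine h3.congr_of_eventuallyEq ?_
  filter_upwards [Ioo_mem_nhds h1 h2] with s hs using artanh_eq hs.1 hs.2

theorem exists_primitive {c : ℂ → ℂ} (hc : DifferentiableOn ℂ c (ball 0 1)) {K : ℝ}
    (hK : ∀ ξ ∈ ball (0 : ℂ) 1, ‖c ξ‖ * (1 - ‖ξ‖ ^ 2) ≤ K) :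
    ∃ C : ℂ → ℂ, C 0 = 0 ∧ (∀ ξ ∈ ball (0 : ℂ) 1, HasDerivAt C (c ξ) ξ) ∧
      ∀ ξ ∈ ball (0 : ℂ) 1, ‖C ξ‖ ≤ K * Real.artanh ‖ξ‖ := by
  obtain ⟨C, hC0, hC⟩ := hc.isExactOn_ball.with_val_at 0 0
  refine ⟨C, hC0, hC, fun ξ hξ => ?_⟩
  have h := norm_le_of_norm_deriv_le (h := fun t => K * Real.artanh t)
    (h' := fun t => K * (1 / (1 - t ^ 2))) hC
    (fun t ht => (hasDerivAt_artanh (by linarith [ht.1]) ht.2).const_mul K) ?_ hξ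
  · simpa [hC0] using h
  · intro ζ hζ
    have h1 := hK ζ hζ
    rw [mem_ball_zero_iff] at hζ
    have h2 : 0 < 1 - ‖ζ‖ ^ 2 := by nlinarith [norm_nonneg ζ]
    rw [mul_one_div, le_div_iff₀ h2]
    exact h1

theorem eq_of_hasDerivAt_zero {g : ℂ → ℂ} {r : ℝ} (hg : ∀ ζ ∈ ball (0 : ℂ) r, HasDerivAt g 0 ζ)
    {ξ : ℂ} (hξ : ξ ∈ ball (0 : ℂ) r) : g ξ = g 0 := by
  have h := norm_le_of_norm_deriv_le (g := fun ζ => g ζ - g 0) (g' := fun _ => 0) (h := fun _ => 0)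
    (h' := fun _ => 0) (fun ζ hζ => (hg ζ hζ).sub_const _) (fun t _ => hasDerivAt_const t 0)
    (by simp) hξ
  simpa [sub_eq_zero] using h

theorem eq_mul_exp_of_hasDerivAt {y c C : ℂ → ℂ} {r : ℝ}
    (hy : ∀ ζ ∈ ball (0 : ℂ) r, HasDerivAt y (c ζ * y ζ) ζ)
    (hC : ∀ ζ ∈ ball (0 : ℂ) r, HasDerivAt C (c ζ) ζ) (hC0 : C 0 = 0) {ξ : ℂ}
    (hξ : ξ ∈ ball (0 : ℂ) r) : y ξ = y 0 * Complex.exp (C ξ) := by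
  have h := eq_of_hasDerivAt_zero (g := fun ζ => y ζ * Complex.exp (-C ζ)) (r := r) (fun ζ hζ => by
    refine ((hy ζ hζ).mul (hC ζ hζ).neg.cexp).congr_deriv ?_
    simp; ring) hξ
  simp only [hC0, neg_zero, Complex.exp_zero, mul_one] at h
  rw [← h, mul_assoc, ← Complex.exp_add]
  simp

theorem norm_log_one_sub_le {x : ℂ} {q : ℝ} (hx : ‖x‖ ≤ q) (hq : q < 1) :
    ‖Complex.log (1 - x)‖ ≤ -Real.log (1 - q) := by
  have hr : ∀ ζ ∈ ball (0 : ℂ) 1, HasDerivAt (fun ζ => Complex.log (1 - ζ)) (-1 / (1 - ζ)) ζ := by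
    intro ζ hζ
    rw [mem_ball_zero_iff] at hζ
    have h1 : 1 - ζ ∈ Complex.slitPlane :=
      Or.inl (by simp; linarith [Complex.re_le_norm ζ])
    simpa using ((hasDerivAt_id ζ).const_sub 1).clog h1
  have h := norm_le_of_norm_deriv_le (h := fun t => -Real.log (1 - t)) (h' := fun t => 1 / (1 - t))
    hr (fun t ht => by
      have := (((hasDerivAt_id t).const_sub 1).log (by simp; linarith [ht.2])).fun_neg
      simpa [neg_div] using this) ?_ (ξ := x) (by rw [mem_ball_zero_iff]; linarith)
  · simp at h
    refine h.trans ?_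
    have h3 : Real.log (1 - q) ≤ Real.log (1 - ‖x‖) :=
      Real.log_le_log (by linarith) (by linarith)
    linarith
  · intro ζ hζ
    rw [mem_ball_zero_iff] at hζ
    rw [norm_div, norm_neg, norm_one]
    refine one_div_le_one_div_of_le (by linarith) ?_
    have := norm_sub_norm_le (1 : ℂ) ζ
    rw [norm_one] at this
    exact this

end DiskCalculus

/-! ### The system on a coordinate axis, solved by quadratures -/

section Axis

/-- `Φ` is a majorant, bounded by `F`, of the primitives on the disk of radius `r` of functions
growing at most like `((1 + |ξ|) / (1 - |ξ|)) ^ (3 ε / 2)`. -/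
structure GrowthMajorant (ε r F : ℝ) (Φ φ : ℝ → ℝ) : Prop where
  zero : Φ 0 = 0
  nonneg : ∀ t ∈ Ico 0 r, 0 ≤ Φ t
  le : ∀ t ∈ Ico 0 r, Φ t ≤ F
  hasDerivAt : ∀ t ∈ Ico 0 r, HasDerivAt Φ (φ t) t
  exp_le : ∀ t ∈ Ico 0 r, Real.exp (3 * ε * Real.artanh t) ≤ φ t

/-- Bound for `(∂_m u - P^k_{km} u) / ∂_m e_m` on the `k`-th axis. -/
def rowBound (ε F : ℝ) : ℝ := ε * (2 * (1 + ε * F) + 2 * ε * F + 3 / 2 * F + 3 / 4 * ε * F ^ 2)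

/-- A primitive of `rowBound ε`, divided by `(1 - ε F) ^ 2`. -/
def entryBound (ε F x : ℝ) : ℝ :=
  ε / (1 - ε * F) ^ 2 * (2 * x + 3 / 4 * x ^ 2 + ε * (2 * x ^ 2 + 1 / 4 * x ^ 3))

/-- The restriction to the `k`-th coordinate axis of the coefficients of the system and of the
`1`-jets, in the directions `k` and `m`, of the solutions `u` and `w` with the `1`-jets
`u = 1, ∇u = 0` and `w = 0, ∂_k w = 1, ∂_m w = 0` at the origin. Here `p`, `b`, `b'`, `p'` stand for
`P^k_{kk}`, `P^m_{mk}`, `P^k_{km}`, `P^m_{mm}`. -/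
structure AxisData (ε : ℝ) (p b bt pt bd btd ptd e u u₁ u₂ w w₁ w₂ E : ℂ → ℂ) : Prop where
  hp : DifferentiableOn ℂ p (ball 0 1)
  hb : ∀ ξ ∈ ball (0 : ℂ) 1, HasDerivAt b (bd ξ) ξ
  hbt : ∀ ξ ∈ ball (0 : ℂ) 1, HasDerivAt bt (btd ξ) ξ
  hpt : ∀ ξ ∈ ball (0 : ℂ) 1, HasDerivAt pt (ptd ξ) ξ
  p_le : ∀ ξ ∈ ball (0 : ℂ) 1, ‖p ξ‖ * (1 - ‖ξ‖ ^ 2) ≤ ε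
  b_le : ∀ ξ ∈ ball (0 : ℂ) 1, ‖b ξ‖ * (1 - ‖ξ‖ ^ 2) ≤ ε
  bt_le : ∀ ξ ∈ ball (0 : ℂ) 1, ‖bt ξ‖ ≤ ε
  pt_le : ∀ ξ ∈ ball (0 : ℂ) 1, ‖pt ξ‖ ≤ ε
  he : ∀ ξ ∈ ball (0 : ℂ) 1, HasDerivAt e ((p ξ - 2 * b ξ) * e ξ) ξ
  e_le : ‖e 0‖ ≤ 3 * ε
  hu : ∀ ξ ∈ ball (0 : ℂ) 1, HasDerivAt u (u₁ ξ) ξ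
  hu₁ : ∀ ξ ∈ ball (0 : ℂ) 1, HasDerivAt u₁ (p ξ * u₁ ξ + (bd ξ + b ξ ^ 2 - p ξ * b ξ) * u ξ) ξ
  hu₂ : ∀ ξ ∈ ball (0 : ℂ) 1, HasDerivAt u₂ (bt ξ * u₁ ξ + b ξ * u₂ ξ +
    (ptd ξ / 2 - e ξ / 2 - b ξ * bt ξ) * u ξ) ξ
  hw : ∀ ξ ∈ ball (0 : ℂ) 1, HasDerivAt w (w₁ ξ) ξ
  hw₁ : ∀ ξ ∈ ball (0 : ℂ) 1, HasDerivAt w₁ (p ξ * w₁ ξ + (bd ξ + b ξ ^ 2 - p ξ * b ξ) * w ξ) ξ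
  hw₂ : ∀ ξ ∈ ball (0 : ℂ) 1, HasDerivAt w₂ (bt ξ * w₁ ξ + b ξ * w₂ ξ +
    (ptd ξ / 2 - e ξ / 2 - b ξ * bt ξ) * w ξ) ξ
  hE : ∀ ξ ∈ ball (0 : ℂ) 1, HasDerivAt E (b ξ * E ξ) ξ
  u_zero : u 0 = 1
  u₁_zero : u₁ 0 = 0
  u₂_zero : u₂ 0 = 0
  w_zero : w 0 = 0
  w₁_zero : w₁ 0 = 1
  E_zero : E 0 = 1

variable {ε r F : ℝ} {Φ φ : ℝ → ℝ} {p b bt pt bd btd ptd e u u₁ u₂ w w₁ w₂ E : ℂ → ℂ}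

theorem GrowthMajorant.norm_le (hΦ : GrowthMajorant ε r F Φ φ) {g g' C : ℂ → ℂ} {c : ℂ}
    (hg : ∀ ζ ∈ ball (0 : ℂ) r, HasDerivAt g (g' ζ) ζ)
    (hC : ∀ ζ ∈ ball (0 : ℂ) r, ‖C ζ‖ ≤ 3 * ε * Real.artanh ‖ζ‖)
    (hg' : ∀ ζ ∈ ball (0 : ℂ) r, g' ζ = c * Complex.exp (C ζ)) {ξ : ℂ} (hξ : ξ ∈ ball (0 : ℂ) r) :
    ‖g ξ‖ ≤ ‖g 0‖ + ‖c‖ * Φ ‖ξ‖ := by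
  have h := norm_le_of_norm_deriv_le (h := fun t => ‖c‖ * Φ t) (h' := fun t => ‖c‖ * φ t) hg
    (fun t ht => (hΦ.hasDerivAt t ht).const_mul _) ?_ hξ
  · simpa [hΦ.zero] using h
  · intro ζ hζ
    rw [hg' ζ hζ, norm_mul, Complex.norm_exp]
    have hζ' : ‖ζ‖ ∈ Ico 0 r := ⟨norm_nonneg _, by simpa using hζ⟩
    refine mul_le_mul_of_nonneg_left ((Real.exp_le_exp.2 ?_).trans (hΦ.exp_le _ hζ'))
      (norm_nonneg _)
    exact (Complex.re_le_norm _).trans (hC ζ hζ)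

/-- The second order equation on the axis factors. For a solution v, the function v' - b v is
multiplied by p - b under differentiation; after division by E, where E' = b E, the factor becomes p
- 2 b. Hence (v / E)' is a constant times exp C with C' = p - 2 b. For f = w / E and y = u / E this
gives f' = exp C and y' = -b(0) exp C, so y = 1 - b(0) f stays within ε F of 1. Then w / u = f / y
has derivative exp C / y², which is why the logarithm is l = C - 2 log y. -/
theorem AxisData.estimates
    (D : AxisData ε p b bt pt bd btd ptd e u u₁ u₂ w w₁ w₂ E) (hr : r ≤ 1) (hr0 : 0 < r)
    (hε : 0 ≤ ε) (hΦ : GrowthMajorant ε r F Φ φ) (hεF : ε * F < 1) :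
    (∀ ξ ∈ ball (0 : ℂ) r, u ξ ≠ 0) ∧ (∀ ξ ∈ ball (0 : ℂ) r, E ξ ≠ 0) ∧
    (∀ ξ ∈ ball (0 : ℂ) r, ‖w ξ / u ξ‖ ≤ F / (1 - ε * F)) ∧
    (∀ ξ ∈ ball (0 : ℂ) r, ‖(u₂ ξ - bt ξ * u ξ) / E ξ‖ ≤ rowBound ε F) ∧
    (∀ ξ ∈ ball (0 : ℂ) r, HasDerivAt (fun ξ => (w ξ / u ξ * u₂ ξ - w₂ ξ) / E ξ)
      ((u₂ ξ - bt ξ * u ξ) / E ξ * deriv (fun ξ => w ξ / u ξ) ξ) ξ) ∧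
    (∀ ξ ∈ ball (0 : ℂ) r, ‖(u₂ ξ - bt ξ * u ξ) / E ξ * deriv (fun ξ => w ξ / u ξ) ξ‖ ≤
      ε / (1 - ε * F) ^ 2 * ((2 + 3 / 2 * Φ ‖ξ‖ + ε * (4 * Φ ‖ξ‖ + 3 / 4 * Φ ‖ξ‖ ^ 2)) * φ ‖ξ‖)) ∧
    (∀ ξ ∈ ball (0 : ℂ) r, DifferentiableAt ℂ (fun ξ => w ξ / u ξ) ξ) ∧
    ∃ l : ℂ → ℂ, l 0 = 0 ∧ DifferentiableOn ℂ l (ball 0 r) ∧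
      (∀ ξ ∈ ball (0 : ℂ) r, deriv (fun ξ => w ξ / u ξ) ξ = Complex.exp (l ξ)) ∧
      ∀ ξ ∈ ball (0 : ℂ) r, ‖l ξ‖ ≤ 3 * ε * Real.artanh ‖ξ‖ - 2 * Real.log (1 - ε * F) := by
  have hsub : ball (0 : ℂ) r ⊆ ball 0 1 := ball_subset_ball hr
  have h0r : (0 : ℂ) ∈ ball (0 : ℂ) r := mem_ball_self hr0
  have h01 : (0 : ℂ) ∈ ball (0 : ℂ) 1 := mem_ball_self one_pos
  have hIco : ∀ ξ ∈ ball (0 : ℂ) r, ‖ξ‖ ∈ Ico 0 r := fun ξ hξ =>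
    ⟨norm_nonneg _, by simpa using hξ⟩
  have hbd : DifferentiableOn ℂ b (ball 0 1) := fun ξ hξ =>
    (D.hb ξ hξ).differentiableAt.differentiableWithinAt
  obtain ⟨β, hβ0, hβ, -⟩ := exists_primitive hbd D.b_le
  -- The constant 3 ε is ε for p plus 2 ε for 2 b; it governs the growth rate of the whole estimate.
  obtain ⟨C, hC0, hC, hCn⟩ := exists_primitive (c := fun ξ => p ξ - 2 * b ξ)
    (D.hp.sub (hbd.const_mul 2)) (K := 3 * ε) (fun ξ hξ => by
      have h1 := D.p_le ξ hξ
      have h2 := D.b_le ξ hξ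
      rw [mem_ball_zero_iff] at hξ
      have h3 : 0 < 1 - ‖ξ‖ ^ 2 := by nlinarith [norm_nonneg ξ]
      have h4 : ‖p ξ - 2 * b ξ‖ ≤ ‖p ξ‖ + 2 * ‖b ξ‖ := by
        refine (norm_sub_le _ _).trans ?_
        simp
      nlinarith [mul_le_mul_of_nonneg_right h4 h3.le])
  have hCr : ∀ ζ ∈ ball (0 : ℂ) r, ‖C ζ‖ ≤ 3 * ε * Real.artanh ‖ζ‖ := fun ζ hζ => hCn ζ (hsub hζ)
  have hEe : ∀ ξ ∈ ball (0 : ℂ) 1, E ξ = Complex.exp (β ξ) := fun ξ hξ => by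
    rw [eq_mul_exp_of_hasDerivAt D.hE hβ hβ0 hξ, D.E_zero, one_mul]
  have hE0 : ∀ ξ ∈ ball (0 : ℂ) 1, E ξ ≠ 0 := fun ξ hξ => by
    rw [hEe ξ hξ]; exact Complex.exp_ne_zero _
  have hb0 : ‖b 0‖ ≤ ε := by simpa using D.b_le 0 h01
  -- the ratios `y = u / E` and `f = w / E`
  have hsol : ∀ v v₁ : ℂ → ℂ, (∀ ξ ∈ ball (0 : ℂ) 1, HasDerivAt v (v₁ ξ) ξ) →
      (∀ ξ ∈ ball (0 : ℂ) 1, HasDerivAt v₁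
        (p ξ * v₁ ξ + (bd ξ + b ξ ^ 2 - p ξ * b ξ) * v ξ) ξ) →
      ∀ ξ ∈ ball (0 : ℂ) 1, (v₁ ξ - b ξ * v ξ) / E ξ = (v₁ 0 - b 0 * v 0) * Complex.exp (C ξ) := by
    intro v v₁ hv hv₁ ξ hξ
    have h := eq_mul_exp_of_hasDerivAt (y := fun ξ => (v₁ ξ - b ξ * v ξ) / E ξ)
      (c := fun ξ => p ξ - 2 * b ξ) (fun ζ hζ => by
        refine (((hv₁ ζ hζ).sub ((D.hb ζ hζ).mul (hv ζ hζ))).div (D.hE ζ hζ)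
          (hE0 ζ hζ)).congr_deriv ?_
        have := hE0 ζ hζ
        field_simp
        simp
        ring) hC hC0 hξ
    simpa [D.E_zero] using h
  have hquot : ∀ v v₁ : ℂ → ℂ, (∀ ξ ∈ ball (0 : ℂ) 1, HasDerivAt v (v₁ ξ) ξ) →
      ∀ ξ ∈ ball (0 : ℂ) 1, HasDerivAt (fun ξ => v ξ / E ξ) ((v₁ ξ - b ξ * v ξ) / E ξ) ξ := by
    intro v v₁ hv ξ hξ
    refine ((hv ξ hξ).div (D.hE ξ hξ) (hE0 ξ hξ)).congr_deriv ?_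
    have := hE0 ξ hξ
    field_simp
  have hy' := hsol u u₁ D.hu D.hu₁
  have hf' := hsol w w₁ D.hw D.hw₁
  simp only [D.u_zero, D.u₁_zero, D.w_zero, D.w₁_zero, mul_one, mul_zero, sub_zero, zero_sub,
    one_mul] at hy' hf'
  set y : ℂ → ℂ := fun ξ => u ξ / E ξ with hy
  set f : ℂ → ℂ := fun ξ => w ξ / E ξ with hf
  have hyd : ∀ ξ ∈ ball (0 : ℂ) 1, HasDerivAt y (-b 0 * Complex.exp (C ξ)) ξ := fun ξ hξ => by
    rw [← hy' ξ hξ]; exact hquot u u₁ D.hu ξ hξ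
  have hfd : ∀ ξ ∈ ball (0 : ℂ) 1, HasDerivAt f (Complex.exp (C ξ)) ξ := fun ξ hξ => by
    rw [← hf' ξ hξ]; exact hquot w w₁ D.hw ξ hξ
  have hyf : ∀ ξ ∈ ball (0 : ℂ) 1, y ξ = 1 - b 0 * f ξ := by
    intro ξ hξ
    have h := eq_of_hasDerivAt_zero (g := fun ζ => y ζ + b 0 * f ζ) (fun ζ hζ => by
      refine ((hyd ζ hζ).add ((hfd ζ hζ).const_mul (b 0))).congr_deriv ?_
      ring) hξ
    simp [hy, hf, D.u_zero, D.w_zero, D.E_zero] at h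
    linear_combination h
  have hfn : ∀ ξ ∈ ball (0 : ℂ) r, ‖f ξ‖ ≤ Φ ‖ξ‖ := by
    intro ξ hξ
    have h := hΦ.norm_le (g := f) (c := 1) (fun ζ hζ => hfd ζ (hsub hζ)) hCr (fun ζ _ => by simp) hξ
    simpa [hf, D.w_zero] using h
  have hfF : ∀ ξ ∈ ball (0 : ℂ) r, ‖f ξ‖ ≤ F := fun ξ hξ => (hfn ξ hξ).trans (hΦ.le _ (hIco ξ hξ))
  have hF0 : 0 ≤ F := (hΦ.nonneg 0 ⟨le_rfl, hr0⟩).trans (hΦ.le 0 ⟨le_rfl, hr0⟩)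
  have hbf : ∀ ξ ∈ ball (0 : ℂ) r, ‖b 0 * f ξ‖ ≤ ε * Φ ‖ξ‖ := fun ξ hξ => by
    rw [norm_mul]; exact mul_le_mul hb0 (hfn ξ hξ) (norm_nonneg _) hε
  have hbF : ∀ ξ ∈ ball (0 : ℂ) r, ‖b 0 * f ξ‖ ≤ ε * F := fun ξ hξ =>
    (hbf ξ hξ).trans (mul_le_mul_of_nonneg_left (hΦ.le _ (hIco ξ hξ)) hε)
  have hyu : ∀ ξ ∈ ball (0 : ℂ) r, ‖y ξ‖ ≤ 1 + ε * Φ ‖ξ‖ := fun ξ hξ => by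
    rw [hyf ξ (hsub hξ)]
    refine (norm_sub_le _ _).trans ?_
    rw [norm_one]
    linarith [hbf ξ hξ]
  have hyl : ∀ ξ ∈ ball (0 : ℂ) r, 1 - ε * F ≤ ‖y ξ‖ := fun ξ hξ => by
    rw [hyf ξ (hsub hξ)]
    have := norm_sub_norm_le (1 : ℂ) (b 0 * f ξ)
    rw [norm_one] at this
    linarith [hbF ξ hξ]
  have hεF0 : 0 < 1 - ε * F := by linarith
  have hy0 : ∀ ξ ∈ ball (0 : ℂ) r, y ξ ≠ 0 := fun ξ hξ h => by
    have := hyl ξ hξ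
    rw [h, norm_zero] at this
    linarith
  have hu0 : ∀ ξ ∈ ball (0 : ℂ) r, u ξ ≠ 0 := fun ξ hξ h => hy0 ξ hξ (by simp [hy, h])
  have hA : ∀ ξ ∈ ball (0 : ℂ) r, w ξ / u ξ = f ξ / y ξ := fun ξ hξ => by
    have := hE0 ξ (hsub hξ)
    have := hu0 ξ hξ
    simp only [hf, hy]
    field_simp
  have hAd : ∀ ξ ∈ ball (0 : ℂ) r, HasDerivAt (fun ξ => w ξ / u ξ)
      ((w₁ ξ * u ξ - w ξ * u₁ ξ) / u ξ ^ 2) ξ := fun ξ hξ =>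
    (D.hw ξ (hsub hξ)).div (D.hu ξ (hsub hξ)) (hu0 ξ hξ)
  have hAd' : ∀ ξ ∈ ball (0 : ℂ) r, deriv (fun ξ => w ξ / u ξ) ξ =
      Complex.exp (C ξ) / y ξ ^ 2 := by
    intro ξ hξ
    have h1 := (hfd ξ (hsub hξ)).div (hyd ξ (hsub hξ)) (hy0 ξ hξ)
    have h2 : (fun ξ => w ξ / u ξ) =ᶠ[𝓝 ξ] (f / y) := by
      filter_upwards [isOpen_ball.mem_nhds hξ] with ζ hζ using hA ζ hζ
    rw [h2.deriv_eq, h1.deriv]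
    congr 1
    have := hyf ξ (hsub hξ)
    linear_combination Complex.exp (C ξ) * this
  have hexp : ∀ ξ ∈ ball (0 : ℂ) r, ‖Complex.exp (C ξ)‖ ≤ φ ‖ξ‖ := fun ξ hξ => by
    rw [Complex.norm_exp]
    exact (Real.exp_le_exp.2 ((Complex.re_le_norm _).trans (hCr ξ hξ))).trans
      (hΦ.exp_le _ (hIco ξ hξ))
  have hAn : ∀ ξ ∈ ball (0 : ℂ) r, ‖deriv (fun ξ => w ξ / u ξ) ξ‖ ≤ φ ‖ξ‖ / (1 - ε * F) ^ 2 := by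
    intro ξ hξ
    rw [hAd' ξ hξ, norm_div, norm_pow]
    exact div_le_div₀ ((norm_nonneg _).trans (hexp ξ hξ)) (hexp ξ hξ) (by positivity)
      (pow_le_pow_left₀ hεF0.le (hyl ξ hξ) 2)
  -- the bound for the ratio `(u₂ - bt u) / E`
  have hee : ∀ ξ ∈ ball (0 : ℂ) 1, e ξ = e 0 * Complex.exp (C ξ) := fun ξ hξ =>
    eq_mul_exp_of_hasDerivAt D.he hC hC0 hξ
  set R : ℂ → ℂ := fun ξ => (u₂ ξ - bt ξ * u ξ) / E ξ with hR
  have hRd : ∀ ξ ∈ ball (0 : ℂ) 1, HasDerivAt R (y ξ * (ptd ξ / 2 - e ξ / 2 - btd ξ)) ξ := by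
    intro ξ hξ
    refine (((D.hu₂ ξ hξ).sub ((D.hbt ξ hξ).mul (D.hu ξ hξ))).div (D.hE ξ hξ)
      (hE0 ξ hξ)).congr_deriv ?_
    have := hE0 ξ hξ
    simp only [hy, Pi.sub_apply, Pi.mul_apply]
    field_simp
    ring
  -- Integration by parts: R' contains the derivatives of `bt` and `pt`, for which no bound is
  -- available. Adding this term moves the derivative onto y and leaves `bt` and `pt` themselves,
  -- which are bounded by ε. Subtracting `pt 0` makes G vanish at 0.
  set G : ℂ → ℂ := fun ξ => R ξ + y ξ * (bt ξ - (pt ξ - pt 0) / 2) with hG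
  have hGd : ∀ ξ ∈ ball (0 : ℂ) 1, HasDerivAt G
      (-b 0 * Complex.exp (C ξ) * (bt ξ - (pt ξ - pt 0) / 2) - e ξ / 2 * y ξ) ξ := by
    intro ξ hξ
    refine ((hRd ξ hξ).add ((hyd ξ hξ).mul ((D.hbt ξ hξ).sub
      (((D.hpt ξ hξ).sub_const _).div_const 2)))).congr_deriv ?_
    simp only [Pi.sub_apply]
    ring
  have hcoef : ∀ ξ ∈ ball (0 : ℂ) 1, ‖bt ξ - (pt ξ - pt 0) / 2‖ ≤ 2 * ε := by
    intro ξ hξ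
    have h1 := D.bt_le ξ hξ
    have h2 := D.pt_le ξ hξ
    have h3 := D.pt_le 0 h01
    have h4 : ‖(pt ξ - pt 0) / 2‖ ≤ ε := by
      rw [norm_div, Complex.norm_ofNat]
      linarith [norm_sub_le (pt ξ) (pt 0)]
    linarith [norm_sub_le (bt ξ) ((pt ξ - pt 0) / 2)]
  have hGn : ∀ ξ ∈ ball (0 : ℂ) r, ‖G ξ‖ ≤
      2 * ε ^ 2 * Φ ‖ξ‖ + 3 / 2 * ε * (Φ ‖ξ‖ + ε * Φ ‖ξ‖ ^ 2 / 2) := by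
    intro ξ hξ
    have h := norm_le_of_norm_deriv_le
      (h := fun t => 2 * ε ^ 2 * Φ t + 3 / 2 * ε * (Φ t + ε * Φ t ^ 2 / 2))
      (h' := fun t => (2 * ε ^ 2 + 3 / 2 * ε * (1 + ε * Φ t)) * φ t)
      (fun ζ hζ => hGd ζ (hsub hζ)) (fun t ht => by
        have h1 := hΦ.hasDerivAt t ht
        refine ((h1.const_mul (2 * ε ^ 2)).add ((h1.add (((h1.pow 2).const_mul ε).div_const
          2)).const_mul (3 / 2 * ε))).congr_deriv ?_
        simp; ring) (fun ζ hζ => by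
        have h1 := hexp ζ hζ
        have h2 := hyu ζ hζ
        have h3 := hcoef ζ (hsub hζ)
        have h4 := hΦ.nonneg _ (hIco ζ hζ)
        have h5 : 0 ≤ φ ‖ζ‖ := (norm_nonneg _).trans h1
        refine (norm_sub_le _ _).trans ?_
        rw [hee ζ (hsub hζ), norm_mul, norm_mul, norm_neg, norm_mul, norm_div, norm_mul,
          Complex.norm_ofNat]
        have e1 : ‖b 0‖ * ‖Complex.exp (C ζ)‖ * ‖bt ζ - (pt ζ - pt 0) / 2‖ ≤
            ε * φ ‖ζ‖ * (2 * ε) := by gcongr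
        have e2 : ‖e 0‖ * ‖Complex.exp (C ζ)‖ / 2 * ‖y ζ‖ ≤
            3 * ε * φ ‖ζ‖ / 2 * (1 + ε * Φ ‖ζ‖) := by
          have := D.e_le
          gcongr
        nlinarith [e1, e2]) hξ
    have hG0 : ‖G 0‖ ≤ 0 := by
      simp [hG, hR, hy, D.u_zero, D.u₂_zero, D.E_zero]
    simp only [hΦ.zero] at h
    simp only [ne_eq, OfNat.ofNat_ne_zero, not_false_eq_true, zero_pow, mul_zero, zero_div,
      add_zero, sub_zero] at h
    linarith
  have hRn : ∀ ξ ∈ ball (0 : ℂ) r, ‖R ξ‖ ≤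
      ε * (2 + 3 / 2 * Φ ‖ξ‖ + ε * (4 * Φ ‖ξ‖ + 3 / 4 * Φ ‖ξ‖ ^ 2)) := by
    intro ξ hξ
    have h1 : R ξ = G ξ - y ξ * (bt ξ - (pt ξ - pt 0) / 2) := by simp [hG]
    have h2 : ‖y ξ * (bt ξ - (pt ξ - pt 0) / 2)‖ ≤ (1 + ε * Φ ‖ξ‖) * (2 * ε) := by
      rw [norm_mul]
      exact mul_le_mul (hyu ξ hξ) (hcoef ξ (hsub hξ)) (norm_nonneg _)
        ((norm_nonneg _).trans (hyu ξ hξ))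
    rw [h1]
    have h3 := hGn ξ hξ
    refine (norm_sub_le _ _).trans ?_
    nlinarith
  refine ⟨hu0, fun ξ hξ => hE0 ξ (hsub hξ), ?_, ?_, ?_, ?_,
    fun ξ hξ => (hAd ξ hξ).differentiableAt, ?_⟩
  · intro ξ hξ
    rw [hA ξ hξ, norm_div]
    exact div_le_div₀ hF0 (hfF ξ hξ) hεF0 (hyl ξ hξ)
  · intro ξ hξ
    refine (hRn ξ hξ).trans ?_
    have h1 := hΦ.nonneg _ (hIco ξ hξ)
    have h2 := hΦ.le _ (hIco ξ hξ)
    have h3 : ε * (4 * Φ ‖ξ‖ + 3 / 4 * Φ ‖ξ‖ ^ 2) ≤ ε * (4 * F + 3 / 4 * F ^ 2) := by gcongr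
    rw [rowBound]
    refine mul_le_mul_of_nonneg_left ?_ hε
    linarith
  · intro ξ hξ
    have hξ1 := hsub hξ
    refine ((((hAd ξ hξ).mul (D.hu₂ ξ hξ1)).sub (D.hw₂ ξ hξ1)).div (D.hE ξ hξ1)
      (hE0 ξ hξ1)).congr_deriv ?_
    rw [(hAd ξ hξ).deriv]
    have := hE0 ξ hξ1
    have := hu0 ξ hξ
    simp only [Pi.mul_apply, Pi.sub_apply]
    field_simp
    ring
  · intro ξ hξ
    have hp0 : 0 ≤ φ ‖ξ‖ := (norm_nonneg _).trans (hexp ξ hξ)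
    rw [norm_mul]
    have h := mul_le_mul (hRn ξ hξ) (hAn ξ hξ) (norm_nonneg _) ((norm_nonneg _).trans (hRn ξ hξ))
    refine h.trans (le_of_eq ?_)
    field_simp
  · have hslit : ∀ ξ ∈ ball (0 : ℂ) r, y ξ ∈ Complex.slitPlane := by
      intro ξ hξ
      left
      rw [hyf ξ (hsub hξ), Complex.sub_re, Complex.one_re]
      linarith [Complex.re_le_norm (b 0 * f ξ), hbF ξ hξ]
    refine ⟨fun ξ => C ξ - 2 * Complex.log (y ξ), ?_, ?_, ?_, ?_⟩
    · simp [hC0, hy, D.u_zero, D.E_zero]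
    · intro ξ hξ
      exact ((hC ξ (hsub hξ)).differentiableAt.sub
        (((hyd ξ (hsub hξ)).clog (hslit ξ hξ)).differentiableAt.const_mul
          2)).differentiableWithinAt
    · intro ξ hξ
      rw [hAd' ξ hξ, Complex.exp_sub, two_mul, Complex.exp_add, Complex.exp_log (hy0 ξ hξ), sq]
    · intro ξ hξ
      refine (norm_sub_le _ _).trans ?_
      have h1 := norm_log_one_sub_le (hbF ξ hξ) hεF
      rw [← hyf ξ (hsub hξ)] at h1
      rw [norm_mul, Complex.norm_ofNat]
      linarith [hCr ξ hξ]

end Axis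

namespace LinearSystem

/-! ### Restricting a regular system to the axes -/

section AxisRestriction

variable {n : ℕ} {L : LinearSystem n} {ε : ℝ}

theorem hasDerivAt_axis {f : (Fin n → ℂ) → ℂ} (hf : DifferentiableOn ℂ f (polydisk n)) (k : Fin n)
    {ξ : ℂ} (hξ : ξ ∈ ball (0 : ℂ) 1) :
    HasDerivAt (fun ζ => f (Pi.single k ζ)) (pderiv k f (Pi.single k ξ)) ξ := by
  have h : ∀ ζ : ℂ, (0 : Fin n → ℂ) + ζ • Pi.single k 1 = Pi.single k ζ := fun ζ => by
    rw [zero_add, ← Pi.single_smul, smul_eq_mul, mul_one]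
  have h1 := hasDerivAt_comp_line (f := f) (x := 0) (v := Pi.single k 1) (ξ := ξ)
    (by rw [h]; exact DifferentiableOn.at_polydisk hf (single_mem_polydisk hξ))
  simp only [h] at h1
  exact h1

theorem norm_deriv_zero_le {f : ℂ → ℂ} {r M : ℝ} (hr : 0 < r)
    (hf : DifferentiableOn ℂ f (ball 0 r)) (hM : ∀ ξ ∈ ball (0 : ℂ) r, ‖f ξ‖ ≤ M) :
    ‖deriv f 0‖ ≤ M / r := by
  have key : ∀ ρ : ℝ, 0 < ρ → ρ < r → ‖deriv f 0‖ ≤ M / ρ := by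
    intro ρ h1 h2
    have hsub : closedBall (0 : ℂ) ρ ⊆ ball 0 r := closedBall_subset_ball h2
    refine Complex.norm_deriv_le_of_forall_mem_sphere_norm_le h1
      (DifferentiableOn.diffContOnCl (by rw [closure_ball _ h1.ne']; exact hf.mono hsub)) ?_
    exact fun w hw => hM w (hsub (sphere_subset_closedBall hw))
  have ht : Tendsto (fun ρ : ℝ => M / ρ) (𝓝[<] r) (𝓝 (M / r)) :=
    (ContinuousAt.tendsto (by fun_prop (disch := exact hr.ne'))).mono_left nhdsWithin_le_nhds
  refine ge_of_tendsto ht ?_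
  filter_upwards [Ioo_mem_nhdsLT hr] with ρ hρ using key ρ hρ.1 hρ.2

theorem Regular.pderiv_pderiv_self (hR : L.Regular ε) {v : (Fin n → ℂ) → ℂ} (hv : L.IsSolution v)
    {z : Fin n → ℂ} (hz : z ∈ polydisk n) (k : Fin n) :
    pderiv k (pderiv k v) z = L.P k k k z * pderiv k v z + L.P₀ k k z * v z := by
  rw [hv.2 z hz, Finset.sum_eq_single k]
  · intro l _ hl; rw [hR.vanish z hz l k k hl hl, zero_mul]
  · simp

theorem Regular.pderiv_pderiv_of_ne (hR : L.Regular ε) {v : (Fin n → ℂ) → ℂ}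
    (hv : L.IsSolution v) {z : Fin n → ℂ} (hz : z ∈ polydisk n) {k m : Fin n} (hkm : k ≠ m) :
    pderiv k (pderiv m v) z =
      L.P k k m z * pderiv k v z + L.P m m k z * pderiv m v z + L.P₀ k m z * v z := by
  rw [hv.2 z hz, sum_eq_add_of_ne hkm, hR.symm z hz m k m]
  intro l h1 h2; rw [hR.vanish z hz l k m h1 h2, zero_mul]

/-- A solution whose `1`-jet at `x` vanishes except in the `m`-th direction vanishes together with
its tangential derivatives on the hyperplane `z_m = x_m`. -/
theorem Regular.eq_zero_on_hyperplane (hR : L.Regular ε) {v : (Fin n → ℂ) → ℂ}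
    (hv : L.IsSolution v) {m : Fin n} {x y : Fin n → ℂ} (hx : x ∈ polydisk n) (hy : y ∈ polydisk n)
    (hxy : y m = x m) (h0 : v x = 0) (h1 : ∀ i, i ≠ m → pderiv i v x = 0) :
    v y = 0 ∧ ∀ i, i ≠ m → pderiv i v y = 0 := by
  have h := hv.eq_zero_of_jet_eq_zero hR.hol (Finset.univ.erase m) (fun z hz i hi j hj l hl => by
    have : l = m := by simpa using hl
    subst this
    exact hR.vanish z hz l i j (Finset.ne_of_mem_erase hi).symm (Finset.ne_of_mem_erase hj).symm)
    hx hy (fun i hi => by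
      have : i = m := by simpa using hi
      rw [this, hxy]) h0 (fun i hi => h1 i (Finset.ne_of_mem_erase hi))
  exact ⟨h.1, fun i hi => h.2 i (by simpa using hi)⟩

/-- For a solution `v`, the function `∂_k v - P^m_{mk} v` satisfies a first order equation along
the `k`-th direction. -/
theorem Regular.pderiv_sub_mul (hR : L.Regular ε) {v : (Fin n → ℂ) → ℂ} (hv : L.IsSolution v)
    {z : Fin n → ℂ} (hz : z ∈ polydisk n) {k m : Fin n} (hkm : k ≠ m) :
    pderiv k (fun z => pderiv k v z - L.P m m k z * v z) z =
      (L.P k k k z - L.P m m k z) * (pderiv k v z - L.P m m k z * v z) := by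
  have hb : DifferentiableAt ℂ (L.P m m k) z := DifferentiableOn.at_polydisk (hR.hol.1 m m k) hz
  rw [pderiv_sub (hv.differentiableAt_pderiv hz k) (hb.fun_mul (hv.differentiableAt hz)),
    pderiv_mul hb (hv.differentiableAt hz), hR.pderiv_pderiv_self hv hz, hR.P₀_diag z hz k m hkm]
  ring

/-- Take the solution v for which r = ∂_k v - P^m_{mk} v vanishes at 0, hence on the whole k-th
axis. There v' = b v, so v has no zeros, and ∂_m r equals minus the quantity in question times v.
Applying ∂_m to the equation of r, on the axis where r = 0, gives ∂_k ∂_m r = (p - b) ∂_m r.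
Dividing by v changes p - b into p - 2 b. -/
theorem Regular.hasDerivAt_curvature (hR : L.Regular ε) {k m : Fin n} (hkm : k ≠ m) {ξ : ℂ}
    (hξ : ξ ∈ ball (0 : ℂ) 1) :
    HasDerivAt (fun ζ => -pderiv k (L.P m m m) (Pi.single k ζ) +
        2 * pderiv m (L.P m m k) (Pi.single k ζ))
      ((L.P k k k (Pi.single k ξ) - 2 * L.P m m k (Pi.single k ξ)) *
        (-pderiv k (L.P m m m) (Pi.single k ξ) + 2 * pderiv m (L.P m m k) (Pi.single k ξ))) ξ := by
  obtain ⟨v, hv, hv0, hv1⟩ := hR.exists_solution 0 zero_mem_polydisk 1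
    (Pi.single k (L.P m m k 0))
  have hbh := hR.hol.1 m m k
  have hph := hR.hol.1 k k k
  set r : (Fin n → ℂ) → ℂ := fun z => pderiv k v z - L.P m m k z * v z with hr
  have hrh : DifferentiableOn ℂ r (polydisk n) :=
    (differentiableOn_pderiv isOpen_polydisk hv.1 k).sub (hbh.mul hv.1)
  have hcd : DifferentiableOn ℂ (fun ζ => L.P k k k (Pi.single k ζ) - L.P m m k (Pi.single k ζ))
      (ball 0 1) := fun ζ hζ =>
    ((hasDerivAt_axis hph k hζ).sub (hasDerivAt_axis hbh k hζ)).differentiableAt.differentiableWithinAt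
  have hbd : DifferentiableOn ℂ (fun ζ => L.P m m k (Pi.single k ζ)) (ball 0 1) := fun ζ hζ =>
    (hasDerivAt_axis hbh k hζ).differentiableAt.differentiableWithinAt
  have hr0 : ∀ ζ ∈ ball (0 : ℂ) 1, r (Pi.single k ζ) = 0 := by
    obtain ⟨C, hC0, hC⟩ := hcd.isExactOn_ball.with_val_at 0 0
    intro ζ hζ
    have h := eq_mul_exp_of_hasDerivAt (y := fun ζ => r (Pi.single k ζ)) (fun w hw => by
      have h1 := hasDerivAt_axis hrh k hw
      rwa [hR.pderiv_sub_mul hv (single_mem_polydisk hw) hkm] at h1) hC hC0 hζ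
    simp [hr, hv0, hv1] at h
    exact h
  have hv' : ∀ ζ ∈ ball (0 : ℂ) 1, HasDerivAt (fun ζ => v (Pi.single k ζ))
      (L.P m m k (Pi.single k ζ) * v (Pi.single k ζ)) ζ := fun ζ hζ => by
    have h1 := hasDerivAt_axis hv.1 k hζ
    rwa [sub_eq_zero.1 (hr0 ζ hζ)] at h1
  have hvne : ∀ ζ ∈ ball (0 : ℂ) 1, v (Pi.single k ζ) ≠ 0 := by
    obtain ⟨β, hβ0, hβ⟩ := hbd.isExactOn_ball.with_val_at 0 0
    intro ζ hζ
    have h := eq_mul_exp_of_hasDerivAt hv' hβ hβ0 hζ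
    simp only [Pi.single_zero, hv0, one_mul] at h
    rw [h]
    exact Complex.exp_ne_zero _
  have hrm : ∀ ζ ∈ ball (0 : ℂ) 1, pderiv m r (Pi.single k ζ) =
      -(-pderiv k (L.P m m m) (Pi.single k ζ) + 2 * pderiv m (L.P m m k) (Pi.single k ζ)) *
        v (Pi.single k ζ) := by
    intro ζ hζ
    have hz := single_mem_polydisk (k := k) hζ
    have hb := DifferentiableOn.at_polydisk hbh hz
    have h0 := sub_eq_zero.1 (hr0 ζ hζ)
    rw [hr, pderiv_sub (hv.differentiableAt_pderiv hz k) (hb.fun_mul (hv.differentiableAt hz)),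
      pderiv_mul hb (hv.differentiableAt hz), pderiv_comm isOpen_polydisk hv.1 hz,
      hR.pderiv_pderiv_of_ne hv hz hkm, hR.P₀_off_diag _ hz k m hkm, h0]
    ring
  have hG : HasDerivAt (fun ζ => pderiv m r (Pi.single k ζ))
      ((L.P k k k (Pi.single k ξ) - L.P m m k (Pi.single k ξ)) * pderiv m r (Pi.single k ξ)) ξ := by
    have hz := single_mem_polydisk (k := k) hξ
    have h1 := hasDerivAt_axis (differentiableOn_pderiv isOpen_polydisk hrh m) k hξ
    have h2 : EqOn (pderiv k r) (fun z => (L.P k k k z - L.P m m k z) * r z) (polydisk n) :=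
      fun z hz => hR.pderiv_sub_mul hv hz hkm
    have hd := (DifferentiableOn.at_polydisk hph hz).fun_sub (DifferentiableOn.at_polydisk hbh hz)
    rw [pderiv_comm isOpen_polydisk hrh hz, pderiv_congr isOpen_polydisk h2 hz,
      pderiv_mul hd (DifferentiableOn.at_polydisk hrh hz), hr0 ξ hξ, zero_mul, add_zero] at h1
    exact h1
  have hq := (hG.div (hv' ξ hξ) (hvne ξ hξ)).neg
  have heq : (fun ζ => -pderiv k (L.P m m m) (Pi.single k ζ) +
      2 * pderiv m (L.P m m k) (Pi.single k ζ)) =ᶠ[𝓝 ξ]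
      -((fun ζ => pderiv m r (Pi.single k ζ)) / fun ζ => v (Pi.single k ζ)) := by
    filter_upwards [isOpen_ball.mem_nhds hξ] with ζ hζ
    simp only [Pi.neg_apply, Pi.div_apply]
    rw [hrm ζ hζ]
    have := hvne ζ hζ
    field_simp
  refine (hq.congr_of_eventuallyEq heq).congr_deriv ?_
  rw [hrm ξ hξ]
  have := hvne ξ hξ
  field_simp
  ring

theorem Regular.axisData (hR : L.Regular ε) {u w e : (Fin n → ℂ) → ℂ} {k m : Fin n} (hkm : k ≠ m)
    (hu : L.IsSolution u) (hu0 : u 0 = 1) (hu1 : ∀ i, pderiv i u 0 = 0)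
    (hw : L.IsSolution w) (hw0 : w 0 = 0) (hw1 : ∀ i, pderiv i w 0 = (Pi.single k 1 : Fin n → ℂ) i)
    (he : L.IsSolution e) (he0 : e 0 = 0) (he1 : ∀ i, pderiv i e 0 = (Pi.single m 1 : Fin n → ℂ) i) :
    AxisData ε (fun ξ => L.P k k k (Pi.single k ξ)) (fun ξ => L.P m m k (Pi.single k ξ))
      (fun ξ => L.P k k m (Pi.single k ξ)) (fun ξ => L.P m m m (Pi.single k ξ))
      (fun ξ => pderiv k (L.P m m k) (Pi.single k ξ))
      (fun ξ => pderiv k (L.P k k m) (Pi.single k ξ))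
      (fun ξ => pderiv k (L.P m m m) (Pi.single k ξ))
      (fun ξ => -pderiv k (L.P m m m) (Pi.single k ξ) + 2 * pderiv m (L.P m m k) (Pi.single k ξ))
      (fun ξ => u (Pi.single k ξ)) (fun ξ => pderiv k u (Pi.single k ξ))
      (fun ξ => pderiv m u (Pi.single k ξ))
      (fun ξ => w (Pi.single k ξ)) (fun ξ => pderiv k w (Pi.single k ξ))
      (fun ξ => pderiv m w (Pi.single k ξ)) (fun ξ => pderiv m e (Pi.single k ξ)) := by
  have hself : ∀ v, L.IsSolution v → ∀ ξ ∈ ball (0 : ℂ) 1,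
      HasDerivAt (fun ξ => pderiv k v (Pi.single k ξ))
        (L.P k k k (Pi.single k ξ) * pderiv k v (Pi.single k ξ) +
          (pderiv k (L.P m m k) (Pi.single k ξ) + L.P m m k (Pi.single k ξ) ^ 2 -
            L.P k k k (Pi.single k ξ) * L.P m m k (Pi.single k ξ)) * v (Pi.single k ξ)) ξ := by
    intro v hv ξ hξ
    have hz := single_mem_polydisk (k := k) hξ
    have h1 := hasDerivAt_axis (differentiableOn_pderiv isOpen_polydisk hv.1 k) k hξ
    rwa [hR.pderiv_pderiv_self hv hz, hR.P₀_diag _ hz k m hkm] at h1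
  have hoff : ∀ v, L.IsSolution v → ∀ ξ ∈ ball (0 : ℂ) 1,
      HasDerivAt (fun ξ => pderiv m v (Pi.single k ξ))
        (L.P k k m (Pi.single k ξ) * pderiv k v (Pi.single k ξ) +
          L.P m m k (Pi.single k ξ) * pderiv m v (Pi.single k ξ) +
          (pderiv k (L.P m m m) (Pi.single k ξ) / 2 -
            (-pderiv k (L.P m m m) (Pi.single k ξ) + 2 * pderiv m (L.P m m k) (Pi.single k ξ)) / 2 -
            L.P m m k (Pi.single k ξ) * L.P k k m (Pi.single k ξ)) * v (Pi.single k ξ)) ξ := by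
    intro v hv ξ hξ
    have hz := single_mem_polydisk (k := k) hξ
    have h1 := hasDerivAt_axis (differentiableOn_pderiv isOpen_polydisk hv.1 m) k hξ
    rw [hR.pderiv_pderiv_of_ne hv hz hkm, hR.P₀_off_diag _ hz k m hkm] at h1
    refine h1.congr_deriv ?_
    ring
  have hb0 : ∀ m' l, ∀ ξ ∈ ball (0 : ℂ) 1, ∀ k', l ≠ k' → ‖L.P m' m' l (Pi.single k' ξ)‖ ≤ ε := by
    intro m' l ξ hξ k' hl
    have h := hR.bound _ (single_mem_polydisk (k := k') hξ) m' l
    simpa [hl] using h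
  have hbk : ∀ m', ∀ ξ ∈ ball (0 : ℂ) 1,
      ‖L.P m' m' k (Pi.single k ξ)‖ * (1 - ‖ξ‖ ^ 2) ≤ ε := by
    intro m' ξ hξ
    have h := hR.bound _ (single_mem_polydisk (k := k) hξ) m' k
    simpa using h
  exact
  { hp := fun ξ hξ =>
      (hasDerivAt_axis (hR.hol.1 k k k) k hξ).differentiableAt.differentiableWithinAt
    hb := fun ξ hξ => hasDerivAt_axis (hR.hol.1 m m k) k hξ
    hbt := fun ξ hξ => hasDerivAt_axis (hR.hol.1 k k m) k hξ
    hpt := fun ξ hξ => hasDerivAt_axis (hR.hol.1 m m m) k hξ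
    p_le := hbk k
    b_le := hbk m
    bt_le := fun ξ hξ => hb0 k m ξ hξ k hkm.symm
    pt_le := fun ξ hξ => hb0 m m ξ hξ k hkm.symm
    he := fun ξ hξ => hR.hasDerivAt_curvature hkm hξ
    -- Each coefficient is differentiated along an axis on which its own weight 1 - |z_l|² equals 1.
    -- It is therefore bounded by ε on the unit disk, and Cauchy's estimate gives ε + 2 ε.
    e_le := by
      have h1 : ‖pderiv k (L.P m m m) 0‖ ≤ ε := by
        have h := norm_deriv_zero_le one_pos (fun ξ hξ => (hasDerivAt_axis (hR.hol.1 m m m) k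
          hξ).differentiableAt.differentiableWithinAt) (fun ξ hξ => hb0 m m ξ hξ k hkm.symm)
        rw [(hasDerivAt_axis (hR.hol.1 m m m) k (mem_ball_self one_pos)).deriv] at h
        simpa using h
      have h2 : ‖pderiv m (L.P m m k) 0‖ ≤ ε := by
        have h := norm_deriv_zero_le one_pos (fun ξ hξ => (hasDerivAt_axis (hR.hol.1 m m k) m
          hξ).differentiableAt.differentiableWithinAt) (fun ξ hξ => hb0 m k ξ hξ m hkm)
        rw [(hasDerivAt_axis (hR.hol.1 m m k) m (mem_ball_self one_pos)).deriv] at h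
        simpa using h
      simp only [Pi.single_zero]
      refine (norm_add_le _ _).trans ?_
      rw [norm_neg, norm_mul, Complex.norm_ofNat]
      linarith
    hu := fun ξ hξ => hasDerivAt_axis hu.1 k hξ
    hu₁ := hself u hu
    hu₂ := hoff u hu
    hw := fun ξ hξ => hasDerivAt_axis hw.1 k hξ
    hw₁ := hself w hw
    hw₂ := hoff w hw
    -- The k-th axis lies in z_m = 0, where e and its tangential derivatives vanish; only the term
    -- P^m_{mk} ∂_m e survives.
    hE := fun ξ hξ => by
      have hz := single_mem_polydisk (k := k) hξ
      have h1 := hasDerivAt_axis (differentiableOn_pderiv isOpen_polydisk he.1 m) k hξ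
      have h2 := hR.eq_zero_on_hyperplane he (m := m) zero_mem_polydisk hz
        (by simp [hkm.symm]) he0 (fun i hi => by rw [he1]; simp [hi])
      rw [hR.pderiv_pderiv_of_ne he hz hkm, h2.1, h2.2 k hkm, mul_zero, mul_zero, zero_add,
        add_zero] at h1
      exact h1
    u_zero := by simpa using hu0
    u₁_zero := by simpa using hu1 k
    u₂_zero := by simpa using hu1 m
    w_zero := by simpa using hw0
    w₁_zero := by simpa using hw1 k
    E_zero := by simpa using he1 m }

end AxisRestriction

end LinearSystem

/-! ### Derivative of a determinant -/

section Determinant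

variable {ι : Type*} [Fintype ι] [DecidableEq ι]

/-- **Jacobi's formula** for matrices solving the linear equation `A' = A X`. -/
theorem hasDerivAt_det {A : ℂ → Matrix ι ι ℂ} {X : Matrix ι ι ℂ} {t : ℂ}
    (hA : ∀ i j, HasDerivAt (fun s => A s i j) ((A t * X) i j) t) :
    HasDerivAt (fun s => (A s).det) (X.trace * (A t).det) t := by
  have h1 : HasDerivAt (fun s => (A s).det)
      (∑ σ : Equiv.Perm ι, ((Equiv.Perm.sign σ : ℤ) : ℂ) *
        ∑ i, (∏ j ∈ Finset.univ.erase i, A t (σ j) j) * (A t * X) (σ i) i) t := by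
    simp only [Matrix.det_apply']
    refine HasDerivAt.fun_sum fun σ _ => HasDerivAt.const_mul _ ?_
    have := HasDerivAt.fun_finsetProd (u := Finset.univ) (fun i _ => hA (σ i) i)
    simpa [smul_eq_mul] using this
  refine h1.congr_deriv ?_
  have h2 : ∀ i, ((A t).updateCol i fun k => ∑ j, X j i • A t k j).det = X i i * (A t).det :=
    fun i => by rw [Matrix.det_updateCol_sum, smul_eq_mul]
  have h3 : X.trace * (A t).det =
      ∑ i, ((A t).updateCol i fun k => ∑ j, X j i • A t k j).det := by
    rw [Matrix.trace, Finset.sum_mul]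
    exact Finset.sum_congr rfl fun i _ => (h2 i).symm
  rw [h3]
  simp only [Matrix.det_apply', Finset.mul_sum]
  rw [Finset.sum_comm]
  refine Finset.sum_congr rfl fun i _ => Finset.sum_congr rfl fun σ _ => ?_
  have h4 : ∏ j ∈ Finset.univ.erase i, ((A t).updateCol i fun k => ∑ j, X j i • A t k j) (σ j) j =
      ∏ j ∈ Finset.univ.erase i, A t (σ j) j :=
    Finset.prod_congr rfl fun j hj => Matrix.updateCol_ne (Finset.ne_of_mem_erase hj)
  rw [← Finset.mul_prod_erase _ _ (Finset.mem_univ i), h4, Matrix.updateCol_self, Matrix.mul_apply]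
  simp only [smul_eq_mul, mul_comm (X _ _)]
  ring

end Determinant

namespace LinearSystem

/-! ### The Wronskian and its triangular reduction -/

section Wronskian

variable {n : ℕ} {L : LinearSystem n} {ε : ℝ}

/-- The Wronskian matrix of a solution `u` and `n` solutions `e k`. -/
def wronskian (u : (Fin n → ℂ) → ℂ) (e : Fin n → (Fin n → ℂ) → ℂ) (z : Fin n → ℂ) :
    Matrix (Unit ⊕ Fin n) (Unit ⊕ Fin n) ℂ :=
  Matrix.fromBlocks (Matrix.of fun _ _ => u z) (Matrix.of fun _ j => pderiv j u z)
    (Matrix.of fun k _ => e k z) (Matrix.of fun k j => pderiv j (e k) z)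

/-- The Wronskian of a system in canonical form is constant. -/
theorem det_wronskian (hcan : L.IsCanonical)
    {u : (Fin n → ℂ) → ℂ} {e : Fin n → (Fin n → ℂ) → ℂ} (hu : L.IsSolution u)
    (he : ∀ k, L.IsSolution (e k)) {z : Fin n → ℂ} (hz : z ∈ polydisk n) :
    (wronskian u e z).det = (wronskian u e 0).det := by
  rw [mem_polydisk_iff_norm] at hz
  -- Rescaling puts z at an interior parameter t < 1 of a line ξ ↦ ξ y that stays in the polydisk
  -- for all |ξ| < 1.
  set t : ℝ := (1 + ‖z‖) / 2 with ht
  have ht0 : 0 < t := by have := norm_nonneg z; positivity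
  have ht1 : t < 1 := by rw [ht]; linarith
  set y : Fin n → ℂ := (t : ℂ)⁻¹ • z with hy
  have hty : (t : ℂ) • y = z := by
    rw [hy, smul_smul, mul_inv_cancel₀ (by exact_mod_cast ht0.ne'), one_smul]
  have hyn : ‖y‖ ≤ 1 := by
    rw [hy, norm_smul, norm_inv, Complex.norm_real, Real.norm_of_nonneg ht0.le,
      inv_mul_le_iff₀ ht0, mul_one, ht]
    linarith
  have hmem : ∀ ξ ∈ ball (0 : ℂ) 1, ξ • y ∈ polydisk n := fun ξ hξ => by
    rw [mem_ball_zero_iff] at hξ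
    rw [mem_polydisk_iff_norm, norm_smul]
    nlinarith [norm_nonneg y, norm_nonneg ξ]
  have hline : ∀ f : (Fin n → ℂ) → ℂ, DifferentiableOn ℂ f (polydisk n) → ∀ ξ ∈ ball (0 : ℂ) 1,
      HasDerivAt (fun ζ => f (ζ • y)) (∑ i, y i * pderiv i f (ξ • y)) ξ := fun f hf ξ hξ => by
    have h := hasDerivAt_comp_line (f := f) (x := 0) (v := y) (ξ := ξ)
      (by rw [zero_add]; exact DifferentiableOn.at_polydisk hf (hmem ξ hξ))
    simpa only [zero_add, fderiv_apply_eq_sum] using h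
  have hder : ∀ ξ ∈ ball (0 : ℂ) 1, HasDerivAt (fun ζ => (wronskian u e (ζ • y)).det) 0 ξ := by
    intro ξ hξ
    set x := ξ • y with hx
    -- The connection matrix along the line: the Wronskian matrix W satisfies W' = W B. Canonical
    -- form says exactly that B has trace 0.
    set B : Matrix (Unit ⊕ Fin n) (Unit ⊕ Fin n) ℂ := Matrix.fromBlocks 0
      (Matrix.of fun _ j => ∑ i, y i * L.P₀ i j x) (Matrix.of fun l _ => y l)
      (Matrix.of fun l j => ∑ i, y i * L.P l i j x) with hB
    have htr : B.trace = 0 := by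
      simp only [hB, Matrix.trace, Matrix.diag_apply, Fintype.sum_sum_type,
        Matrix.fromBlocks_apply₁₁, Matrix.fromBlocks_apply₂₂, Matrix.zero_apply, Matrix.of_apply,
        Finset.sum_const_zero, zero_add]
      rw [Finset.sum_comm]
      simp_rw [← Finset.mul_sum, hcan x (hmem ξ hξ), mul_zero, Finset.sum_const_zero]
    have hrow : ∀ w, L.IsSolution w → ∀ j, HasDerivAt (fun ζ => pderiv j w (ζ • y))
        (w x * ∑ i, y i * L.P₀ i j x + ∑ l, pderiv l w x * ∑ i, y i * L.P l i j x) ξ := by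
      intro w hw j
      refine (hline _ (differentiableOn_pderiv isOpen_polydisk hw.1 j) ξ hξ).congr_deriv ?_
      simp_rw [hw.2 _ (hmem ξ hξ), mul_add, Finset.sum_add_distrib, Finset.mul_sum]
      rw [add_comm, Finset.sum_comm]
      congr 1
      · exact Finset.sum_congr rfl fun i _ => by ring
      · exact Finset.sum_congr rfl fun l _ => Finset.sum_congr rfl fun i _ => by ring
    have h := hasDerivAt_det (A := fun ζ => wronskian u e (ζ • y)) (X := B) (t := ξ) ?_
    · simpa [htr] using h
    · rintro (a | a) (b | b)
      · simpa [wronskian, hB, Matrix.mul_apply, mul_comm] using hline u hu.1 ξ hξ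
      · simpa [wronskian, hB, Matrix.mul_apply] using hrow u hu b
      · simpa [wronskian, hB, Matrix.mul_apply, mul_comm] using hline (e a) (he a).1 ξ hξ
      · simpa [wronskian, hB, Matrix.mul_apply] using hrow (e a) (he a) b
  have h := eq_of_hasDerivAt_zero hder (ξ := (t : ℂ)) (by
    rwa [mem_ball_zero_iff, Complex.norm_real, Real.norm_of_nonneg ht0.le])
  simpa only [hty, zero_smul] using h

/-- Row operations that turn the Wronskian into a block triangular matrix. -/
theorem det_mul_det_wronskian {u : (Fin n → ℂ) → ℂ} {e : Fin n → (Fin n → ℂ) → ℂ}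
    {z : Fin n → ℂ} {N : Matrix (Fin n) (Fin n) ℂ} {a d : Fin n → ℂ}
    (h0 : ∀ k, ∑ m, N k m * e m z = a k * u z)
    (h1 : ∀ k j, ∑ m, N k m * pderiv j (e m) z = a k * pderiv j u z + if k = j then d k else 0) :
    N.det * (wronskian u e z).det = u z * ∏ k, d k := by
  have h2 : Matrix.fromBlocks (1 : Matrix Unit Unit ℂ) 0 (Matrix.of fun k _ => -a k) N *
      wronskian u e z = Matrix.fromBlocks (Matrix.of fun _ _ => u z)
        (Matrix.of fun _ j => pderiv j u z) 0 (Matrix.diagonal d) := by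
    rw [wronskian, Matrix.fromBlocks_multiply]
    congr 1
    · simp
    · simp
    · ext k i
      simp [Matrix.mul_apply, h0]
    · ext k j
      simp [Matrix.mul_apply, h1, Matrix.diagonal_apply]
  have h3 := congrArg Matrix.det h2
  rw [Matrix.det_mul, Matrix.det_fromBlocks_zero₁₂, Matrix.det_one, one_mul,
    Matrix.det_fromBlocks_zero₂₁, Matrix.det_diagonal] at h3
  simpa using h3

end Wronskian

end LinearSystem

/-- Coordinate-wise description of solutions `u`, `e k` of the system: the vector `e` is determined
by `u` through the matrix `1 + M`, whose `k`-th row depends on `z k` only. -/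
structure AxisFactorization {n : ℕ} (ε r F : ℝ) (Φ φ : ℝ → ℝ) (u : (Fin n → ℂ) → ℂ)
    (e : Fin n → (Fin n → ℂ) → ℂ) (A l : Fin n → ℂ → ℂ) (R M : Fin n → Fin n → ℂ → ℂ) : Prop where
  A_le : ∀ k, ∀ ξ ∈ ball (0 : ℂ) r, ‖A k ξ‖ ≤ F / (1 - ε * F)
  l_zero : ∀ k, l k 0 = 0
  l_diff : ∀ k, DifferentiableOn ℂ (l k) (ball 0 r)
  l_le : ∀ k, ∀ ξ ∈ ball (0 : ℂ) r, ‖l k ξ‖ ≤ 3 * ε * Real.artanh ‖ξ‖ - 2 * Real.log (1 - ε * F)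
  R_self : ∀ k ξ, R k k ξ = 0
  M_self : ∀ k ξ, M k k ξ = 0
  R_diff : ∀ k m, DifferentiableOn ℂ (R k m) (ball 0 r)
  R_le : ∀ k m, ∀ ξ ∈ ball (0 : ℂ) r, ‖R k m ξ‖ ≤ rowBound ε F
  M_zero : ∀ k m, M k m 0 = 0
  M_deriv : ∀ k m, ∀ ξ ∈ ball (0 : ℂ) r,
    HasDerivAt (M k m) (R k m ξ * Complex.exp (l k ξ)) ξ
  M_deriv_le : ∀ k m, ∀ ξ ∈ ball (0 : ℂ) r, ‖R k m ξ * Complex.exp (l k ξ)‖ ≤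
    ε / (1 - ε * F) ^ 2 * ((2 + 3 / 2 * Φ ‖ξ‖ + ε * (4 * Φ ‖ξ‖ + 3 / 4 * Φ ‖ξ‖ ^ 2)) * φ ‖ξ‖)
  sum_mul : ∀ z : Fin n → ℂ, ‖z‖ < r → ∀ k,
    e k z + ∑ m, M k m (z k) * e m z = A k (z k) * u z
  det_eq : ∀ z : Fin n → ℂ, ‖z‖ < r → (1 + Matrix.of fun k m => M k m (z k)).det =
    u z * ∏ k, (Complex.exp (l k (z k)) * (u z - ∑ m, R k m (z k) * e m z))

theorem GrowthMajorant.bound_nonneg {ε r F : ℝ} {Φ φ : ℝ → ℝ} (hΦ : GrowthMajorant ε r F Φ φ)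
    (hr0 : 0 < r) : 0 ≤ F :=
  (hΦ.nonneg 0 ⟨le_rfl, hr0⟩).trans (hΦ.le 0 ⟨le_rfl, hr0⟩)

/-! ### Factorization of u^(n+1) through functions on the axes -/

namespace LinearSystem

variable {n : ℕ} {L : LinearSystem n} {ε r F : ℝ} {Φ φ : ℝ → ℝ}

/-- A and M are found on the k-th axis. There e_m (m ≠ k) vanishes and ∂_m is its only derivative
that can be nonzero, so A cancels the value of the combination and M_km cancels its ∂_m-derivative.
Uniqueness on the hyperplane spreads this from the axis point to all points with the same k-th
coordinate, which gives the row operations on the Wronskian. -/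
theorem Regular.exists_axisFactorization [Nontrivial (Fin n)] (hR : L.Regular ε) (hr : r ≤ 1)
    (hr0 : 0 < r) (hε : 0 ≤ ε) (hΦ : GrowthMajorant ε r F Φ φ) (hεF : ε * F < 1)
    {u : (Fin n → ℂ) → ℂ} (hu : L.IsSolution u) (hu0 : u 0 = 1) (hu1 : ∀ i, pderiv i u 0 = 0) :
    ∃ (e : Fin n → (Fin n → ℂ) → ℂ) (A l : Fin n → ℂ → ℂ) (R M : Fin n → Fin n → ℂ → ℂ),
      (∀ k, L.IsSolution (e k)) ∧ (∀ k, e k 0 = 0) ∧ AxisFactorization ε r F Φ φ u e A l R M := by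
  have hsub : ball (0 : ℂ) r ⊆ ball 0 1 := ball_subset_ball hr
  have hF0 := hΦ.bound_nonneg hr0
  choose e he he0 he1 using fun k : Fin n =>
    hR.exists_solution 0 zero_mem_polydisk 0 (Pi.single k 1)
  have hest := fun (k m : Fin n) (hkm : k ≠ m) =>
    (hR.axisData hkm hu hu0 hu1 (he k) (he0 k) (he1 k) (he m) (he0 m) (he1 m)).estimates hr hr0
      hε hΦ hεF
  set A : Fin n → ℂ → ℂ := fun k ξ => e k (Pi.single k ξ) / u (Pi.single k ξ) with hA
  set R : Fin n → Fin n → ℂ → ℂ := fun k m ξ => if k = m then 0 else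
    (pderiv m u (Pi.single k ξ) - L.P k k m (Pi.single k ξ) * u (Pi.single k ξ)) /
      pderiv m (e m) (Pi.single k ξ) with hRdef
  set M : Fin n → Fin n → ℂ → ℂ := fun k m ξ => if k = m then 0 else
    (A k ξ * pderiv m u (Pi.single k ξ) - pderiv m (e k) (Pi.single k ξ)) /
      pderiv m (e m) (Pi.single k ξ) with hM
  -- `A k` involves no second index, so any auxiliary m ≠ k supplies its estimates; this is where
  -- `Nontrivial` enters.
  have hl : ∀ k, ∃ l : ℂ → ℂ, l 0 = 0 ∧ DifferentiableOn ℂ l (ball 0 r) ∧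
      (∀ ξ ∈ ball (0 : ℂ) r, deriv (A k) ξ = Complex.exp (l ξ)) ∧
      ∀ ξ ∈ ball (0 : ℂ) r, ‖l ξ‖ ≤ 3 * ε * Real.artanh ‖ξ‖ - 2 * Real.log (1 - ε * F) := by
    intro k
    obtain ⟨m, hm⟩ := exists_ne k
    exact (hest k m hm.symm).2.2.2.2.2.2.2
  choose l hl0 hld hlA hln using hl
  have hu_ne : ∀ k, ∀ ξ ∈ ball (0 : ℂ) r, u (Pi.single k ξ) ≠ 0 := by
    intro k
    obtain ⟨m, hm⟩ := exists_ne k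
    exact (hest k m hm.symm).1
  have hAd : ∀ k, ∀ ξ ∈ ball (0 : ℂ) r, HasDerivAt (A k) (Complex.exp (l k ξ)) ξ := by
    intro k ξ hξ
    obtain ⟨m, hm⟩ := exists_ne k
    rw [← hlA k ξ hξ]
    exact ((hest k m hm.symm).2.2.2.2.2.2.1 ξ hξ).hasDerivAt
  have hMd : ∀ k m, ∀ ξ ∈ ball (0 : ℂ) r,
      HasDerivAt (M k m) (R k m ξ * Complex.exp (l k ξ)) ξ := by
    intro k m ξ hξ
    rw [← hlA k ξ hξ]
    by_cases hkm : k = m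
    · simp only [hM, hRdef, hkm, if_true, zero_mul]
      exact hasDerivAt_const ξ 0
    · have h := (hest k m hkm).2.2.2.2.1 ξ hξ
      simpa only [hM, hRdef, hkm, if_false] using h
  have hΦ0 : ∀ t ∈ Ico 0 r, 0 ≤ φ t := fun t ht => (Real.exp_pos _).le.trans (hΦ.exp_le t ht)
  have hIco : ∀ ξ ∈ ball (0 : ℂ) r, ‖ξ‖ ∈ Ico 0 r := fun ξ hξ =>
    ⟨norm_nonneg _, by simpa using hξ⟩
  have hjet : ∀ k, ∀ ξ ∈ ball (0 : ℂ) r, ∀ m, m ≠ k →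
      e m (Pi.single k ξ) = 0 ∧ ∀ j, j ≠ m → pderiv j (e m) (Pi.single k ξ) = 0 := by
    intro k ξ hξ m hm
    exact hR.eq_zero_on_hyperplane (he m) (m := m) zero_mem_polydisk
      (single_mem_polydisk (hsub hξ)) (by simp [hm]) (he0 m) (fun i hi => by rw [he1]; simp [hi])
  have hzk : ∀ z : Fin n → ℂ, ‖z‖ < r → ∀ k, z k ∈ ball (0 : ℂ) r := fun z hz k => by
    rw [mem_ball_zero_iff]; exact (norm_le_pi_norm z k).trans_lt hz
  -- the combination of solutions vanishing on the hyperplane `y k = ξ`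
  have hcomb : ∀ k, ∀ ξ ∈ ball (0 : ℂ) r, ∀ y ∈ polydisk n, y k = ξ →
      e k y + ∑ m, M k m ξ * e m y = A k ξ * u y ∧
      ∀ j, j ≠ k → pderiv j (e k) y + ∑ m, M k m ξ * pderiv j (e m) y = A k ξ * pderiv j u y := by
    intro k ξ hξ y hy hyk
    set w : Option (Option (Fin n)) → (Fin n → ℂ) → ℂ := fun a =>
      a.elim u fun b => b.elim (e k) e with hw
    set c : Option (Option (Fin n)) → ℂ := fun a =>
      a.elim (-A k ξ) fun b => b.elim 1 fun m => M k m ξ with hc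
    have hws : ∀ a, L.IsSolution (w a) := by rintro (_ | _ | m) <;> simp [hw, hu, he]
    have hxk := single_mem_polydisk (k := k) (hsub hξ)
    have hpd : ∀ x ∈ polydisk n, ∀ j, pderiv j (fun z => ∑ a, c a * w a z) x =
        -A k ξ * pderiv j u x + (pderiv j (e k) x + ∑ m, M k m ξ * pderiv j (e m) x) := by
      intro x hx j
      rw [pderiv_linearCombination fun a => (hws a).differentiableAt hx]
      simp [hw, hc, Fintype.sum_option]
    have h := hR.eq_zero_on_hyperplane (IsSolution.linearCombination hws c) (m := k) hxk hy
      (by simp [hyk]) ?_ ?_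
    · constructor
      · have h1 := h.1
        simp only [hw, hc, Fintype.sum_option, Option.elim] at h1
        linear_combination h1
      · intro j hj
        have h1 := h.2 j hj
        rw [hpd y hy] at h1
        linear_combination h1
    · have h2 : ∑ m, M k m ξ * e m (Pi.single k ξ) = 0 := Finset.sum_eq_zero fun m _ => by
        by_cases hm : m = k
        · simp [hM, hm]
        · rw [(hjet k ξ hξ m hm).1, mul_zero]
      simp only [hw, hc, Fintype.sum_option, Option.elim, h2, hA]
      have := hu_ne k ξ hξ
      field_simp
      ring
    · intro i hi
      have hE := (hest k i hi.symm).2.1 ξ hξ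
      rw [hpd _ hxk, Finset.sum_eq_single i]
      · simp only [hM, hi.symm, if_false]
        field_simp
        ring
      · intro m _ hm
        by_cases hmk : m = k
        · simp [hM, hmk]
        · rw [(hjet k ξ hξ m hmk).2 i hm.symm, mul_zero]
      · simp
  have hnorm : ∀ z : Fin n → ℂ, ‖z‖ < r → z ∈ polydisk n := fun z hz =>
    mem_polydisk_iff_norm.2 (hz.trans_le hr)
  -- The diagonal entry comes from differentiating in z_k the identity e_k + ∑ M_km(z_k) e_m =
  -- A_k(z_k) u, whose coefficients now vary with z_k.
  have hdiag : ∀ z : Fin n → ℂ, ‖z‖ < r → ∀ k,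
      pderiv k (e k) z + ∑ m, M k m (z k) * pderiv k (e m) z = A k (z k) * pderiv k u z +
        Complex.exp (l k (z k)) * (u z - ∑ m, R k m (z k) * e m z) := by
    intro z hz k
    have hd : ∀ v, L.IsSolution v →
        HasDerivAt (fun ζ : ℂ => v (z + ζ • Pi.single k 1)) (pderiv k v z) 0 := fun v hv => by
      have h := hasDerivAt_comp_line (f := v) (x := z) (v := Pi.single k 1) (ξ := 0)
        (by simpa using hv.differentiableAt (hnorm z hz))
      simpa [pderiv] using h
    have hs : ∀ (g : ℂ → ℂ) (g' : ℂ), HasDerivAt g g' (z k) →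
        HasDerivAt (fun ζ : ℂ => g (z k + ζ)) g' 0 := fun g g' hg => by
      simpa using HasDerivAt.comp_const_add (z k) 0 (by simpa using hg)
    have hk := hzk z hz k
    have h1 := ((hd _ (he k)).add (HasDerivAt.fun_sum (u := Finset.univ) fun m _ =>
      (hs _ _ (hMd k m _ hk)).mul (hd _ (he m)))).sub ((hs _ _ (hAd k _ hk)).mul (hd _ hu))
    have hev : ∀ᶠ ζ : ℂ in 𝓝 0, z + ζ • Pi.single k 1 ∈ ball (0 : Fin n → ℂ) r := by
      refine ContinuousAt.eventually_mem (by fun_prop) (isOpen_ball.mem_nhds ?_)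
      simpa using hz
    have h2 : HasDerivAt (fun _ : ℂ => (0 : ℂ)) _ 0 := h1.congr_of_eventuallyEq (by
      filter_upwards [hev] with ζ hζ
      rw [mem_ball_zero_iff] at hζ
      have hc := (hcomb k (z k + ζ) (by simpa using hzk _ hζ k) _ (hnorm _ hζ) (by simp)).1
      simp only [Pi.add_apply, Pi.sub_apply, Pi.mul_apply]
      rw [hc, sub_self])
    have h3 := h2.unique (hasDerivAt_const (0 : ℂ) (0 : ℂ))
    simp only [add_zero, zero_smul, Finset.sum_add_distrib] at h3
    have h4 : ∑ m, R k m (z k) * Complex.exp (l k (z k)) * e m z =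
        Complex.exp (l k (z k)) * ∑ m, R k m (z k) * e m z := by
      rw [Finset.mul_sum]
      exact Finset.sum_congr rfl fun m _ => by ring
    rw [h4] at h3
    linear_combination h3
  refine ⟨e, A, l, R, M, he, he0, ?_⟩
  exact
  { A_le := fun k ξ hξ => by
      obtain ⟨m, hm⟩ := exists_ne k
      exact (hest k m hm.symm).2.2.1 ξ hξ
    l_zero := hl0
    l_diff := hld
    l_le := hln
    R_self := fun k ξ => by simp [hRdef]
    M_self := fun k ξ => by simp [hM]
    R_diff := fun k m => by
      by_cases hkm : k = m
      · simp only [hRdef, hkm, if_true]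
        exact differentiableOn_const 0
      · simp only [hRdef, hkm, if_false]
        have hax : ∀ f : (Fin n → ℂ) → ℂ, DifferentiableOn ℂ f (polydisk n) →
            DifferentiableOn ℂ (fun ξ => f (Pi.single k ξ)) (ball 0 r) := fun f hf ξ hξ =>
          (hasDerivAt_axis hf k (hsub hξ)).differentiableAt.differentiableWithinAt
        exact ((hax _ (differentiableOn_pderiv isOpen_polydisk hu.1 m)).sub
          ((hax _ (hR.hol.1 k k m)).mul (hax _ hu.1))).div
          (hax _ (differentiableOn_pderiv isOpen_polydisk (he m).1 m)) (hest k m hkm).2.1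
    R_le := fun k m ξ hξ => by
      by_cases hkm : k = m
      · simp only [hRdef, hkm, if_true, norm_zero, rowBound]
        positivity
      · simp only [hRdef, hkm, if_false]
        exact (hest k m hkm).2.2.2.1 ξ hξ
    M_zero := fun k m => by
      by_cases hkm : k = m
      · simp [hM, hkm]
      · simp [hM, hkm, hA, he0, he1, hu1, Ne.symm hkm]
    M_deriv := hMd
    M_deriv_le := fun k m ξ hξ => by
      by_cases hkm : k = m
      · simp only [hRdef, hkm, if_true, zero_mul, norm_zero]
        have h1 := hΦ.nonneg _ (hIco ξ hξ)
        have h2 := hΦ0 _ (hIco ξ hξ)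
        positivity
      · rw [← hlA k ξ hξ]
        simp only [hRdef, hkm, if_false]
        exact (hest k m hkm).2.2.2.2.2.1 ξ hξ
    sum_mul := fun z hz k => (hcomb k (z k) (hzk z hz k) z (hnorm z hz) rfl).1
    det_eq := fun z hz => by
      have hN : ∀ (k : Fin n) (x : Fin n → ℂ),
          ∑ m, (1 + Matrix.of fun k m => M k m (z k)) k m * x m =
            x k + ∑ m, M k m (z k) * x m := fun k x => by
        simp only [Matrix.add_apply, Matrix.of_apply, add_mul, Finset.sum_add_distrib]
        simp [Matrix.one_apply]
      have h := det_mul_det_wronskian (u := u) (e := e) (z := z)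
        (N := 1 + Matrix.of fun k m => M k m (z k)) (a := fun k => A k (z k))
        (d := fun k => Complex.exp (l k (z k)) * (u z - ∑ m, R k m (z k) * e m z))
        (fun k => by
          rw [hN]
          exact (hcomb k (z k) (hzk z hz k) z (hnorm z hz) rfl).1)
        (fun k j => by
          rw [hN k fun m => pderiv j (e m) z]
          by_cases hkj : k = j
          · subst hkj
            simpa using hdiag z hz k
          · simpa [hkj] using
              (hcomb k (z k) (hzk z hz k) z (hnorm z hz) rfl).2 j (Ne.symm hkj))
      have hw0 : (wronskian u e 0).det = 1 := by
        have : wronskian u e 0 = 1 := by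
          rw [wronskian, ← Matrix.fromBlocks_one]
          congr 1
          · ext a b; simp [hu0]
          · ext a b; simp [hu1]
          · ext a b; simp [he0]
          · ext a b; simp [he1, Matrix.one_apply, Pi.single_apply, eq_comm]
        rw [this, Matrix.det_one]
      have hcan : L.IsCanonical := fun z hz i => hR.canonical z hz i
      rwa [det_wronskian hcan hu he (hnorm z hz), hw0, mul_one] at h }

end LinearSystem

/-! ### Traces for matrices with zero diagonal -/

section TraceBound

variable {ι : Type*} [Fintype ι] [DecidableEq ι]

theorem sum_norm_mul_le_of_diag_eq_zero {N : ι → ℂ} {k : ι} {a : ℝ} (hN0 : N k = 0)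
    (hN : ∀ m, ‖N m‖ ≤ a) (v : ι → ℂ) {b : ℝ} (hv : ∀ m, ‖v m‖ ≤ b) (ha : 0 ≤ a) :
    ‖∑ m, N m * v m‖ ≤ (Fintype.card ι - 1) * a * b := by
  rw [← Finset.add_sum_erase _ _ (Finset.mem_univ k), hN0, zero_mul, zero_add]
  refine (norm_sum_le_of_le (f := fun m => N m * v m) _ (n := fun _ => a * b) fun m _ => ?_).trans
    (le_of_eq ?_)
  · rw [norm_mul]
    exact mul_le_mul (hN m) (hv m) (norm_nonneg _) ha
  · rw [Finset.sum_const, Finset.card_erase_of_mem (Finset.mem_univ k), Finset.card_univ,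
      nsmul_eq_mul, Nat.cast_sub (Fintype.card_pos_iff.2 ⟨k⟩)]
    push_cast
    ring

/-- Since N' has zero diagonal, X_ii = -∑_m N_im X_mi, which makes the trace second order in the
entries. The column sums of |X| are bounded by absorbing the (n - 1) a part of the equation, n being
the size of the matrix. -/
theorem norm_trace_le {N N' X : Matrix ι ι ℂ} {a b : ℝ} (hN0 : ∀ i, N i i = 0)
    (hN0' : ∀ i, N' i i = 0) (hN : ∀ i j, ‖N i j‖ ≤ a) (hN' : ∀ i j, ‖N' i j‖ ≤ b)
    (ha0 : 0 ≤ a) (ha : (Fintype.card ι - 1) * a < 1) (hX : (1 + N) * X = N') :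
    ‖X.trace‖ ≤ Fintype.card ι * (((Fintype.card ι - 1) * a) / (1 - (Fintype.card ι - 1) * a) * b) := by
  set c : ℝ := (Fintype.card ι : ℝ) with hc
  have hXe : ∀ i j, X i j = N' i j - ∑ m, N i m * X m j := fun i j => by
    have h := congrFun (congrFun hX i) j
    rw [add_mul, one_mul, Matrix.add_apply, Matrix.mul_apply] at h
    linear_combination h
  have hoff : ∀ i j, ‖∑ m, N i m * X m j‖ ≤ a * ∑ m ∈ Finset.univ.erase i, ‖X m j‖ := fun i j => by
    rw [← Finset.add_sum_erase _ _ (Finset.mem_univ i), hN0, zero_mul, zero_add, Finset.mul_sum]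
    exact norm_sum_le_of_le _ fun m _ => by
      rw [norm_mul]; exact mul_le_mul_of_nonneg_right (hN i m) (norm_nonneg _)
  have hcard : ∀ j : ι, ((Finset.univ.erase j).card : ℝ) = c - 1 := fun j => by
    rw [Finset.card_erase_of_mem (Finset.mem_univ j), Finset.card_univ,
      Nat.cast_sub (Fintype.card_pos_iff.2 ⟨j⟩), hc, Nat.cast_one]
  have hcol : ∀ j, ∑ i, ‖X i j‖ ≤ (c - 1) * b / (1 - (c - 1) * a) := fun j => by
    rw [le_div_iff₀ (by linarith)]
    have h1 : ∑ i, ‖X i j‖ ≤ ∑ i, (‖N' i j‖ + a * ∑ m ∈ Finset.univ.erase i, ‖X m j‖) :=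
      Finset.sum_le_sum fun i _ => by
        rw [hXe i j]
        have h2 := norm_sub_le (N' i j) (∑ m, N i m * X m j)
        have h3 := hoff i j
        simp only [← hXe]
        rw [← hXe i j] at h2
        linarith
    have h2 : ∑ i, ‖N' i j‖ ≤ (c - 1) * b := by
      rw [← Finset.add_sum_erase _ _ (Finset.mem_univ j), hN0', norm_zero, zero_add, ← hcard j,
        ← nsmul_eq_mul]
      exact Finset.sum_le_card_nsmul _ _ _ fun i _ => hN' i j
    have h3 : ∑ i, ∑ m ∈ Finset.univ.erase i, ‖X m j‖ = (c - 1) * ∑ m, ‖X m j‖ := by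
      have h4 : ∀ i, ∑ m ∈ Finset.univ.erase i, ‖X m j‖ = ∑ m, ‖X m j‖ - ‖X i j‖ := fun i => by
        rw [← Finset.add_sum_erase _ _ (Finset.mem_univ i)]; ring
      simp_rw [h4, Finset.sum_sub_distrib, Finset.sum_const, Finset.card_univ, nsmul_eq_mul]
      ring
    rw [Finset.sum_add_distrib, ← Finset.mul_sum, h3] at h1
    nlinarith
  rw [Matrix.trace]
  refine (norm_sum_le_of_le (n := fun _ => a * ((c - 1) * b / (1 - (c - 1) * a))) _
    fun i _ => ?_).trans (le_of_eq ?_)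
  · rw [Matrix.diag_apply, hXe, hN0', zero_sub, norm_neg]
    refine (hoff i i).trans (mul_le_mul_of_nonneg_left ((Finset.sum_le_sum_of_subset_of_nonneg
      (Finset.erase_subset _ _) fun _ _ _ => norm_nonneg _).trans (hcol i)) ha0)
  · rw [Finset.sum_const, Finset.card_univ, nsmul_eq_mul]
    ring

end TraceBound

/-! ### Nonvanishing of u and bounds for e / u -/

section Logarithm

variable {n : ℕ} {ε r F : ℝ} {Φ φ : ℝ → ℝ} {u : (Fin n → ℂ) → ℂ} {e : Fin n → (Fin n → ℂ) → ℂ}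
  {A l : Fin n → ℂ → ℂ} {R M : Fin n → Fin n → ℂ → ℂ}

theorem entryBound_mono {x y : ℝ} (hε : 0 ≤ ε) (hx : 0 ≤ x) (hxy : x ≤ y) :
    entryBound ε F x ≤ entryBound ε F y := by
  rw [entryBound, entryBound]
  gcongr

theorem hasDerivAt_entryBound {t c : ℝ} (hΦ : HasDerivAt Φ c t) :
    HasDerivAt (fun t => entryBound ε F (Φ t)) (ε / (1 - ε * F) ^ 2 *
      ((2 + 3 / 2 * Φ t + ε * (4 * Φ t + 3 / 4 * Φ t ^ 2)) * c)) t := by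
  unfold entryBound
  refine ((((hΦ.const_mul 2).add ((hΦ.pow 2).const_mul (3 / 4))).add
    ((((hΦ.pow 2).const_mul 2).add ((hΦ.pow 3).const_mul (1 / 4))).const_mul ε)).const_mul
      (ε / (1 - ε * F) ^ 2)).congr_deriv ?_
  push_cast
  ring

theorem AxisFactorization.M_le (H : AxisFactorization ε r F Φ φ u e A l R M)
    (hε : 0 ≤ ε) (hΦ : GrowthMajorant ε r F Φ φ) (k m : Fin n) {ξ : ℂ} (hξ : ξ ∈ ball (0 : ℂ) r) :
    ‖M k m ξ‖ ≤ entryBound ε F F := by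
  have h := norm_le_of_norm_deriv_le (h := fun t => entryBound ε F (Φ t)) (H.M_deriv k m)
    (fun t ht => hasDerivAt_entryBound (hΦ.hasDerivAt t ht)) (H.M_deriv_le k m) hξ
  have hI : ‖ξ‖ ∈ Ico 0 r := ⟨norm_nonneg _, by simpa using hξ⟩
  have h2 := entryBound_mono (F := F) hε (hΦ.nonneg _ hI) (hΦ.le _ hI)
  rw [H.M_zero, norm_zero, hΦ.zero] at h
  have h3 : entryBound ε F 0 = 0 := by simp [entryBound]
  linarith

/-- 1 + M is strictly diagonally dominant, and u is a factor of its determinant, so u ≠ 0. The bound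
on e / u comes from (1 + M) e = A u by absorbing M e in the maximum norm. -/
theorem AxisFactorization.ne_zero_and_norm_le (H : AxisFactorization ε r F Φ φ u e A l R M)
    (hε : 0 ≤ ε) (hΦ : GrowthMajorant ε r F Φ φ) (hεF : ε * F < 1) (hr0 : 0 < r)
    (hμ : (n - 1) * entryBound ε F F < 1) {z : Fin n → ℂ} (hz : ‖z‖ < r) :
    (1 + Matrix.of fun k m => M k m (z k)).det ≠ 0 ∧ u z ≠ 0 ∧
      ∀ m, ‖e m z / u z‖ ≤ F / (1 - ε * F) / (1 - (n - 1) * entryBound ε F F) := by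
  have hzk : ∀ k, z k ∈ ball (0 : ℂ) r := fun k => by
    rw [mem_ball_zero_iff]; exact (norm_le_pi_norm z k).trans_lt hz
  have hF := hΦ.bound_nonneg hr0
  have hm0 : 0 ≤ entryBound ε F F := by rw [entryBound]; positivity
  have hdet : (1 + Matrix.of fun k m => M k m (z k)).det ≠ 0 := by
    refine det_ne_zero_of_sum_row_lt_diag fun k => ?_
    rw [Matrix.add_apply, Matrix.one_apply_eq, Matrix.of_apply, H.M_self, add_zero, norm_one]
    refine (Finset.sum_le_card_nsmul _ _ (entryBound ε F F) fun j hj => ?_).trans_lt ?_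
    · rw [Matrix.add_apply, Matrix.one_apply_ne (Finset.ne_of_mem_erase hj).symm, zero_add]
      exact H.M_le hε hΦ k j (hzk k)
    · have hn : 1 ≤ n := by have := k.pos; omega
      rw [Finset.card_erase_of_mem (Finset.mem_univ k), Finset.card_univ, Fintype.card_fin,
        nsmul_eq_mul, Nat.cast_sub hn, Nat.cast_one]
      exact hμ
  have hu : u z ≠ 0 := fun h => hdet (by rw [H.det_eq z hz, h, zero_mul])
  refine ⟨hdet, hu, fun m => ?_⟩
  have hA0 : 0 ≤ F / (1 - ε * F) := div_nonneg hF (by linarith)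
  have hE : ‖fun m => e m z‖ ≤ F / (1 - ε * F) * ‖u z‖ +
      (n - 1) * entryBound ε F F * ‖fun m => e m z‖ := by
    have hn : (1 : ℝ) ≤ n := by
      have := m.pos; exact_mod_cast this
    refine (pi_norm_le_iff_of_nonneg (add_nonneg (by positivity) (mul_nonneg (mul_nonneg
      (by linarith) hm0) (norm_nonneg _)))).2 fun k => ?_
    have h1 : e k z = A k (z k) * u z - ∑ m, M k m (z k) * e m z := by
      linear_combination H.sum_mul z hz k
    have h2 := sum_norm_mul_le_of_diag_eq_zero (N := fun m => M k m (z k)) (k := k) (H.M_self k _)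
      (fun m => H.M_le hε hΦ k m (hzk k)) (fun m => e m z)
      (fun m => norm_le_pi_norm (fun m => e m z) m) hm0
    rw [Fintype.card_fin] at h2
    have h3 : ‖A k (z k) * u z‖ ≤ F / (1 - ε * F) * ‖u z‖ := by
      rw [norm_mul]; exact mul_le_mul_of_nonneg_right (H.A_le k _ (hzk k)) (norm_nonneg _)
    rw [h1]
    exact (norm_sub_le _ _).trans (add_le_add h3 h2)
  rw [norm_div, div_le_iff₀ (norm_pos_iff.2 hu), div_mul_eq_mul_div, le_div_iff₀ (by linarith)]
  have h4 := norm_le_pi_norm (fun m => e m z) m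
  have h5 : ‖fun m => e m z‖ * (1 - (n - 1) * entryBound ε F F) ≤ F / (1 - ε * F) * ‖u z‖ := by
    linarith
  exact (mul_le_mul_of_nonneg_right h4 (by linarith)).trans h5

end Logarithm

/-- Bound for the norms of the entries of `e / u`. -/
def ratioBound (n : ℕ) (ε F : ℝ) : ℝ := F / (1 - ε * F) / (1 - (n - 1) * entryBound ε F F)

/-- The bounded part of the contribution of each coordinate to `(n + 1) log u`. -/
def logBound (n : ℕ) (ε F : ℝ) : ℝ :=
  (n - 1) * entryBound ε F F / (1 - (n - 1) * entryBound ε F F) * entryBound ε F F -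
    Real.log (1 - (n - 1) * rowBound ε F * ratioBound n ε F) - 2 * Real.log (1 - ε * F)

/-! ### Logarithms of det(1 + M) and of u^(n+1) on complex lines -/

section Logarithm

variable {n : ℕ} {ε r F : ℝ} {Φ φ : ℝ → ℝ} {u : (Fin n → ℂ) → ℂ} {e : Fin n → (Fin n → ℂ) → ℂ}
  {A l : Fin n → ℂ → ℂ} {R M : Fin n → Fin n → ℂ → ℂ}

/-- By Jacobi's formula the logarithmic derivative of the determinant along t ↦ t ζ is the trace of
(1 + N)⁻¹ N'. The logarithm is defined as its primitive, so no branch has to be chosen, and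
`norm_trace_le` is integrated against the derivative of `entryBound ε F ∘ Φ`. -/
theorem AxisFactorization.exists_log_det (H : AxisFactorization ε r F Φ φ u e A l R M)
    (hε : 0 ≤ ε) (hΦ : GrowthMajorant ε r F Φ φ) (hΦm : MonotoneOn Φ (Ico 0 r))
    (hφm : MonotoneOn φ (Ico 0 r)) (hεF : ε * F < 1) (hr0 : 0 < r)
    (hμ : (n - 1) * entryBound ε F F < 1) (hn : 1 ≤ n) {ζ : Fin n → ℂ} (hζ : ‖ζ‖ ≤ 1) :
    ∃ d : ℂ → ℂ, DifferentiableOn ℂ d (ball 0 r) ∧ d 0 = 0 ∧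
      (∀ t ∈ ball (0 : ℂ) r, Complex.exp (d t) =
        (1 + Matrix.of fun k m => M k m (t * ζ k)).det) ∧
      ∀ t ∈ ball (0 : ℂ) r, ‖d t‖ ≤ n * ((n - 1) * entryBound ε F F /
        (1 - (n - 1) * entryBound ε F F) * entryBound ε F F) := by
  have hF := hΦ.bound_nonneg hr0
  have hm0 : 0 ≤ entryBound ε F F := by rw [entryBound]; positivity
  have hn' : (1 : ℝ) ≤ n := by exact_mod_cast hn
  have hμ0 : 0 ≤ (n - 1) * entryBound ε F F := mul_nonneg (by linarith) hm0
  have hle : ∀ (t : ℂ) k, ‖t * ζ k‖ ≤ ‖t‖ := fun t k => by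
    rw [norm_mul]
    exact mul_le_of_le_one_right (norm_nonneg _) ((norm_le_pi_norm ζ k).trans hζ)
  have hmem : ∀ t ∈ ball (0 : ℂ) r, ∀ k, t * ζ k ∈ ball (0 : ℂ) r := fun t ht k => by
    rw [mem_ball_zero_iff] at ht ⊢; exact (hle t k).trans_lt ht
  have hIco : ∀ ξ ∈ ball (0 : ℂ) r, ‖ξ‖ ∈ Ico 0 r := fun ξ hξ =>
    ⟨norm_nonneg _, by simpa using hξ⟩
  have hnorm : ∀ t ∈ ball (0 : ℂ) r, ‖t • ζ‖ < r := fun t ht => by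
    rw [mem_ball_zero_iff] at ht
    rw [norm_smul]
    exact (mul_le_of_le_one_right (norm_nonneg _) hζ).trans_lt ht
  set N : ℂ → Matrix (Fin n) (Fin n) ℂ := fun t => Matrix.of fun k m => M k m (t * ζ k) with hN
  set N' : ℂ → Matrix (Fin n) (Fin n) ℂ := fun t => Matrix.of fun k m =>
    R k m (t * ζ k) * Complex.exp (l k (t * ζ k)) * ζ k with hN'
  set X : ℂ → Matrix (Fin n) (Fin n) ℂ := fun t => (1 + N t)⁻¹ * N' t with hX
  have hdet : ∀ t ∈ ball (0 : ℂ) r, (1 + N t).det ≠ 0 := fun t ht =>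
    (H.ne_zero_and_norm_le hε hΦ hεF hr0 hμ (hnorm t ht)).1
  have hXeq : ∀ t ∈ ball (0 : ℂ) r, (1 + N t) * X t = N' t := fun t ht => by
    rw [hX, ← mul_assoc, Matrix.mul_nonsing_inv _ (isUnit_iff_ne_zero.2 (hdet t ht)), one_mul]
  have hd : ∀ t ∈ ball (0 : ℂ) r, HasDerivAt (fun s => (1 + N s).det)
      ((X t).trace * (1 + N t).det) t := fun t ht => by
    refine hasDerivAt_det (A := fun s => 1 + N s) fun i j => ?_
    rw [hXeq t ht]
    simp only [Matrix.add_apply, hN, hN', Matrix.of_apply]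
    exact ((H.M_deriv i j _ (hmem t ht i)).comp t (hasDerivAt_mul_const (ζ i))).const_add _
  have hD : DifferentiableOn ℂ (fun s => (1 + N s).det) (ball 0 r) := fun t ht =>
    (hd t ht).differentiableAt.differentiableWithinAt
  have hcd : DifferentiableOn ℂ (fun t => (X t).trace) (ball 0 r) := by
    refine ((hD.deriv isOpen_ball).div hD hdet).congr fun t ht => ?_
    simp only [Pi.div_apply, (hd t ht).deriv]
    rw [mul_div_cancel_right₀ _ (hdet t ht)]
  obtain ⟨d, hd0, hdd⟩ := hcd.isExactOn_ball.with_val_at 0 0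
  refine ⟨d, fun t ht => (hdd t ht).differentiableAt.differentiableWithinAt, hd0,
    fun t ht => ?_, fun t ht => ?_⟩
  · have h := eq_mul_exp_of_hasDerivAt hd hdd hd0 ht
    have h0 : (1 + N 0).det = 1 := by
      have : N 0 = 0 := by ext k m; simp [hN, H.M_zero]
      rw [this, add_zero, Matrix.det_one]
    rw [h0, one_mul] at h
    exact h.symm
  · set κ := (n : ℝ) * ((n - 1) * entryBound ε F F / (1 - (n - 1) * entryBound ε F F)) with hκ
    have hκ0 : 0 ≤ κ := mul_nonneg (by linarith) (div_nonneg hμ0 (by linarith))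
    have h := norm_le_of_norm_deriv_le (h := fun t => κ * entryBound ε F (Φ t))
      (h' := fun t => κ * (ε / (1 - ε * F) ^ 2 *
      ((2 + 3 / 2 * Φ t + ε * (4 * Φ t + 3 / 4 * Φ t ^ 2)) * φ t))) hdd
      (fun t ht => (hasDerivAt_entryBound (hΦ.hasDerivAt t ht)).const_mul κ) (fun t ht => ?_) ht
    · rw [hd0, norm_zero, hΦ.zero, zero_add] at h
      have h1 := entryBound_mono (F := F) hε (hΦ.nonneg _ (hIco t ht)) (hΦ.le _ (hIco t ht))
      have h2 : entryBound ε F 0 = 0 := by simp [entryBound]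
      have h3 := mul_le_mul_of_nonneg_left h1 hκ0
      rw [h2, mul_zero, sub_zero] at h
      refine (h.trans h3).trans (le_of_eq ?_)
      rw [hκ]; ring
    · have h := norm_trace_le (N := N t) (N' := N' t) (X := X t) (a := entryBound ε F F)
        (b := ε / (1 - ε * F) ^ 2 *
          ((2 + 3 / 2 * Φ ‖t‖ + ε * (4 * Φ ‖t‖ + 3 / 4 * Φ ‖t‖ ^ 2)) * φ ‖t‖))
        (fun i => by simp [hN, H.M_self]) (fun i => by simp [hN', H.R_self])
        (fun i j => H.M_le hε hΦ i j (hmem t ht i)) (fun i j => ?_) hm0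
        (by rwa [Fintype.card_fin]) (hXeq t ht)
      · rw [Fintype.card_fin] at h
        refine h.trans (le_of_eq ?_)
        rw [hκ]; ring
      · simp only [hN', Matrix.of_apply]
        have hz := hmem t ht i
        have h1 := H.M_deriv_le i j _ hz
        have h2 := hΦm (hIco _ hz) (hIco t ht) (hle t i)
        have h3 := hφm (hIco _ hz) (hIco t ht) (hle t i)
        have h4 := hΦ.nonneg _ (hIco _ hz)
        have h5 : 0 ≤ φ ‖t * ζ i‖ := (Real.exp_pos _).le.trans (hΦ.exp_le _ (hIco _ hz))
        have h6 := hΦ.nonneg _ (hIco t ht)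
        rw [norm_mul]
        refine (mul_le_of_le_one_right (norm_nonneg _) ((norm_le_pi_norm ζ i).trans hζ)).trans
          (h1.trans ?_)
        gcongr

theorem AxisFactorization.exists_log (H : AxisFactorization ε r F Φ φ u e A l R M)
    (hε : 0 ≤ ε) (hΦ : GrowthMajorant ε r F Φ φ) (hΦm : MonotoneOn Φ (Ico 0 r))
    (hφm : MonotoneOn φ (Ico 0 r)) (hεF : ε * F < 1) (hr0 : 0 < r) (hr : r ≤ 1)
    (hμ : (n - 1) * entryBound ε F F < 1)
    (hq : (n - 1) * rowBound ε F * ratioBound n ε F < 1) (hn : 1 ≤ n)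
    (hu : DifferentiableOn ℂ u (polydisk n)) (he : ∀ k, DifferentiableOn ℂ (e k) (polydisk n))
    (he0 : ∀ k, e k 0 = 0) {ζ : Fin n → ℂ} (hζ : ‖ζ‖ ≤ 1) :
    ∃ G : ℂ → ℂ, DifferentiableOn ℂ G (ball 0 r) ∧ G 0 = 0 ∧
      (∀ t ∈ ball (0 : ℂ) r, Complex.exp (G t) = u (t • ζ) ^ (n + 1)) ∧
      ∀ t ∈ ball (0 : ℂ) r, ‖G t‖ ≤ n * (logBound n ε F + 3 * ε * Real.artanh ‖t‖) := by
  obtain ⟨d, hd, hd0, hde, hdn⟩ := H.exists_log_det hε hΦ hΦm hφm hεF hr0 hμ hn hζ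
  have hF := hΦ.bound_nonneg hr0
  have hρ0 : 0 ≤ rowBound ε F := by rw [rowBound]; positivity
  have hle : ∀ (t : ℂ) k, ‖t * ζ k‖ ≤ ‖t‖ := fun t k => by
    rw [norm_mul]
    exact mul_le_of_le_one_right (norm_nonneg _) ((norm_le_pi_norm ζ k).trans hζ)
  have hmem : ∀ t ∈ ball (0 : ℂ) r, ∀ k, t * ζ k ∈ ball (0 : ℂ) r := fun t ht k => by
    rw [mem_ball_zero_iff] at ht ⊢; exact (hle t k).trans_lt ht
  have hnorm : ∀ t ∈ ball (0 : ℂ) r, ‖t • ζ‖ < r := fun t ht => by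
    rw [mem_ball_zero_iff] at ht
    rw [norm_smul]
    exact (mul_le_of_le_one_right (norm_nonneg _) hζ).trans_lt ht
  have hline : ∀ f : (Fin n → ℂ) → ℂ, DifferentiableOn ℂ f (polydisk n) →
      DifferentiableOn ℂ (fun t : ℂ => f (t • ζ)) (ball 0 r) := fun f hf =>
    hf.comp (by fun_prop) fun t ht => mem_polydisk_iff_norm.2 ((hnorm t ht).trans_le hr)
  have hu_ne : ∀ t ∈ ball (0 : ℂ) r, u (t • ζ) ≠ 0 := fun t ht =>
    (H.ne_zero_and_norm_le hε hΦ hεF hr0 hμ (hnorm t ht)).2.1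
  set f : Fin n → ℂ → ℂ := fun k t => ∑ m, R k m (t * ζ k) * (e m (t • ζ) / u (t • ζ)) with hf
  have hfn : ∀ k, ∀ t ∈ ball (0 : ℂ) r, ‖f k t‖ ≤ (n - 1) * rowBound ε F * ratioBound n ε F := by
    intro k t ht
    have h := sum_norm_mul_le_of_diag_eq_zero (N := fun m => R k m (t * ζ k)) (k := k)
      (H.R_self k _) (fun m => H.R_le k m _ (hmem t ht k)) (fun m => e m (t • ζ) / u (t • ζ))
      (fun m => (H.ne_zero_and_norm_le hε hΦ hεF hr0 hμ (hnorm t ht)).2.2 m) hρ0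
    rwa [Fintype.card_fin] at h
  have hslit : ∀ k, ∀ t ∈ ball (0 : ℂ) r, 1 - f k t ∈ Complex.slitPlane := fun k t ht => by
    left
    rw [Complex.sub_re, Complex.one_re]
    linarith [Complex.re_le_norm (f k t), hfn k t ht]
  have hfd : ∀ k, DifferentiableOn ℂ (f k) (ball 0 r) := fun k =>
    DifferentiableOn.fun_sum fun m _ => ((H.R_diff k m).comp (by fun_prop)
      fun t ht => hmem t ht k).mul ((hline _ (he m)).div (hline _ hu) hu_ne)
  -- With f_k = ∑ R_km e_m / u, the determinant formula reads det(1 + M) = u^(n+1) ∏ exp(l_k) (1 -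
  -- f_k).
  refine ⟨fun t => d t - ∑ k, l k (t * ζ k) - ∑ k, Complex.log (1 - f k t), ?_, ?_, ?_, ?_⟩
  · refine (hd.sub (DifferentiableOn.fun_sum fun k _ => (H.l_diff k).comp (by fun_prop)
      fun t ht => hmem t ht k)).sub (DifferentiableOn.fun_sum fun k _ => ?_)
    exact (((differentiableOn_const 1).sub (hfd k)).clog (hslit k))
  · simp [hd0, H.l_zero, hf, he0]
  · intro t ht
    have h1 := H.det_eq _ (hnorm t ht)
    have h2 : ∀ k, u (t • ζ) - ∑ m, R k m (t * ζ k) * e m (t • ζ) = u (t • ζ) * (1 - f k t) := by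
      intro k
      rw [hf, mul_sub, mul_one, Finset.mul_sum]
      congr 1
      refine Finset.sum_congr rfl fun m _ => ?_
      have := hu_ne t ht
      field_simp
    simp only [Pi.smul_apply, smul_eq_mul, h2] at h1
    rw [Complex.exp_sub, Complex.exp_sub, hde t ht, h1, Complex.exp_sum, Complex.exp_sum,
      Finset.prod_congr rfl fun k _ => Complex.exp_log (Complex.slitPlane_ne_zero (hslit k t ht)),
      Finset.prod_mul_distrib, Finset.prod_mul_distrib, Finset.prod_const, Finset.card_univ,
      Fintype.card_fin]
    have h3 : ∏ k, Complex.exp (l k (t * ζ k)) ≠ 0 :=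
      Finset.prod_ne_zero_iff.2 fun k _ => Complex.exp_ne_zero _
    have h4 : ∏ k, (1 - f k t) ≠ 0 :=
      Finset.prod_ne_zero_iff.2 fun k _ => Complex.slitPlane_ne_zero (hslit k t ht)
    field_simp
    ring
  · intro t ht
    have hlk : ∀ k, ‖l k (t * ζ k)‖ ≤ 3 * ε * Real.artanh ‖t‖ - 2 * Real.log (1 - ε * F) := by
      intro k
      refine (H.l_le k _ (hmem t ht k)).trans ?_
      have h1 : Real.artanh ‖t * ζ k‖ ≤ Real.artanh ‖t‖ :=
        Real.artanh_le_artanh (by linarith [norm_nonneg (t * ζ k)])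
          ((mem_ball_zero_iff.1 ht).trans_le hr) (hle t k)
      have := mul_le_mul_of_nonneg_left h1 (by linarith : 0 ≤ 3 * ε)
      linarith
    have h1 : ‖∑ k, l k (t * ζ k)‖ ≤
        n * (3 * ε * Real.artanh ‖t‖ - 2 * Real.log (1 - ε * F)) := by
      refine (norm_sum_le_of_le _ fun k _ => hlk k).trans (le_of_eq ?_)
      simp
      ring
    have h2 : ‖∑ k, Complex.log (1 - f k t)‖ ≤
        n * -Real.log (1 - (n - 1) * rowBound ε F * ratioBound n ε F) := by
      refine (norm_sum_le_of_le _ fun k _ =>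
        norm_log_one_sub_le (hfn k t ht) hq).trans (le_of_eq ?_)
      simp
    refine (norm_sub_le _ _).trans ?_
    have h3 := norm_sub_le (d t) (∑ k, l k (t * ζ k))
    have h4 := hdn t ht
    rw [logBound]
    linarith

end Logarithm

/-! ### Schwarz–Pick estimates for functions vanishing to second order -/

section SchwarzPick

/-- **Schwarz–Pick lemma**, in the form of a bound depending on the value at the center. -/
theorem norm_le_of_norm_le_of_norm_zero_le {h : ℂ → ℂ} {R H a : ℝ}
    (hd : DifferentiableOn ℂ h (ball 0 R)) (hH : ∀ t ∈ ball (0 : ℂ) R, ‖h t‖ ≤ H)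
    (h0 : ‖h 0‖ ≤ a) (haH : a < H) {t : ℂ} (ht : t ∈ ball (0 : ℂ) R) :
    ‖h t‖ ≤ H * (a + H * (‖t‖ / R)) / (H + a * (‖t‖ / R)) := by
  have ht' := mem_ball_zero_iff.1 ht
  have hR : 0 < R := (norm_nonneg t).trans_lt ht'
  set x := ‖t‖ / R with hx
  have hx0 : 0 ≤ x := by positivity
  have hx1 : x ≤ 1 := (div_le_one hR).2 ht'.le
  have ha0 : 0 ≤ a := (norm_nonneg _).trans h0
  have hH0 : 0 < H := ha0.trans_lt haH
  set b := h 0 with hb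
  have hbH : ‖b‖ < H := h0.trans_lt haH
  have hlow : ∀ s ∈ ball (0 : ℂ) R, H ^ 2 - ‖b‖ * ‖h s‖ ≤ ‖(H : ℂ) ^ 2 - starRingEnd ℂ b * h s‖ := by
    intro s _
    have := norm_sub_norm_le ((H : ℂ) ^ 2) (starRingEnd ℂ b * h s)
    simpa [abs_of_pos hH0] using this
  have hpos : ∀ s ∈ ball (0 : ℂ) R, 0 < H ^ 2 - ‖b‖ * ‖h s‖ := fun s hs => by
    have := mul_le_mul_of_nonneg_left (hH s hs) (norm_nonneg b)
    nlinarith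
  have hne : ∀ s ∈ ball (0 : ℂ) R, (H : ℂ) ^ 2 - starRingEnd ℂ b * h s ≠ 0 := fun s hs hz => by
    have := hlow s hs
    rw [hz, norm_zero] at this
    linarith [hpos s hs]
  have hid : ∀ w : ℂ, ‖(H : ℂ) ^ 2 - starRingEnd ℂ b * w‖ ^ 2 =
      H ^ 2 * ‖w - b‖ ^ 2 + (H ^ 2 - ‖b‖ ^ 2) * (H ^ 2 - ‖w‖ ^ 2) := by
    intro w
    simp only [← Complex.normSq_eq_norm_sq, Complex.normSq_apply, ← Complex.ofReal_pow,
      Complex.sub_re, Complex.sub_im, Complex.mul_re, Complex.mul_im, Complex.ofReal_re,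
      Complex.ofReal_im, Complex.conj_re, Complex.conj_im]
    ring
  -- The Möbius map sending the disk of radius H to the unit disk and b to 0; `hid` is the identity
  -- showing |f| ≤ 1.
  set f : ℂ → ℂ := fun s => H * (h s - b) / ((H : ℂ) ^ 2 - starRingEnd ℂ b * h s) with hf
  have hfd : DifferentiableOn ℂ f (ball 0 R) :=
    ((hd.sub_const b).const_mul _).div ((hd.const_mul _).const_sub _) hne
  have hf0 : f 0 = 0 := by simp [hf, hb]
  have hmaps : MapsTo f (ball 0 R) (closedBall (f 0) 1) := by
    intro s hs
    rw [hf0, mem_closedBall_zero_iff, hf, norm_div, div_le_one (norm_pos_iff.2 (hne s hs)),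
      norm_mul, Complex.norm_real, Real.norm_of_nonneg hH0.le]
    refine le_of_sq_le_sq ?_ (norm_nonneg _)
    rw [hid, mul_pow]
    have h1 := hH s hs
    have h2 : 0 ≤ (H ^ 2 - ‖b‖ ^ 2) * (H ^ 2 - ‖h s‖ ^ 2) :=
      mul_nonneg (by nlinarith [norm_nonneg b]) (by nlinarith [norm_nonneg (h s)])
    linarith
  have hS := Complex.dist_le_div_mul_dist_of_mapsTo_ball hfd hmaps ht
  rw [hf0, dist_zero_right, dist_zero_right, one_div, ← div_eq_inv_mul, ← hx, hf, norm_div,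
    div_le_iff₀ (norm_pos_iff.2 (hne t ht)), norm_mul, Complex.norm_real,
    Real.norm_of_nonneg hH0.le] at hS
  have hw0 := norm_nonneg (h t)
  have hwH := hH t ht
  set w := ‖h t‖ with hw
  set α := ‖b‖ with hα
  have hα0 : 0 ≤ α := norm_nonneg _
  have hkey : H * (w - α) ≤ x * (H ^ 2 - α * w) := by
    refine le_of_sq_le_sq ?_ (mul_nonneg hx0 (hpos t ht).le)
    have h1 : H ^ 2 * ‖h t - b‖ ^ 2 ≤ x ^ 2 * ‖(H : ℂ) ^ 2 - starRingEnd ℂ b * h t‖ ^ 2 := by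
      rw [← mul_pow, ← mul_pow]
      exact pow_le_pow_left₀ (by positivity) hS 2
    have h2 := pow_le_pow_left₀ (hpos t ht).le (hlow t ht) 2
    have h3 := hid (h t)
    have hx2 : 0 ≤ 1 - x ^ 2 := by nlinarith
    nlinarith [mul_le_mul_of_nonneg_left h2 hx2]
  have h5 : w * (H + α * x) ≤ H * (α + H * x) := by linarith
  have h6 : w ≤ H * (α + H * x) / (H + α * x) := by
    rw [le_div_iff₀ (by positivity)]; exact h5
  refine h6.trans ?_
  -- The bound increases with |h(0)|, so the exact value may be replaced by its majorant a.
  rw [div_le_div_iff₀ (by positivity) (by positivity)]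
  have h8 : H * (a + H * x) * (H + α * x) - H * (α + H * x) * (H + a * x) =
      (a - α) * (H ^ 2 * (1 - x ^ 2)) := by ring
  have h9 : 0 ≤ (a - α) * (H ^ 2 * (1 - x ^ 2)) :=
    mul_nonneg (by linarith) (mul_nonneg (by positivity) (by nlinarith))
  linarith

/-- Since v'(0) = 0, G vanishes to second order. Two applications of the Schwarz lemma bound h = G /
t² by K / R², and h(0) = N s / 2 because v(0) = 1. The Schwarz–Pick bound for h then combines both
pieces of information. -/
theorem norm_le_of_exp_eq_pow {G v v' : ℂ → ℂ} {R K a : ℝ} {s : ℂ} {N : ℕ} (hR : 0 < R)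
    (hG : DifferentiableOn ℂ G (ball 0 R)) (hG0 : G 0 = 0)
    (hGv : ∀ t ∈ ball (0 : ℂ) R, Complex.exp (G t) = v t ^ N)
    (hv : ∀ t ∈ ball (0 : ℂ) R, HasDerivAt v (v' t) t) (hv0 : v 0 = 1) (hv'0 : v' 0 = 0)
    (hs : HasDerivAt v' s 0) (hGK : ∀ t ∈ ball (0 : ℂ) R, ‖G t‖ ≤ K)
    (ha : ‖N * s / 2‖ ≤ a) (haK : a < K / R / R) {t : ℂ} (ht : t ∈ ball (0 : ℂ) R) :
    ‖G t‖ ≤ ‖t‖ ^ 2 * (K / R / R * (a + K / R / R * (‖t‖ / R)) / (K / R / R + a * (‖t‖ / R))) := by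
  have h0 : (0 : ℂ) ∈ ball (0 : ℂ) R := mem_ball_self hR
  have hd : ∀ t ∈ ball (0 : ℂ) R, HasDerivAt G (deriv G t) t := fun t ht =>
    (hG.differentiableAt (isOpen_ball.mem_nhds ht)).hasDerivAt
  have hrel : ∀ t ∈ ball (0 : ℂ) R, deriv G t * v t = N * v' t := by
    intro t ht
    have h1 := (hd t ht).cexp
    have h2 : HasDerivAt (fun t => Complex.exp (G t)) (N * v t ^ (N - 1) * v' t) t := by
      refine ((hv t ht).fun_pow N).congr_of_eventuallyEq ?_
      filter_upwards [isOpen_ball.mem_nhds ht] with s hs using hGv s hs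
    have h3 := h1.unique h2
    rw [hGv t ht] at h3
    have hvt : v t ≠ 0 ∨ N = 0 := by
      by_contra! h
      have h4 := hGv t ht
      rw [h.1, zero_pow h.2] at h4
      exact Complex.exp_ne_zero _ h4
    rcases hvt with hvt | rfl
    · rcases N with _ | N
      · simp only [pow_zero, one_mul, Nat.cast_zero, zero_mul] at h3
        simp [h3]
      · have h5 : v t ^ N ≠ 0 := pow_ne_zero _ hvt
        refine mul_left_cancel₀ h5 ?_
        rw [Nat.add_sub_cancel] at h3
        rw [pow_succ] at h3
        linear_combination h3
    · simp only [pow_zero, one_mul, Nat.cast_zero, zero_mul] at h3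
      simp [h3]
  have hG1 : deriv G 0 = 0 := by
    have := hrel 0 h0
    rwa [hv0, hv'0, mul_one, mul_zero] at this
  have hG2 : HasDerivAt (deriv G) (N * s) 0 := by
    have h1 : deriv G =ᶠ[𝓝 0] fun t => N * v' t / v t := by
      have hvc : ContinuousAt v 0 := (hv 0 h0).continuousAt
      filter_upwards [isOpen_ball.mem_nhds h0, hvc.eventually_ne (by rw [hv0]; exact one_ne_zero)]
        with t ht hvt
      rw [← hrel t ht, mul_div_cancel_right₀ _ hvt]
    refine (((hs.const_mul (N : ℂ)).fun_div (hv 0 h0) (by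
      rw [hv0]; exact one_ne_zero)).congr_of_eventuallyEq h1).congr_deriv ?_
    simp [hv0, hv'0]
  set g := dslope G 0 with hg
  have hgd : DifferentiableOn ℂ g (ball 0 R) :=
    (Complex.differentiableOn_dslope (isOpen_ball.mem_nhds h0)).2 hG
  have hg0 : g 0 = 0 := by rw [hg, dslope_same, hG1]
  have hGg : ∀ t, G t = t * g t := fun t => by
    have := sub_smul_dslope G 0 t
    rw [sub_zero, smul_eq_mul, hG0, sub_zero] at this
    exact this.symm
  set h := dslope g 0 with hh
  have hhd : DifferentiableOn ℂ h (ball 0 R) :=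
    (Complex.differentiableOn_dslope (isOpen_ball.mem_nhds h0)).2 hgd
  have hgh : ∀ t, g t = t * h t := fun t => by
    have := sub_smul_dslope g 0 t
    rw [sub_zero, smul_eq_mul, hg0, sub_zero] at this
    exact this.symm
  have hgK : ∀ t ∈ ball (0 : ℂ) R, ‖g t‖ ≤ K / R := fun t ht =>
    Complex.norm_dslope_le_div_of_mapsTo_ball hG (fun s hs => by
      rw [hG0, mem_closedBall_zero_iff]; exact hGK s hs) ht
  have hhK : ∀ t ∈ ball (0 : ℂ) R, ‖h t‖ ≤ K / R / R := fun t ht =>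
    Complex.norm_dslope_le_div_of_mapsTo_ball hgd (fun s hs => by
      rw [hg0, mem_closedBall_zero_iff]; exact hgK s hs) ht
  have hh0 : h 0 = N * s / 2 := by
    have hgd' : ∀ t ∈ ball (0 : ℂ) R, HasDerivAt g (deriv g t) t := fun t ht =>
      (hgd.differentiableAt (isOpen_ball.mem_nhds ht)).hasDerivAt
    have h1 : deriv G =ᶠ[𝓝 0] fun t => g t + t * deriv g t := by
      filter_upwards [isOpen_ball.mem_nhds h0] with t ht
      have h2 : HasDerivAt G (1 * g t + t * deriv g t) t :=
        ((hasDerivAt_id t).mul (hgd' t ht)).congr_of_eventuallyEq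
          (Eventually.of_forall fun t => by simp [hGg t])
      rw [h2.deriv, one_mul]
    have h3 : HasDerivAt (deriv g) (deriv (deriv g) 0) 0 :=
      ((hgd.deriv isOpen_ball).differentiableAt (isOpen_ball.mem_nhds h0)).hasDerivAt
    have h4 := (hgd' 0 h0).fun_add ((hasDerivAt_id' (0 : ℂ)).fun_mul h3)
    have h5 := hG2.unique (h4.congr_of_eventuallyEq h1)
    simp only [one_mul, zero_mul, add_zero] at h5
    rw [hh, dslope_same, h5]
    ring
  have hfin := norm_le_of_norm_le_of_norm_zero_le hhd hhK (by rw [hh0]; exact ha) haK ht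
  rw [hGg, hgh, ← mul_assoc, ← sq, norm_mul, norm_pow]
  exact mul_le_mul_of_nonneg_left hfin (by positivity)

end SchwarzPick

namespace LinearSystem

/-! ### Growth of log |u|: Cauchy estimates at the origin and both bounds -/

section Growth

variable {n : ℕ} {L : LinearSystem n} {ε r F : ℝ} {Φ φ : ℝ → ℝ}

theorem Regular.norm_P_axis_le (hR : L.Regular ε) {m l k : Fin n} (hlk : l ≠ k) {ξ : ℂ}
    (hξ : ξ ∈ ball (0 : ℂ) 1) : ‖L.P m m l (Pi.single k ξ)‖ ≤ ε := by
  have h := hR.bound _ (single_mem_polydisk (k := k) hξ) m l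
  simpa [hlk] using h

theorem Regular.norm_pderiv_P_le (hR : L.Regular ε) {m l k : Fin n} (hlk : l ≠ k) :
    ‖pderiv k (L.P m m l) 0‖ ≤ ε := by
  have h := norm_deriv_zero_le one_pos (fun ξ hξ => (hasDerivAt_axis (hR.hol.1 m m l) k
    hξ).differentiableAt.differentiableWithinAt) (fun ξ hξ => hR.norm_P_axis_le hlk hξ)
  rw [(hasDerivAt_axis (hR.hol.1 m m l) k (mem_ball_self one_pos)).deriv] at h
  simpa using h

theorem Regular.norm_P_zero_le (hR : L.Regular ε) (m l : Fin n) : ‖L.P m m l 0‖ ≤ ε := by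
  simpa using hR.bound 0 zero_mem_polydisk m l

/-- Here the weight degenerates along the axis of differentiation, so Cauchy's estimate is used on
radius 3/5, close to the optimal 1/√3; it gives (25/16)(5/3) < 2.61. -/
theorem Regular.norm_pderiv_P_self_le (hR : L.Regular ε) (hε : 0 ≤ ε) (m k : Fin n) :
    ‖pderiv k (L.P m m k) 0‖ ≤ 2.61 * ε := by
  have hsub : ball (0 : ℂ) (3 / 5) ⊆ ball 0 1 := ball_subset_ball (by norm_num)
  have h := norm_deriv_zero_le (r := 3 / 5) (M := ε / (16 / 25)) (by norm_num) (fun ξ hξ =>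
    (hasDerivAt_axis (hR.hol.1 m m k) k (hsub hξ)).differentiableAt.differentiableWithinAt)
    (fun ξ hξ => by
      have h1 := hR.bound _ (single_mem_polydisk (k := k) (hsub hξ)) m k
      simp only [Pi.single_eq_same] at h1
      rw [le_div_iff₀ (by norm_num)]
      refine (mul_le_mul_of_nonneg_left ?_ (norm_nonneg _)).trans h1
      rw [mem_ball_zero_iff] at hξ
      nlinarith [norm_nonneg ξ])
  rw [(hasDerivAt_axis (hR.hol.1 m m k) k (mem_ball_self one_pos)).deriv, Pi.single_zero] at h
  refine h.trans ?_
  linarith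

theorem Regular.norm_P₀_self_le [Nontrivial (Fin n)] (hR : L.Regular ε) (hε : 0 ≤ ε) (k : Fin n) :
    ‖L.P₀ k k 0‖ ≤ 2.61 * ε + 2 * ε ^ 2 := by
  obtain ⟨m, hm⟩ := exists_ne k
  rw [hR.P₀_diag 0 zero_mem_polydisk k m hm.symm]
  have h1 := hR.norm_pderiv_P_self_le hε m k
  have h2 := hR.norm_P_zero_le m k
  have h3 := hR.norm_P_zero_le k k
  have h4 : ‖L.P m m k 0 ^ 2‖ ≤ ε ^ 2 := by
    rw [norm_pow]; exact pow_le_pow_left₀ (norm_nonneg _) h2 2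
  have h5 : ‖L.P k k k 0 * L.P m m k 0‖ ≤ ε ^ 2 := by
    rw [norm_mul, sq]; exact mul_le_mul h3 h2 (norm_nonneg _) hε
  refine (norm_sub_le _ _).trans ?_
  have h6 := norm_add_le (pderiv k (L.P m m k) 0) (L.P m m k 0 ^ 2)
  linarith

theorem Regular.norm_P₀_le_of_ne (hR : L.Regular ε) (hε : 0 ≤ ε) {k m : Fin n} (hkm : k ≠ m) :
    ‖L.P₀ k m 0‖ ≤ 2 * ε + ε ^ 2 := by
  rw [hR.P₀_off_diag 0 zero_mem_polydisk k m hkm]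
  have h1 := hR.norm_pderiv_P_le (m := m) (l := m) (k := k) hkm.symm
  have h2 := hR.norm_pderiv_P_le (m := m) (l := k) (k := m) hkm
  have h3 : ‖L.P m m k 0 * L.P k k m 0‖ ≤ ε ^ 2 := by
    rw [norm_mul, sq]
    exact mul_le_mul (hR.norm_P_zero_le m k) (hR.norm_P_zero_le k m) (norm_nonneg _) hε
  refine (norm_sub_le _ _).trans ?_
  have h4 := norm_sub_le (pderiv k (L.P m m m) 0) (pderiv m (L.P m m k) 0)
  linarith

theorem Regular.norm_sum_P₀_le [Nontrivial (Fin n)] (hR : L.Regular ε) (hε : 0 ≤ ε)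
    {ζ : Fin n → ℂ} (hζ : ‖ζ‖ ≤ 1) : ‖∑ i, ζ i * ∑ j, ζ j * L.P₀ j i 0‖ ≤
      n * (2.61 * ε + 2 * ε ^ 2) + n * (n - 1) * (2 * ε + ε ^ 2) := by
  have hζi : ∀ i, ‖ζ i‖ ≤ 1 := fun i => (norm_le_pi_norm ζ i).trans hζ
  have h1 : ∀ i, ‖ζ i * ∑ j, ζ j * L.P₀ j i 0‖ ≤
      (2.61 * ε + 2 * ε ^ 2) + (n - 1) * (2 * ε + ε ^ 2) := fun i => by
    rw [norm_mul]
    refine (mul_le_of_le_one_left (norm_nonneg _) (hζi i)).trans ?_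
    rw [← Finset.add_sum_erase _ _ (Finset.mem_univ i)]
    refine (norm_add_le _ _).trans (add_le_add ?_ ?_)
    · rw [norm_mul]
      exact (mul_le_of_le_one_left (norm_nonneg _) (hζi i)).trans (hR.norm_P₀_self_le hε i)
    · refine (norm_sum_le_of_le (n := fun _ => 2 * ε + ε ^ 2) _ fun j hj => ?_).trans
        (le_of_eq ?_)
      · rw [norm_mul]
        exact (mul_le_of_le_one_left (norm_nonneg _) (hζi j)).trans
          (hR.norm_P₀_le_of_ne hε (Finset.ne_of_mem_erase hj))
      · rw [Finset.sum_const, Finset.card_erase_of_mem (Finset.mem_univ i), Finset.card_univ,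
          Fintype.card_fin, nsmul_eq_mul, Nat.cast_sub i.pos]
        norm_num
  refine (norm_sum_le_of_le _ fun i _ => h1 i).trans (le_of_eq ?_)
  simp
  ring

theorem hasDerivAt_line {f : (Fin n → ℂ) → ℂ} (hf : DifferentiableOn ℂ f (polydisk n))
    {ζ : Fin n → ℂ} (hζ : ‖ζ‖ ≤ 1) {t : ℂ} (ht : t ∈ ball (0 : ℂ) 1) :
    HasDerivAt (fun t : ℂ => f (t • ζ)) (∑ i, ζ i * pderiv i f (t • ζ)) t := by
  have hz : t • ζ ∈ polydisk n := by
    rw [mem_ball_zero_iff] at ht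
    rw [mem_polydisk_iff_norm, norm_smul]
    exact (mul_le_of_le_one_right (norm_nonneg _) hζ).trans_lt ht
  have h := hasDerivAt_comp_line (f := f) (x := 0) (v := ζ) (ξ := t)
    (by rw [zero_add]; exact DifferentiableOn.at_polydisk hf hz)
  simpa only [zero_add, fderiv_apply_eq_sum] using h

/-- The logarithm of the solution with the `1`-jet `u = 1, ∇u = 0` at the origin, on a complex line
through the origin. -/
theorem Regular.exists_log [Nontrivial (Fin n)] (hR : L.Regular ε) (hr : r ≤ 1)
    (hr0 : 0 < r) (hε : 0 ≤ ε) (hΦ : GrowthMajorant ε r F Φ φ) (hΦm : MonotoneOn Φ (Ico 0 r))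
    (hφm : MonotoneOn φ (Ico 0 r)) (hεF : ε * F < 1)
    (hμ : (n - 1) * entryBound ε F F < 1)
    (hq : (n - 1) * rowBound ε F * ratioBound n ε F < 1)
    {u : (Fin n → ℂ) → ℂ} (hu : L.IsSolution u) (hu0 : u 0 = 1) (hu1 : ∀ i, pderiv i u 0 = 0)
    {ζ : Fin n → ℂ} (hζ : ‖ζ‖ ≤ 1) :
    ∃ G : ℂ → ℂ, DifferentiableOn ℂ G (ball 0 r) ∧ G 0 = 0 ∧
      (∀ t ∈ ball (0 : ℂ) r, Complex.exp (G t) = u (t • ζ) ^ (n + 1)) ∧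
      ∀ t ∈ ball (0 : ℂ) r, ‖G t‖ ≤ n * (logBound n ε F + 3 * ε * Real.artanh ‖t‖) := by
  obtain ⟨e, A, l, R, M, he, he0, H⟩ := hR.exists_axisFactorization hr hr0 hε hΦ hεF hu hu0 hu1
  have hn : 1 ≤ n := by
    obtain ⟨i, -⟩ := exists_pair_ne (Fin n)
    exact i.pos
  exact H.exists_log hε hΦ hΦm hφm hεF hr0 hr hμ hq hn hu.1 (fun k => (he k).1) he0 hζ

theorem abs_log_le_of_exp_eq_pow {g w : ℂ} {n : ℕ} (h : Complex.exp g = w ^ (n + 1)) :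
    (n + 1) * |Real.log ‖w‖| ≤ ‖g‖ := by
  have h1 : Real.exp g.re = ‖w‖ ^ (n + 1) := by rw [← Complex.norm_exp, h, norm_pow]
  have h2 : g.re = (n + 1) * Real.log ‖w‖ := by
    rw [← Real.log_exp g.re, h1, Real.log_pow]; push_cast; ring
  have h3 := Complex.abs_re_le_norm g
  rwa [h2, abs_mul, abs_of_nonneg (by positivity)] at h3

theorem exists_smul_eq {z : Fin n → ℂ} : ∃ ζ : Fin n → ℂ, ‖ζ‖ ≤ 1 ∧ (‖z‖ : ℂ) • ζ = z := by
  by_cases h : z = 0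
  · exact ⟨0, by simp, by simp [h]⟩
  · have h1 : (‖z‖ : ℂ) ≠ 0 := by exact_mod_cast norm_ne_zero_iff.2 h
    refine ⟨(‖z‖ : ℂ)⁻¹ • z, ?_, by rw [smul_smul, mul_inv_cancel₀ h1, one_smul]⟩
    rw [norm_smul, norm_inv, Complex.norm_real, norm_norm, inv_mul_cancel₀ (norm_ne_zero_iff.2 h)]

theorem Regular.abs_log_le [Nontrivial (Fin n)] (hR : L.Regular ε) (hr : r ≤ 1)
    (hr0 : 0 < r) (hε : 0 ≤ ε) (hΦ : GrowthMajorant ε r F Φ φ) (hΦm : MonotoneOn Φ (Ico 0 r))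
    (hφm : MonotoneOn φ (Ico 0 r)) (hεF : ε * F < 1)
    (hμ : (n - 1) * entryBound ε F F < 1)
    (hq : (n - 1) * rowBound ε F * ratioBound n ε F < 1)
    {u : (Fin n → ℂ) → ℂ} (hu : L.IsSolution u) (hu0 : u 0 = 1) (hu1 : ∀ i, pderiv i u 0 = 0)
    {z : Fin n → ℂ} (hz : ‖z‖ < r) :
    u z ≠ 0 ∧ (n + 1) * |Real.log ‖u z‖| ≤ n * (logBound n ε F + 3 * ε * Real.artanh ‖z‖) := by
  obtain ⟨ζ, hζ, hzζ⟩ := exists_smul_eq (z := z)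
  obtain ⟨G, -, -, hGe, hGn⟩ := hR.exists_log hr hr0 hε hΦ hΦm hφm hεF hμ hq hu hu0 hu1 hζ
  have ht : (‖z‖ : ℂ) ∈ ball (0 : ℂ) r := by simpa using hz
  have h1 := hGe _ ht
  have h2 := hGn _ ht
  rw [hzζ] at h1
  rw [Complex.norm_real, norm_norm] at h2
  refine ⟨fun h => Complex.exp_ne_zero (G ‖z‖) (by rw [h1, h]; simp), ?_⟩
  exact (abs_log_le_of_exp_eq_pow h1).trans h2

theorem Regular.abs_log_le_sq [Nontrivial (Fin n)] (hR : L.Regular ε) (hr : r < 1)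
    (hr0 : 0 < r) (hε : 0 ≤ ε) (hΦ : GrowthMajorant ε r F Φ φ) (hΦm : MonotoneOn Φ (Ico 0 r))
    (hφm : MonotoneOn φ (Ico 0 r)) (hεF : ε * F < 1)
    (hμ : (n - 1) * entryBound ε F F < 1)
    (hq : (n - 1) * rowBound ε F * ratioBound n ε F < 1)
    {u : (Fin n → ℂ) → ℂ} (hu : L.IsSolution u) (hu0 : u 0 = 1) (hu1 : ∀ i, pderiv i u 0 = 0)
    {K a : ℝ} (hK : n * (logBound n ε F + 3 * ε * Real.artanh r) ≤ K)
    (ha : (n + 1) / 2 * (n * (2.61 * ε + 2 * ε ^ 2) + n * (n - 1) * (2 * ε + ε ^ 2)) ≤ a)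
    (haK : a < K / r / r) {z : Fin n → ℂ} (hz : ‖z‖ < r) :
    u z ≠ 0 ∧ (n + 1) * |Real.log ‖u z‖| ≤ ‖z‖ ^ 2 *
      (K / r / r * (a + K / r / r * (‖z‖ / r)) / (K / r / r + a * (‖z‖ / r))) := by
  obtain ⟨ζ, hζ, hzζ⟩ := exists_smul_eq (z := z)
  obtain ⟨G, hGd, hG0, hGe, hGn⟩ :=
    hR.exists_log hr.le hr0 hε hΦ hΦm hφm hεF hμ hq hu hu0 hu1 hζ
  have ht : (‖z‖ : ℂ) ∈ ball (0 : ℂ) r := by simpa using hz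
  have hsub : ball (0 : ℂ) r ⊆ ball 0 1 := ball_subset_ball hr.le
  have h01 : (0 : ℂ) ∈ ball (0 : ℂ) 1 := mem_ball_self one_pos
  -- Because u(0) = 1 and ∇u(0) = 0, only P^0(0) contributes to the second derivative on the line.
  have hs : HasDerivAt (fun t : ℂ => ∑ i, ζ i * pderiv i u (t • ζ))
      (∑ i, ζ i * ∑ j, ζ j * L.P₀ j i 0) 0 := by
    refine HasDerivAt.fun_sum fun i _ => HasDerivAt.const_mul _ ?_
    refine (hasDerivAt_line (differentiableOn_pderiv isOpen_polydisk hu.1 i) hζ h01).congr_deriv ?_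
    refine Finset.sum_congr rfl fun j _ => ?_
    rw [zero_smul, hu.2 0 zero_mem_polydisk, hu0]
    simp [hu1]
  have h := norm_le_of_exp_eq_pow (N := n + 1) hr0 hGd hG0 hGe
    (fun t ht => hasDerivAt_line hu.1 hζ (hsub ht)) (by simpa using hu0) (by simp [hu1]) hs
    (K := K) (a := a) (fun t ht => by
      refine (hGn t ht).trans (le_trans ?_ hK)
      rw [mem_ball_zero_iff] at ht
      have h1 := Real.artanh_le_artanh (by linarith [norm_nonneg t]) hr ht.le
      gcongr) (by
      refine le_trans ?_ ha
      rw [norm_div, norm_mul, Complex.norm_natCast, Complex.norm_ofNat, mul_div_right_comm]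
      push_cast
      exact mul_le_mul_of_nonneg_left (hR.norm_sum_P₀_le hε hζ) (by positivity)) haK ht
  have h1 := hGe _ ht
  rw [hzζ] at h1
  rw [Complex.norm_real, norm_norm] at h
  refine ⟨fun h => Complex.exp_ne_zero (G ‖z‖) (by rw [h1, h]; simp), ?_⟩
  exact (abs_log_le_of_exp_eq_pow h1).trans h

end Growth

end LinearSystem

/-! ### Explicit majorants and numerical inequalities -/

section Numerics

/-- exp(3 ε artanh t) = ((1 + t)/(1 - t))^(3ε/2). Raising the exponent to κ and replacing 1 + t by 1
+ r leaves an elementary primitive; a rational κ later lets its values be bounded through integer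
powers. -/
theorem growthMajorant_rpow {ε r κ F : ℝ} (hr0 : 0 < r) (hr : r ≤ 1) (hκ0 : 0 ≤ κ)
    (hκ : 3 / 2 * ε ≤ κ) (hκ1 : κ < 1)
    (hF : (1 + r) ^ κ * (1 - (1 - r) ^ (1 - κ)) / (1 - κ) ≤ F) :
    GrowthMajorant ε r F (fun t => (1 + r) ^ κ * (1 - (1 - t) ^ (1 - κ)) / (1 - κ))
      (fun t => (1 + r) ^ κ * (1 - t) ^ (-κ)) where
  zero := by simp
  nonneg := fun t ht => by
    have h1 : (1 - t) ^ (1 - κ) ≤ 1 :=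
      Real.rpow_le_one (by linarith [ht.2]) (by linarith [ht.1]) (by linarith)
    have h2 : 0 ≤ (1 + r) ^ κ := by positivity
    exact div_nonneg (mul_nonneg h2 (by linarith)) (by linarith)
  le := fun t ht => by
    refine le_trans ?_ hF
    have h1 : (1 - r) ^ (1 - κ) ≤ (1 - t) ^ (1 - κ) :=
      Real.rpow_le_rpow (by linarith) (by linarith [ht.2]) (by linarith)
    have h2 : 0 < 1 - κ := by linarith
    gcongr
  hasDerivAt := fun t ht => by
    have h1 : (1 : ℝ) - t ≠ 0 := by linarith [ht.2]
    have h2 : 1 - κ ≠ 0 := by linarith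
    refine ((((((hasDerivAt_id' t).const_sub 1).rpow_const (p := 1 - κ) (Or.inl h1)).const_sub
      1).const_mul ((1 + r) ^ κ)).div_const (1 - κ)).congr_deriv ?_
    rw [show 1 - κ - 1 = -κ by ring]
    field_simp
  exp_le := fun t ht => by
    have h1 : 0 < 1 - t := by linarith [ht.2]
    have h2 : 0 < 1 + t := by linarith [ht.1]
    have h3 : 3 * ε * Real.artanh t ≤ κ * (2 * Real.artanh t) := by
      have := mul_le_mul_of_nonneg_right hκ (Real.artanh_nonneg ht.1)
      linarith
    have h4 : κ * (2 * Real.artanh t) = Real.log (1 + t) * κ + Real.log (1 - t) * (-κ) := by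
      rw [artanh_eq (by linarith) (by linarith)]; ring
    refine (Real.exp_le_exp.2 h3).trans ?_
    rw [h4, Real.exp_add, ← Real.rpow_def_of_pos h2, ← Real.rpow_def_of_pos h1]
    have h5 : (1 + t) ^ κ ≤ (1 + r) ^ κ :=
      Real.rpow_le_rpow h2.le (by linarith [ht.2]) hκ0
    have h6 : 0 ≤ (1 - t) ^ (-κ) := by positivity
    gcongr

theorem monotoneOn_majorant {r κ : ℝ} (hr0 : 0 < r) (hr : r ≤ 1) (hκ1 : κ < 1) :
    MonotoneOn (fun t => (1 + r) ^ κ * (1 - (1 - t) ^ (1 - κ)) / (1 - κ)) (Ico 0 r) := by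
  intro s _ t ht hst
  have h1 : (1 - t) ^ (1 - κ) ≤ (1 - s) ^ (1 - κ) :=
    Real.rpow_le_rpow (by linarith [ht.2]) (by linarith) (by linarith)
  have h2 : 0 < 1 - κ := by linarith
  dsimp only
  gcongr

theorem monotoneOn_majorant_deriv {r κ : ℝ} (hr0 : 0 < r) (hr : r ≤ 1) (hκ0 : 0 ≤ κ) :
    MonotoneOn (fun t => (1 + r) ^ κ * (1 - t) ^ (-κ)) (Ico 0 r) := by
  intro s _ t ht hst
  have h1 : (1 - s) ^ (-κ) ≤ (1 - t) ^ (-κ) :=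
    Real.rpow_le_rpow_of_nonpos (by linarith [ht.2]) (by linarith) (by linarith)
  dsimp only
  gcongr

theorem rpow_div_le {x y : ℝ} {p q : ℕ} (hx : 0 ≤ x) (hy : 0 ≤ y) (hq : q ≠ 0)
    (h : x ^ p ≤ y ^ q) : x ^ ((p : ℝ) / q) ≤ y := by
  rw [div_eq_mul_inv, Real.rpow_mul hx, Real.rpow_natCast, ← Real.pow_rpow_inv_natCast hy hq]
  exact Real.rpow_le_rpow (by positivity) h (by positivity)

theorem le_rpow_div {x y : ℝ} {p q : ℕ} (hx : 0 ≤ x) (hy : 0 ≤ y) (hq : q ≠ 0)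
    (h : y ^ q ≤ x ^ p) : y ≤ x ^ ((p : ℝ) / q) := by
  rw [div_eq_mul_inv, Real.rpow_mul hx, Real.rpow_natCast, ← Real.pow_rpow_inv_natCast hy hq]
  exact Real.rpow_le_rpow (by positivity) h (by positivity)

theorem neg_log_le {q c : ℝ} (hq : q < 1) (hc : 0 ≤ c)
    (h : 1 ≤ (1 - q) * (1 + c + c ^ 2 / 2 + c ^ 3 / 6 + c ^ 4 / 24)) : -Real.log (1 - q) ≤ c := by
  have h1 := Real.sum_le_exp_of_nonneg hc 5
  simp only [Finset.sum_range_succ, Finset.sum_range_zero, Nat.factorial] at h1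
  norm_num at h1
  have h2 : 0 < 1 - q := by linarith
  rw [← Real.log_inv, Real.log_le_iff_le_exp (inv_pos.2 h2), inv_le_iff_one_le_mul₀' h2]
  refine h.trans (mul_le_mul_of_nonneg_left ?_ h2.le)
  linarith

theorem le_neg_log_one_sub {y : ℝ} (hy0 : 0 ≤ y) (hy : y < 1) :
    y + y ^ 2 / 2 ≤ -Real.log (1 - y) := by
  have h := Real.hasSum_pow_div_log_of_abs_lt_one (x := y) (by rwa [abs_of_nonneg hy0])
  have h1 := sum_le_hasSum (Finset.range 2) (fun i _ => by positivity) h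
  norm_num [Finset.sum_range_succ] at h1
  exact h1

/-- Monotonicity in ε. The numbers ε₀, s, D, B and q majorize ε, (n - 1) ε, `entryBound` / ε,
`rowBound` / ε and the quantity subtracted from 1 in the first logarithm. Keeping s apart from ε₀ is
what allows estimates uniform in n. -/
theorem logBound_le {n : ℕ} {ε F ε₀ s D B q c₁ c₂ : ℝ} (hn : 1 ≤ n) (hε : 0 ≤ ε) (hε₀ : ε ≤ ε₀)
    (hs : (n - 1) * ε ≤ s) (hF : 0 ≤ F) (hεF : ε₀ * F < 1)
    (hD : 2 * F + 3 / 4 * F ^ 2 + ε₀ * (2 * F ^ 2 + 1 / 4 * F ^ 3) ≤ D * (1 - ε₀ * F) ^ 2)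
    (hB : 2 * (1 + ε₀ * F) + 2 * ε₀ * F + 3 / 2 * F + 3 / 4 * ε₀ * F ^ 2 ≤ B)
    (hsD : s * D < 1) (hq : s * B * F ≤ q * (1 - ε₀ * F) * (1 - s * D)) (hq1 : q < 1)
    (hc₁ : -Real.log (1 - q) ≤ c₁) (hc₂ : -Real.log (1 - ε₀ * F) ≤ c₂) :
    ε * F < 1 ∧ (n - 1) * entryBound ε F F < 1 ∧ (n - 1) * rowBound ε F * ratioBound n ε F < 1 ∧
      logBound n ε F ≤ s * D / (1 - s * D) * (ε₀ * D) + c₁ + 2 * c₂ := by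
  have hn' : (0 : ℝ) ≤ n - 1 := by
    have : (1 : ℝ) ≤ n := by exact_mod_cast hn
    linarith
  have hs0 : 0 ≤ s := (mul_nonneg hn' hε).trans hs
  have hε₀0 := hε.trans hε₀
  have h1 : ε * F ≤ ε₀ * F := by gcongr
  have h2 : 0 < 1 - ε₀ * F := by linarith
  have h3 : 0 < 1 - ε * F := by linarith
  have hD0 : 0 ≤ D := by
    by_contra! h
    have h4 : D * (1 - ε₀ * F) ^ 2 < 0 := mul_neg_of_neg_of_pos h (by positivity)
    have h5 : 0 ≤ 2 * F + 3 / 4 * F ^ 2 + ε₀ * (2 * F ^ 2 + 1 / 4 * F ^ 3) := by positivity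
    linarith
  have hB0 : 0 ≤ B := le_trans (by positivity) hB
  have hDε : (2 * F + 3 / 4 * F ^ 2 + ε * (2 * F ^ 2 + 1 / 4 * F ^ 3)) / (1 - ε * F) ^ 2 ≤ D := by
    rw [div_le_iff₀ (by positivity)]
    refine le_trans ?_ (hD.trans ?_) <;> gcongr
  have hentry : entryBound ε F F = ε *
      ((2 * F + 3 / 4 * F ^ 2 + ε * (2 * F ^ 2 + 1 / 4 * F ^ 3)) / (1 - ε * F) ^ 2) := by
    rw [entryBound]; ring
  have he0 : 0 ≤ entryBound ε F F := by rw [entryBound]; positivity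
  have he1 : entryBound ε F F ≤ ε₀ * D := by
    rw [hentry]; gcongr
  have he2 : (n - 1) * entryBound ε F F ≤ s * D := by
    rw [hentry, ← mul_assoc]; gcongr
  have hrow : (n - 1) * rowBound ε F ≤ s * B := by
    rw [rowBound, ← mul_assoc]
    gcongr
    refine le_trans ?_ hB
    gcongr
  have hrow0 : 0 ≤ (n - 1) * rowBound ε F := by
    rw [rowBound]; positivity
  have hsD' : 0 < 1 - s * D := by linarith
  have hratio : ratioBound n ε F ≤ F / (1 - ε₀ * F) / (1 - s * D) := by
    rw [ratioBound]
    gcongr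
  have hqq : (n - 1) * rowBound ε F * ratioBound n ε F ≤ q := by
    have h4 : (n - 1) * rowBound ε F * ratioBound n ε F ≤
        s * B * (F / (1 - ε₀ * F) / (1 - s * D)) := by
      refine mul_le_mul hrow hratio ?_ (by positivity)
      rw [ratioBound]
      exact div_nonneg (div_nonneg hF h3.le) (by linarith)
    refine h4.trans ?_
    rw [← mul_div_assoc, ← mul_div_assoc, div_div, div_le_iff₀ (by positivity)]
    linarith
  refine ⟨by linarith, by linarith, by linarith, ?_⟩
  have hl1 : Real.log (1 - q) ≤ Real.log (1 - (n - 1) * rowBound ε F * ratioBound n ε F) :=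
    Real.log_le_log (by linarith) (by linarith)
  have hl2 : Real.log (1 - ε₀ * F) ≤ Real.log (1 - ε * F) :=
    Real.log_le_log h2 (by linarith)
  have hl3 : (n - 1) * entryBound ε F F / (1 - (n - 1) * entryBound ε F F) * entryBound ε F F ≤
      s * D / (1 - s * D) * (ε₀ * D) := by
    have h4 : 0 ≤ s * D / (1 - s * D) := by positivity
    gcongr
  rw [logBound]
  linarith

theorem artanh_nine_tenths_le : Real.artanh (9 / 10) ≤ 37 / 25 := by
  rw [artanh_eq (by norm_num) (by norm_num), ← Real.log_div (by norm_num) (by norm_num)]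
  have h1 := Real.sum_le_exp_of_nonneg (x := 37 / 50) (by norm_num) 5
  norm_num [Finset.sum_range_succ, Nat.factorial] at h1
  have h2 : (19 : ℝ) ≤ Real.exp (2 * (37 / 25)) := by
    rw [show (2 * (37 / 25) : ℝ) = (4 : ℕ) * (37 / 50) by norm_num, Real.exp_nat_mul]
    refine le_trans ?_ (pow_le_pow_left₀ (by norm_num) h1 4)
    norm_num
  have h3 := (Real.log_le_iff_le_exp (by norm_num)).2 h2
  norm_num at h3 ⊢
  linarith

theorem le_neg_log_of_nine_tenths_le {t : ℝ} (ht : 9 / 10 ≤ t) (ht1 : t < 1) :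
    33 / 20 ≤ -Real.log (1 - t ^ 2) := by
  have h0 : 0 < 1 - t ^ 2 := by nlinarith
  have h1 : Real.log (1 - t ^ 2) ≤ Real.log (19 / 100) :=
    Real.log_le_log h0 (by nlinarith)
  have h2 : (33 / 20 : ℝ) ≤ Real.log (100 / 19) := by
    rw [Real.le_log_iff_exp_le (by norm_num)]
    refine le_of_pow_le_pow_left₀ (n := 20) (by norm_num) (by norm_num) ?_
    rw [← Real.exp_nat_mul, show ((20 : ℕ) * (33 / 20) : ℝ) = (33 : ℕ) * 1 by norm_num,
      Real.exp_nat_mul]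
    refine (pow_le_pow_left₀ (Real.exp_pos _).le Real.exp_one_lt_d9.le 33).trans ?_
    norm_num
  have h3 : Real.log (19 / 100) = -Real.log (100 / 19) := by
    rw [← Real.log_inv]; norm_num
  linarith

theorem artanh_le_log {t : ℝ} (ht0 : 0 ≤ t) (ht : t < 1) :
    Real.artanh t ≤ Real.log 2 + -Real.log (1 - t ^ 2) / 2 := by
  have h1 : Real.log (1 - t ^ 2) = Real.log (1 + t) + Real.log (1 - t) := by
    rw [← Real.log_mul (by linarith) (by linarith)]; ring_nf
  have h2 : Real.log (1 + t) ≤ Real.log 2 := Real.log_le_log (by linarith) (by linarith)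
  rw [artanh_eq (by linarith) ht, h1]
  linarith

/-- Here 1.0935 = 1.35 · (9/10)², so the Schwarz–Pick data are H = 1.35 Q and a = 0.53 Q on radius
9/10. The comparison uses -log(1 - t²) ≥ t² + t⁴/2. -/
theorem schwarzPick_bound_le {Q t : ℝ} (hQ : 0 < Q) (ht0 : 0 ≤ t) (ht : t < 9 / 10) :
    t ^ 2 * (1.0935 * Q / (9 / 10) / (9 / 10) *
      (0.53 * Q + 1.0935 * Q / (9 / 10) / (9 / 10) * (t / (9 / 10))) /
        (1.0935 * Q / (9 / 10) / (9 / 10) + 0.53 * Q * (t / (9 / 10)))) ≤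
      Q * -Real.log (1 - t ^ 2) := by
  have hK : 1.0935 * Q / (9 / 10) / (9 / 10) = 1.35 * Q := by ring
  rw [hK]
  set x := t / (9 / 10) with hx
  have hx0 : 0 ≤ x := by positivity
  have hx1 : x ≤ 1 := by rw [hx, div_le_one (by norm_num)]; exact ht.le
  have htx : t = 9 / 10 * x := by rw [hx]; ring
  have h1 : 1.35 * Q * (0.53 * Q + 1.35 * Q * x) / (1.35 * Q + 0.53 * Q * x) ≤
      Q * (1 + t ^ 2 / 2) := by
    rw [div_le_iff₀ (by positivity), htx]
    -- A cubic inequality, tightest near x = 0.8; the squares in the hint are centered there.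
    have h2 : 1.35 * (0.53 + 1.35 * x) ≤ (1 + (9 / 10 * x) ^ 2 / 2) * (1.35 + 0.53 * x) := by
      nlinarith [mul_nonneg (by linarith : 0 ≤ x + 1.6) (sq_nonneg (x - 0.8)),
        sq_nonneg (x - 0.805)]
    have h3 := mul_le_mul_of_nonneg_left h2 (sq_nonneg Q)
    linarith
  have h4 := le_neg_log_one_sub (y := t ^ 2) (by positivity) (by nlinarith)
  calc _ ≤ t ^ 2 * (Q * (1 + t ^ 2 / 2)) := by gcongr
    _ = Q * (t ^ 2 + (t ^ 2) ^ 2 / 2) := by ring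
    _ ≤ _ := by gcongr

end Numerics

/-! ### Numerical verification for n = 2 and for n ≥ 3 -/

namespace LinearSystem

variable {n : ℕ} {L : LinearSystem n} {ε : ℝ}

theorem Regular.mono (hR : L.Regular ε) {ε' : ℝ} (h : ε ≤ ε') : L.Regular ε' :=
  { hR with bound := fun z hz m l => (hR.bound z hz m l).trans h }

/-- The growth estimate, given numerical bounds on the disks of radius `9/10` and `1`. -/
theorem Regular.abs_log_le_of_logBound_le [Nontrivial (Fin n)] (hR : L.Regular ε) (hε : 0 ≤ ε)
    {κ F F₁ c : ℝ} (hκ : 3 / 2 * ε ≤ κ) (hκ1 : κ < 1)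
    (hF : (1 + 9 / 10) ^ κ * (1 - (1 - 9 / 10) ^ (1 - κ)) / (1 - κ) ≤ F)
    (hF₁ : (1 + 1) ^ κ / (1 - κ) ≤ F₁)
    (hc : n * c ≤ (n + 1) * √n / 2) (hεc : 3 / 2 * ε ≤ c)
    (h : ε * F < 1 ∧ (n - 1) * entryBound ε F F < 1 ∧
      (n - 1) * rowBound ε F * ratioBound n ε F < 1 ∧
      logBound n ε F + 3 * ε * (37 / 25) ≤ 1.0935 * c)
    (h₁ : ε * F₁ < 1 ∧ (n - 1) * entryBound ε F₁ F₁ < 1 ∧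
      (n - 1) * rowBound ε F₁ * ratioBound n ε F₁ < 1 ∧
      logBound n ε F₁ + 3 * ε * Real.log 2 ≤ (c - 3 / 2 * ε) * (33 / 20))
    (ha : √n * ((2.61 * ε + 2 * ε ^ 2) + (n - 1) * (2 * ε + ε ^ 2)) ≤ 0.53)
    {u : (Fin n → ℂ) → ℂ} (hu : L.IsSolution u) (hu0 : u 0 = 1) (hu1 : ∀ i, pderiv i u 0 = 0)
    {z : Fin n → ℂ} (hz : z ∈ polydisk n) :
    u z ≠ 0 ∧ |Real.log ‖u z‖| ≤ √n / 2 * -Real.log (1 - ‖z‖ ^ 2) := by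
  have hz1 := mem_polydisk_iff_norm.1 hz
  have hn : (0 : ℝ) < n := by
    obtain ⟨i, -⟩ := exists_pair_ne (Fin n)
    exact_mod_cast i.pos
  have hsq : √(n : ℝ) * √n = n := Real.mul_self_sqrt hn.le
  have hsn : 0 < √(n : ℝ) := Real.sqrt_pos.2 hn
  have hκ0 : 0 ≤ κ := le_trans (by positivity) hκ
  set Q : ℝ := (n + 1) * √n / 2 with hQ
  have hQ0 : 0 < Q := by positivity
  have key : u z ≠ 0 ∧ (n + 1) * |Real.log ‖u z‖| ≤ Q * -Real.log (1 - ‖z‖ ^ 2) := by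
    -- Inside radius 9/10 the second order vanishing at 0 is used. Outside, -log(1 - |z|²) ≥ 33/20
    -- is large enough to absorb the constant term of the growth bound.
    rcases lt_or_ge ‖z‖ (9 / 10) with hlt | hge
    · have hK : n * (logBound n ε F + 3 * ε * Real.artanh (9 / 10)) ≤ 1.0935 * Q := by
        have h1 : 3 * ε * Real.artanh (9 / 10) ≤ 3 * ε * (37 / 25) :=
          mul_le_mul_of_nonneg_left artanh_nine_tenths_le (by linarith)
        have h2 := mul_le_mul_of_nonneg_left ((add_le_add_right h1 _).trans h.2.2.2) hn.le
        linarith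
      have ha' : (n + 1) / 2 * (n * (2.61 * ε + 2 * ε ^ 2) + n * (n - 1) * (2 * ε + ε ^ 2)) ≤
          0.53 * Q := by
        have h1 := mul_le_mul_of_nonneg_left ha hQ0.le
        refine le_trans (le_of_eq ?_) (h1.trans_eq (mul_comm _ _))
        rw [hQ]
        linear_combination -(n + 1) / 2 * ((2.61 * ε + 2 * ε ^ 2) + (n - 1) * (2 * ε + ε ^ 2)) * hsq
      have h3 := hR.abs_log_le_sq (r := 9 / 10) (by norm_num) (by norm_num) hε
        (growthMajorant_rpow (by norm_num) (by norm_num) hκ0 hκ hκ1 hF)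
        (monotoneOn_majorant (by norm_num) (by norm_num) hκ1)
        (monotoneOn_majorant_deriv (by norm_num) (by norm_num) hκ0) h.1 h.2.1 h.2.2.1 hu hu0 hu1
        hK ha' (by
          rw [show 1.0935 * Q / (9 / 10) / (9 / 10) = 1.35 * Q by ring]
          linarith) hlt
      exact ⟨h3.1, h3.2.trans (schwarzPick_bound_le hQ0 (norm_nonneg z) hlt)⟩
    · have h3 := hR.abs_log_le (r := 1) le_rfl one_pos hε
        (growthMajorant_rpow (κ := κ) (F := F₁) one_pos le_rfl hκ0 hκ hκ1 (by
          rw [sub_self, Real.zero_rpow (by linarith), sub_zero, mul_one]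
          exact hF₁))
        (monotoneOn_majorant one_pos le_rfl hκ1) (monotoneOn_majorant_deriv one_pos le_rfl hκ0)
        h₁.1 h₁.2.1 h₁.2.2.1 hu hu0 hu1 hz1
      refine ⟨h3.1, h3.2.trans ?_⟩
      have h4 := artanh_le_log (norm_nonneg z) hz1
      have h5 := le_neg_log_of_nine_tenths_le hge hz1
      set Λ := -Real.log (1 - ‖z‖ ^ 2) with hΛ
      have h6 : 3 * ε * Real.artanh ‖z‖ ≤ 3 * ε * (Real.log 2 + Λ / 2) :=
        mul_le_mul_of_nonneg_left h4 (by linarith)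
      have h7 : (c - 3 / 2 * ε) * (33 / 20) ≤ (c - 3 / 2 * ε) * Λ :=
        mul_le_mul_of_nonneg_left h5 (by linarith)
      have h8 : logBound n ε F₁ + 3 * ε * Real.artanh ‖z‖ ≤ c * Λ := by linarith [h₁.2.2.2]
      have h9 := mul_le_mul_of_nonneg_left h8 hn.le
      have h10 := mul_le_mul_of_nonneg_right hc (by linarith : 0 ≤ Λ)
      linarith
  refine ⟨key.1, ?_⟩
  have h1 : Q * -Real.log (1 - ‖z‖ ^ 2) = (n + 1) * (√n / 2 * -Real.log (1 - ‖z‖ ^ 2)) := by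
    rw [hQ]; ring
  rw [h1] at key
  exact le_of_mul_le_mul_left key.2 (by positivity)

/-- 0.071 is slightly above √(3/2) / (6.1 · 2√2). The choice κ = 1/9 exceeds 3/2 · 0.071, and c =
1.06 lies just below 3√2/4. -/
theorem abs_log_le_of_two {L : LinearSystem 2} (hR : L.Regular 0.071)
    {u : (Fin 2 → ℂ) → ℂ} (hu : L.IsSolution u) (hu0 : u 0 = 1) (hu1 : ∀ i, pderiv i u 0 = 0)
    {z : Fin 2 → ℂ} (hz : z ∈ polydisk 2) :
    u z ≠ 0 ∧ |Real.log ‖u z‖| ≤ √(2 : ℕ) / 2 * -Real.log (1 - ‖z‖ ^ 2) := by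
  have hlog2 := Real.log_two_lt_d9
  have hs1 : √(2 : ℝ) ≤ 1.4143 := Real.sqrt_le_iff.2 ⟨by norm_num, by norm_num⟩
  have hs0 : 1.4142 ≤ √(2 : ℝ) := Real.le_sqrt_of_sq_le (by norm_num)
  have e1 : (1 / 9 : ℝ) = ((1 : ℕ) : ℝ) / (9 : ℕ) := by norm_num
  have e2 : (1 - 1 / 9 : ℝ) = ((8 : ℕ) : ℝ) / (9 : ℕ) := by norm_num
  have hF : ((1 : ℝ) + 9 / 10) ^ (1 / 9 : ℝ) * (1 - (1 - 9 / 10) ^ (1 - 1 / 9 : ℝ)) / (1 - 1 / 9) ≤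
      1.053 := by
    have h1 : ((1 : ℝ) + 9 / 10) ^ (1 / 9 : ℝ) ≤ 1.074 := by
      rw [e1]; exact rpow_div_le (by norm_num) (by norm_num) (by norm_num) (by norm_num)
    have h2 : 0.129 ≤ ((1 : ℝ) - 9 / 10) ^ (1 - 1 / 9 : ℝ) := by
      rw [e2]; exact le_rpow_div (by norm_num) (by norm_num) (by norm_num) (by norm_num)
    rw [div_le_iff₀ (by norm_num)]
    have h3 : 0 ≤ ((1 : ℝ) + 9 / 10) ^ (1 / 9 : ℝ) := by positivity
    nlinarith
  have hF₁ : ((1 : ℝ) + 1) ^ (1 / 9 : ℝ) / (1 - 1 / 9) ≤ 1.216 := by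
    have h1 : ((1 : ℝ) + 1) ^ (1 / 9 : ℝ) ≤ 1.0808 := by
      rw [e1]; exact rpow_div_le (by norm_num) (by norm_num) (by norm_num) (by norm_num)
    rw [div_le_iff₀ (by norm_num)]
    linarith
  have hb := logBound_le (n := 2) (ε := 0.071) (F := 1.053) (ε₀ := 0.071) (s := 0.071) (D := 3.64)
    (B := 3.938) (q := 0.43) (c₁ := 0.57) (c₂ := 0.08) (by norm_num) (by norm_num) le_rfl
    (by norm_num) (by norm_num) (by norm_num) (by norm_num) (by norm_num) (by norm_num)
    (by norm_num) (by norm_num) (neg_log_le (by norm_num) (by norm_num) (by norm_num))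
    (neg_log_le (by norm_num) (by norm_num) (by norm_num))
  have hb₁ := logBound_le (n := 2) (ε := 0.071) (F := 1.216) (ε₀ := 0.071) (s := 0.071) (D := 4.532)
    (B := 4.249) (q := 0.595) (c₁ := 0.91) (c₂ := 0.092) (by norm_num) (by norm_num) le_rfl
    (by norm_num) (by norm_num) (by norm_num) (by norm_num) (by norm_num) (by norm_num)
    (by norm_num) (by norm_num) (neg_log_le (by norm_num) (by norm_num) (by norm_num))
    (neg_log_le (by norm_num) (by norm_num) (by norm_num))
  refine hR.abs_log_le_of_logBound_le (κ := 1 / 9) (F := 1.053) (F₁ := 1.216) (c := 1.06)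
    (by norm_num) (by norm_num) (by norm_num) hF hF₁ ?_ (by norm_num)
    ⟨hb.1, hb.2.1, hb.2.2.1, ?_⟩ ⟨hb₁.1, hb₁.2.1, hb₁.2.2.1, ?_⟩ ?_ hu hu0 hu1 hz
  · push_cast; linarith
  · have := hb.2.2.2
    norm_num at this ⊢
    linarith
  · have := hb₁.2.2.2
    norm_num at this ⊢
    linarith
  · push_cast
    refine (mul_le_mul_of_nonneg_right hs1 (by norm_num)).trans ?_
    norm_num

/-- 0.2319 is slightly above √2 / 6.1. All constants are taken at the worst case n = 3. -/
theorem abs_log_le_of_three_le (hn : 3 ≤ n) (hR : L.Regular (0.2319 / (n * √n)))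
    {u : (Fin n → ℂ) → ℂ} (hu : L.IsSolution u) (hu0 : u 0 = 1) (hu1 : ∀ i, pderiv i u 0 = 0)
    {z : Fin n → ℂ} (hz : z ∈ polydisk n) :
    u z ≠ 0 ∧ |Real.log ‖u z‖| ≤ √n / 2 * -Real.log (1 - ‖z‖ ^ 2) := by
  have : Nontrivial (Fin n) := Fin.nontrivial_iff_two_le.2 (by omega)
  have hn3 : (3 : ℝ) ≤ n := by exact_mod_cast hn
  have hsq : √(n : ℝ) * √n = n := Real.mul_self_sqrt (by linarith)
  have hs0 : 1.732 ≤ √(n : ℝ) := Real.le_sqrt_of_sq_le (by linarith)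
  set x := √(n : ℝ) with hx
  set ε : ℝ := 0.2319 / (n * x) with hε
  have hnx : 0 < n * x := by positivity
  have hε0 : 0 ≤ ε := by positivity
  have hε1 : ε ≤ 0.0447 := by
    rw [hε, div_le_iff₀ hnx]
    nlinarith
  -- With x = √n this bounds (x² - 1)/x³, whose maximum is at x = √3; the cubic below has a double
  -- root at 1.732.
  have hε2 : (n - 1) * ε ≤ 0.0893 := by
    rw [hε, ← mul_div_assoc, div_le_iff₀ hnx, ← hsq]
    have h1 : 0 ≤ (x - 1.732) ^ 2 * (x + 0.866) := by positivity
    nlinarith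
  have hxε : n * (x * ε) = 0.2319 := by
    rw [hε]; field_simp
  have hlog2 := Real.log_two_lt_d9
  have e1 : (1 / 14 : ℝ) = ((1 : ℕ) : ℝ) / (14 : ℕ) := by norm_num
  have e2 : (1 - 1 / 14 : ℝ) = ((13 : ℕ) : ℝ) / (14 : ℕ) := by norm_num
  have hF : ((1 : ℝ) + 9 / 10) ^ (1 / 14 : ℝ) * (1 - (1 - 9 / 10) ^ (1 - 1 / 14 : ℝ)) /
      (1 - 1 / 14) ≤ 0.996 := by
    have h1 : ((1 : ℝ) + 9 / 10) ^ (1 / 14 : ℝ) ≤ 1.047 := by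
      rw [e1]; exact rpow_div_le (by norm_num) (by norm_num) (by norm_num) (by norm_num)
    have h2 : 0.1178 ≤ ((1 : ℝ) - 9 / 10) ^ (1 - 1 / 14 : ℝ) := by
      rw [e2]; exact le_rpow_div (by norm_num) (by norm_num) (by norm_num) (by norm_num)
    rw [div_le_iff₀ (by norm_num)]
    have h3 : 0 ≤ ((1 : ℝ) + 9 / 10) ^ (1 / 14 : ℝ) := by positivity
    nlinarith
  have hF₁ : ((1 : ℝ) + 1) ^ (1 / 14 : ℝ) / (1 - 1 / 14) ≤ 1.132 := by
    have h1 : ((1 : ℝ) + 1) ^ (1 / 14 : ℝ) ≤ 1.051 := by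
      rw [e1]; exact rpow_div_le (by norm_num) (by norm_num) (by norm_num) (by norm_num)
    rw [div_le_iff₀ (by norm_num)]
    linarith
  have hb := logBound_le (n := n) (F := 0.996) (D := 3.107) (B := 3.706) (q := 0.48) (c₁ := 0.66)
    (c₂ := 0.047) (by omega) hε0 hε1 hε2
    (by norm_num) (by norm_num) (by norm_num) (by norm_num) (by norm_num)
    (by norm_num) (by norm_num) (neg_log_le (by norm_num) (by norm_num) (by norm_num))
    (neg_log_le (by norm_num) (by norm_num) (by norm_num))
  have hb₁ := logBound_le (n := n) (F := 1.132) (D := 3.724) (B := 3.944) (q := 0.632)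
    (c₁ := 1.01) (c₂ := 0.053) (by omega) hε0 hε1 hε2
    (by norm_num) (by norm_num) (by norm_num) (by norm_num) (by norm_num)
    (by norm_num) (by norm_num) (neg_log_le (by norm_num) (by norm_num) (by norm_num))
    (neg_log_le (by norm_num) (by norm_num) (by norm_num))
  refine hR.abs_log_le_of_logBound_le hε0 (κ := 1 / 14) (F := 0.996) (F₁ := 1.132) (c := 1.154)
    (by linarith) (by norm_num) hF hF₁ ?_ (by linarith)
    ⟨hb.1, hb.2.1, hb.2.2.1, ?_⟩ ⟨hb₁.1, hb₁.2.1, hb₁.2.2.1, ?_⟩ ?_ hu hu0 hu1 hz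
  -- (n + 1)/(2√n) increases with n, and at n = 3 it is 2/√3 > 1.154.
  · rw [← hx, ← hsq]
    nlinarith [mul_nonneg (by linarith : 0 ≤ x) (by nlinarith : 0 ≤ x ^ 2 - 2.308 * x + 1)]
  · have := hb.2.2.2
    norm_num at this ⊢
    linarith
  · have := hb₁.2.2.2
    have h2 : 3 * ε * Real.log 2 ≤ 3 * ε * 0.6932 :=
      mul_le_mul_of_nonneg_left (by linarith) (by linarith)
    norm_num at this h2 ⊢
    linarith
  · have hy : x * ε ≤ 0.0773 := by nlinarith [mul_nonneg (by linarith : 0 ≤ x) hε0]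
    have hy0 : 0 ≤ x * ε := by positivity
    have hye : x * ε * ε ≤ 0.0773 * 0.0447 := mul_le_mul hy hε1 hε0 (by norm_num)
    have hyn : n * (x * ε * ε) ≤ 0.2319 * 0.0447 := by
      rw [← mul_assoc, hxε]; exact mul_le_mul_of_nonneg_left hε1 (by norm_num)
    rw [← hx]
    linarith

end LinearSystem

end PolydiskSchwarzian

end

theorem theorem3p10 (n : ℕ) (hn : 2 ≤ n) (L : PolydiskSchwarzian.LinearSystem n)
    (hhol : L.HasHolomorphicCoeffs) (hint : L.CompletelyIntegrable) (hcan : L.IsCanonical)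
    (α : ℝ≥0) (hnorm : L.opNorm ≤ (α : ℝ≥0∞))
    (hα : (n : ℝ) * √(n : ℝ) * (α : ℝ) ≤ 1 / 6.1)
    (u : (Fin n → ℂ) → ℂ) (hu : L.IsSolution u) (hu0 : u 0 = 1)
    (hdu0 : ∀ i, PolydiskSchwarzian.pderiv i u 0 = 0)
    (z : Fin n → ℂ) (hz : z ∈ PolydiskSchwarzian.polydisk n) :
    (1 - ‖z‖ ^ 2) ^ (√(n : ℝ) / 2) ≤ ‖u z‖ ∧
      ‖u z‖ ≤ 1 / (1 - ‖z‖ ^ 2) ^ (√(n : ℝ) / 2) := by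
  have hR := PolydiskSchwarzian.LinearSystem.CompletelyIntegrable.regular hhol hint hcan hnorm
  have hα0 : (0 : ℝ) ≤ α := α.2
  have key : u z ≠ 0 ∧ |Real.log ‖u z‖| ≤ √n / 2 * -Real.log (1 - ‖z‖ ^ 2) := by
    rcases hn.eq_or_lt with rfl | hn3
    · refine PolydiskSchwarzian.LinearSystem.abs_log_le_of_two ((hR.of_two hnorm).mono ?_)
        hu hu0 hdu0 hz
      have hs0 : 1.4142 ≤ √(2 : ℝ) := Real.le_sqrt_of_sq_le (by norm_num)
      have hs1 : √(3 / 2 : ℝ) ≤ 1.2248 := Real.sqrt_le_iff.2 ⟨by norm_num, by norm_num⟩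
      have h1 : (α : ℝ) ≤ 0.057965 := by
        push_cast at hα
        nlinarith
      refine (mul_le_mul hs1 h1 hα0 (by norm_num)).trans ?_
      norm_num
    · refine PolydiskSchwarzian.LinearSystem.abs_log_le_of_three_le hn3 (hR.mono ?_) hu hu0 hdu0 hz
      have hs1 : √(2 : ℝ) ≤ 1.41422 := Real.sqrt_le_iff.2 ⟨by norm_num, by norm_num⟩
      have hn0 : (0 : ℝ) < n := by exact_mod_cast (by omega : 0 < n)
      rw [le_div_iff₀ (by positivity)]
      have h1 : √2 * (α : ℝ) * (n * √n) = √2 * (n * √n * α) := by ring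
      rw [h1]
      refine (mul_le_mul hs1 hα (by positivity) (by norm_num)).trans ?_
      norm_num
  have hz1 := PolydiskSchwarzian.mem_polydisk_iff_norm.1 hz
  have hpos : 0 < 1 - ‖z‖ ^ 2 := by nlinarith [norm_nonneg z]
  have hupos : 0 < ‖u z‖ := norm_pos_iff.2 key.1
  have habs := abs_le.1 key.2
  rw [one_div, ← Real.rpow_neg hpos.le, Real.rpow_def_of_pos hpos, Real.rpow_def_of_pos hpos,
    ← Real.le_log_iff_exp_le hupos, ← Real.log_le_iff_le_exp hupos]
  constructor <;> linarith
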